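/- Let $C$ be a finite (geometric) polytopal complex in $\mathbb{R}^d$ with $d\ge 3$, or a finite (geometric) simplicial complex in $\mathbb{R}^2$ (in which case $d=2$). Suppose that the underlying space $|C|$, the union of the faces of $C$, is star-shaped: there is a point $x\in|C|$ such that $[x,y]\subseteq|C|$ for every $y\in|C|$. Then every $(d-2)$-nd derived subdivision $\operatorname{sd}^{d-2}C$ of $C$ is a simplicial complex that is non-evasive and, in particular, collapsible. Here a polytopal complex is a collection of polytopes, closed under passing to faces (including the empty face), such that the intersection of any two of them is a face of both; it is simplicial if all its faces are simplices. For a nonempty face $\tau$ of a complex $K$, the deletion $K-\tau$ is the subcomplex of all faces not containing $\tau$, and the star $\mathrm{St}(\tau,K)$ is the subcomplex of all faces of faces containing $\tau$. The stellar subdivision of $K$ at $\tau$, with new vertex $v_\tau$ anywhere in the relative interior of $\tau$, is $(K-\tau)\cup\{\operatorname{conv}(\{v_\tau\}\cup\sigma):\sigma\in \mathrm{St}(\tau,K)-\tau\}$. A derived subdivision $\operatorname{sd}K$ is any complex obtained from $K$ by stellar subdivisions at all nonempty faces of $K$ in order of non-increasing dimension; $\operatorname{sd}^0K=K$ and $\operatorname{sd}^{r+1}K=\operatorname{sd}(\operatorname{sd}^rK)$.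 A simplicial complex is non-evasive if it is a single point or, recursively, if it has a vertex $v$ whose link $\mathrm{St}(v,K)-v$ and deletion $K-v$ are both non-evasive. An elementary collapse replaces $K$ by $K-\sigma$, where $\sigma$ is a nonempty face strictly contained in exactly one other face of $K$; $K$ is collapsible if a sequence of elementary collapses reduces it to a single vertex. -/

import Mathlib

namespace PolytopalComplex

variable {E : Type*} [NormedAddCommGroup E] [NormedSpace ℝ E]

/-- A polytope: the convex hull of finitely many points (the empty set is a polytope). -/
def IsPolytope (P : Set E) : Prop :=
  ∃ s : Finset E, P = convexHull ℝ (s : Set E)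

/-- A simplex: the convex hull of finitely many affinely independent points. -/
def IsSimplex (P : Set E) : Prop :=
  ∃ s : Finset E, AffineIndependent ℝ ((↑) : s → E) ∧ P = convexHull ℝ (s : Set E)

/-- A finite geometric polytopal complex, given as its set of faces (polytopes in `E`). The faces of
a polytope `P` are the sets `F` with `IsExposed ℝ P F`, i.e. the empty set and the sets of
maximizers over `P` of linear functionals; so `P` is a face of itself, and the empty face belongs to
every nonempty complex. -/
structure IsPolytopalComplex (K : Set (Set E)) : Prop where
  finite : K.Finite
  isPolytope : ∀ P ∈ K, IsPolytope P
  face_mem : ∀ P ∈ K, ∀ F, IsExposed ℝ P F → F ∈ K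
  inter_face : ∀ P ∈ K, ∀ Q ∈ K, IsExposed ℝ P (P ∩ Q) ∧ IsExposed ℝ Q (P ∩ Q)

/-- A (finite, geometric) simplicial complex: a polytopal complex all of whose faces are
simplices. -/
def IsSimplicialComplex (K : Set (Set E)) : Prop :=
  IsPolytopalComplex K ∧ ∀ P ∈ K, IsSimplex P

/-- The underlying space `|K|`: the union of the faces. -/
def space (K : Set (Set E)) : Set E := ⋃₀ K

/-- `X` is star-shaped: some point `x` of `X` is a star-center. -/
def IsStarShaped (X : Set E) : Prop := ∃ x ∈ X, StarConvex ℝ x X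

/-- The deletion `K - τ` of a nonempty face `τ`: the subcomplex of the faces not containing `τ`
(in a polytopal complex: the faces disjoint from the relative interior of `τ`). -/
def deletion (K : Set (Set E)) (τ : Set E) : Set (Set E) := {σ ∈ K | ¬ τ ⊆ σ}

/-- The star `St(τ, K)`: the smallest subcomplex containing all faces that contain `τ`. -/
def star (K : Set (Set E)) (τ : Set E) : Set (Set E) := {σ ∈ K | ∃ ρ ∈ K, τ ⊆ ρ ∧ σ ⊆ ρ}

/-- The stellar subdivision `st(τ, K)` at the face `τ` with new vertex `v`:
`(K - τ) ∪ {conv ({v} ∪ σ) : σ ∈ St(τ, K) - τ}`. -/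
def stellar (K : Set (Set E)) (τ : Set E) (v : E) : Set (Set E) :=
  deletion K τ ∪ {ρ | ∃ σ ∈ deletion (star K τ) τ, ρ = convexHull ℝ (insert v σ)}

/-- The dimension of a nonempty polytope: that of its affine span. -/
noncomputable def dim (P : Set E) : ℕ := Module.finrank ℝ (vectorSpan ℝ P)

/-- `D` is a derived subdivision of `K`: it is obtained from `K` by stellar subdivisions at all
nonempty faces `τ` of `K`, in some order of non-increasing dimension, where the new vertex `p τ` is
an arbitrary point in the relative interior of `τ`. -/
def IsDerivedSubdivision (K D : Set (Set E)) : Prop :=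
  ∃ (l : List (Set E)) (p : Set E → E),
    l.Nodup ∧ (∀ τ, τ ∈ l ↔ τ ∈ K ∧ τ.Nonempty) ∧
    l.Pairwise (fun τ τ' => dim τ' ≤ dim τ) ∧
    (∀ τ ∈ l, p τ ∈ intrinsicInterior ℝ τ) ∧
    D = l.foldl (fun L τ => stellar L τ (p τ)) K

/-- `D` is an `r`-th derived subdivision `sd^r K` of `K`. -/
def IsIteratedDerived : ℕ → Set (Set E) → Set (Set E) → Prop
  | 0, K, D => D = K
  | r + 1, K, D => ∃ D', IsIteratedDerived r K D' ∧ IsDerivedSubdivision D' D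

/-- The link of a vertex `v` of a simplicial complex, as the subcomplex `St(v, K) - v`. -/
def link (K : Set (Set E)) (v : E) : Set (Set E) := deletion (star K {v}) {v}

/-- Non-evasiveness of a simplicial complex: a single point is non-evasive, and a complex is
non-evasive if it has a vertex whose link and deletion are both non-evasive. The link of a vertex of
a `0`-dimensional complex is `{∅}`, which is not non-evasive, so the only `0`-dimensional
non-evasive complex is the point. -/
inductive NonEvasive : Set (Set E) → Prop
  | point (v : E) : NonEvasive {∅, {v}}
  | step (K : Set (Set E)) (v : E) (hv : {v} ∈ K) (hlink : NonEvasive (link K v))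
      (hdel : NonEvasive (deletion K {v})) : NonEvasive K

/-- `K` elementarily collapses onto `K'`: `K' = K - σ` for a free face `σ` of `K`, i.e. a nonempty
face that is strictly contained in exactly one face of `K`. -/
def ElementaryCollapse (K K' : Set (Set E)) : Prop :=
  ∃ σ ∈ K, σ.Nonempty ∧ (∃! τ, τ ∈ K ∧ σ ⊂ τ) ∧ K' = deletion K σ

/-- `K` is collapsible: a sequence of elementary collapses reduces it to a single vertex. -/
def Collapsible (K : Set (Set E)) : Prop :=
  ∃ v : E, Relation.ReflTransGen ElementaryCollapse K {∅, {v}}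

end PolytopalComplex

/-! The heart is a statement without any dimension bound: the nonempty faces of a star-shaped
complex, ordered by inclusion, have a non-evasive order complex (`IsCellComplex.posetNonEvasive`).
The proof is by induction on dimension with the star center at the origin. It treats complexes of
possibly unbounded polyhedra, because the induction produces slices of tangent cones. For a generic
linear functional ν, the cells lying in ν > 0 are removed vertex by vertex from the top
(`IsCellComplex.posetNonEvasive_of_sweep`). Once the larger cells with lowest vertex v are gone, the
link of {v} consists of the cells through v that reach below v. These correspond to a hyperplane
slice of the tangent cones at v, which is again star-shaped about 0, so induction applies. The side
ν < 0 is treated alike. The cells meeting ν = 0 are compared with the slice of the complex by ker ν,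
which is also covered by induction.

The simplices of a derived subdivision are the hulls of the chosen centers of chains of nonempty
faces (`IsDerivedSubdivision.exists_eq_image`). So one derived subdivision is already non-evasive,
and later ones remain so because barycentric subdivision preserves non-evasiveness of posets
(`PosetNonEvasive.finsetChains`). This settles d ≥ 3. Collapsibility follows from non-evasiveness by
`AbsNonEvasive.collapses`.

For d = 2 nothing is subdivided. Non-evasiveness of the order complex of the faces yields
connectedness and vanishing first cohomology mod 2, and both properties descend to the complex
itself. A plane simplicial complex with these two properties is non-evasive
(`IsEmbedded.absNonEvasive`). The link of its highest vertex in a generic direction is a graph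
ordered by slope, and embeddedness allows each of its vertices at most one lower neighbor; if
connected, this link is non-evasive. If it is disconnected, acyclicity makes the vertex a cut
vertex, and the two sides are handled by induction. Deleting a vertex with non-evasive link keeps
both properties. -/

set_option linter.unusedSectionVars false

namespace PolytopalComplex

/-! ### Non-evasive posets and their barycentric subdivision. -/

section Poset

variable {α β : Type*} [PartialOrder α] [PartialOrder β]

/-- Non-evasiveness of the order complex of a set `Q` of elements of a partial order: the link of
`q` in the order complex of `Q` is the order complex of the elements of `Q` comparable to `q`. -/
inductive PosetNonEvasive : Set α → Prop
  | point (a : α) : PosetNonEvasive {a}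
  | step (Q : Set α) (q : α) (hq : q ∈ Q) (hlink : PosetNonEvasive {p ∈ Q | p < q ∨ q < p})
      (hdel : PosetNonEvasive (Q \ {q})) : PosetNonEvasive Q

/-- Any element other than the apex `m` can be removed, since its link and its deletion again
contain `m` and are cones over it. -/
theorem PosetNonEvasive.of_cone {Q : Set α} (hQ : Q.Finite) {m : α} (hm : m ∈ Q)
    (h : ∀ p ∈ Q, p ≤ m ∨ m ≤ p) : PosetNonEvasive Q := by
  induction hn : Q.ncard using Nat.strong_induction_on generalizing Q with
  | _ n ih =>
    by_cases hs : ∃ q ∈ Q, q ≠ m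
    · obtain ⟨q, hq, hqm⟩ := hs
      have hlt : ∀ R : Set α, R ⊆ Q → q ∉ R → R.ncard < n := fun R hR hqR => by
        rw [← hn]; exact Set.ncard_lt_ncard ⟨hR, fun h' => hqR (h' hq)⟩ hQ
      refine .step Q q hq ?_ ?_
      · have hsub : {p ∈ Q | p < q ∨ q < p} ⊆ Q := fun p hp => hp.1
        refine ih _ (hlt _ hsub fun h' => by simpa using h'.2) (hQ.subset hsub) ?_
          (fun p hp => h p hp.1) rfl
        refine ⟨hm, ?_⟩
        rcases h q hq with h1 | h1
        · exact Or.inr (lt_of_le_of_ne h1 hqm)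
        · exact Or.inl (lt_of_le_of_ne h1 hqm.symm)
      · have hsub : Q \ {q} ⊆ Q := Set.sdiff_subset
        exact ih _ (hlt _ hsub fun h' => h'.2 rfl) (hQ.subset hsub) ⟨hm, fun h' => hqm h'.symm⟩
          (fun p hp => h p hp.1) rfl
    · push Not at hs
      have : Q = {m} := Set.eq_singleton_iff_unique_mem.2 ⟨hm, hs⟩
      rw [this]; exact .point m

/-- Elements `s` of `S` can be removed from `Q` if the elements of `Q \ S` below `s` form a cone. -/
theorem PosetNonEvasive.of_diff {Q S : Set α} (hQ : Q.Finite) (hSQ : S ⊆ Q)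
    (h : ∀ s ∈ S, ∃ m ∈ Q \ S, m < s ∧ ∀ p ∈ Q \ S, p < s → p ≤ m ∨ m ≤ p)
    (hd : PosetNonEvasive (Q \ S)) : PosetNonEvasive Q := by
  induction hn : S.ncard using Nat.strong_induction_on generalizing Q S with
  | _ n ih =>
    rcases S.eq_empty_or_nonempty with rfl | hne
    · simpa using hd
    -- For minimal `s` in `S`, everything of `Q` below `s` lies outside `S` and is comparable to
    -- `m`. Everything above `s` is above `m`, so the whole link of `s` is a cone.
    obtain ⟨s, hs⟩ := (hQ.subset hSQ).exists_minimal hne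
    have hsS := hs.1
    obtain ⟨m, hm, hms, hmc⟩ := h s hsS
    have hset : (Q \ {s}) \ (S \ {s}) = Q \ S := by
      ext x
      simp only [Set.mem_sdiff, Set.mem_singleton_iff]
      constructor
      · rintro ⟨⟨h1, h2⟩, h3⟩; exact ⟨h1, fun h4 => h3 ⟨h4, h2⟩⟩
      · rintro ⟨h1, h2⟩; exact ⟨⟨h1, fun h3 => h2 (h3 ▸ hsS)⟩, fun h3 => h2 h3.1⟩
    refine .step Q s (hSQ hsS) ?_ ?_
    · refine .of_cone (hQ.subset fun p hp => hp.1) (m := m) ⟨hm.1, Or.inl hms⟩ ?_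
      rintro p ⟨hp, hps | hps⟩
      · refine hmc p ⟨hp, fun hpS => ?_⟩ hps
        exact absurd (hs.2 hpS hps.le) hps.not_ge
      · exact Or.inr (hms.trans hps).le
    · refine ih _ ?_ (hQ.subset Set.sdiff_subset) (S := S \ {s})
        (fun x hx => ⟨hSQ hx.1, hx.2⟩) ?_ (by rw [hset]; exact hd) rfl
      · rw [← hn]
        exact Set.ncard_lt_ncard ⟨Set.sdiff_subset, fun h' => (h' hsS).2 rfl⟩ (hQ.subset hSQ)
      · rw [hset]
        exact fun x hx => h x hx.1

/-- Transport runs from the image back to the source, because the induction follows the removal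
order in the image; `Q` and `φ` stay universally quantified for that reason. -/
theorem PosetNonEvasive.of_image {R : Set β} (hR : PosetNonEvasive R) :
    ∀ {Q : Set α} {φ : α → β}, φ '' Q = R → (∀ a ∈ Q, ∀ b ∈ Q, φ a ≤ φ b ↔ a ≤ b) →
      PosetNonEvasive Q := by
  induction hR with
  | point b =>
    intro Q φ h he
    obtain ⟨a, ha, rfl⟩ : b ∈ φ '' Q := h ▸ rfl
    have : Q = {a} := by
      refine Set.eq_singleton_iff_unique_mem.2 ⟨ha, fun x hx => ?_⟩
      have hx' : φ x = φ a := by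
        have : φ x ∈ φ '' Q := ⟨x, hx, rfl⟩
        rw [h] at this; exact this
      exact le_antisymm ((he _ hx _ ha).1 hx'.le) ((he _ ha _ hx).1 hx'.ge)
    rw [this]; exact .point a
  | step R r hr _ _ ih1 ih2 =>
    intro Q φ h he
    obtain ⟨q, hq, rfl⟩ : r ∈ φ '' Q := h ▸ hr
    have hlt : ∀ a ∈ Q, ∀ b ∈ Q, φ a < φ b ↔ a < b := fun a ha b hb => by
      rw [lt_iff_le_not_ge, lt_iff_le_not_ge, he a ha b hb, he b hb a ha]
    refine .step Q q hq (ih1 (φ := φ) ?_ fun a ha b hb => he a ha.1 b hb.1)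
      (ih2 (φ := φ) ?_ fun a ha b hb => he a ha.1 b hb.1)
    · subst h
      ext x; constructor
      · rintro ⟨p, ⟨hp, hpq⟩, rfl⟩
        exact ⟨⟨p, hp, rfl⟩, by rwa [hlt p hp q hq, hlt q hq p hp]⟩
      · rintro ⟨⟨p, hp, rfl⟩, hpq⟩
        exact ⟨p, ⟨hp, by rwa [hlt p hp q hq, hlt q hq p hp] at hpq⟩, rfl⟩
    · subst h
      ext x; constructor
      · rintro ⟨p, ⟨hp, hpq⟩, rfl⟩
        refine ⟨⟨p, hp, rfl⟩, fun hx => hpq ?_⟩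
        have hx : φ p = φ q := hx
        exact le_antisymm ((he _ hp _ hq).1 hx.le) ((he _ hq _ hp).1 hx.ge)
      · rintro ⟨⟨p, hp, rfl⟩, hpq⟩
        exact ⟨p, ⟨hp, fun h' => hpq (by rw [Set.mem_singleton_iff.1 h']; rfl)⟩, rfl⟩

theorem PosetNonEvasive.nonempty {Q : Set α} (h : PosetNonEvasive Q) : Q.Nonempty := by
  induction h with
  | point a => exact ⟨a, rfl⟩
  | step Q q hq => exact ⟨q, hq⟩

theorem PosetNonEvasive.finite {Q : Set α} (h : PosetNonEvasive Q) : Q.Finite := by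
  induction h with
  | point a => exact Set.finite_singleton a
  | step Q q hq _ _ _ h2 =>
    refine (h2.insert q).subset fun x hx => ?_
    · by_cases hxq : x = q
      · exact Or.inl hxq
      · exact Or.inr ⟨hx, hxq⟩

theorem PosetNonEvasive.image {Q : Set α} (hQ : PosetNonEvasive Q) {φ : α → β}
    (he : ∀ a ∈ Q, ∀ b ∈ Q, φ a ≤ φ b ↔ a ≤ b) : PosetNonEvasive (φ '' Q) := by
  classical
  obtain ⟨a₀, -⟩ := hQ.nonempty
  have : Nonempty α := ⟨a₀⟩
  have hinj : Set.InjOn φ Q := fun a ha b hb h =>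
    le_antisymm ((he a ha b hb).1 h.le) ((he b hb a ha).1 h.ge)
  have hinv : ∀ a ∈ Q, Function.invFunOn φ Q (φ a) = a := hinj.leftInvOn_invFunOn
  refine hQ.of_image (φ := Function.invFunOn φ Q) ?_ ?_
  · rw [Set.image_image]
    exact (Set.image_congr hinv).trans (by simp)
  · rintro _ ⟨a, ha, rfl⟩ _ ⟨b, hb, rfl⟩
    rw [hinv a ha, hinv b hb, he a ha b hb]

/-- The finite chains contained in `Q`, including the empty one. -/
def finsetChains (Q : Set α) : Set (Finset α) :=
  {c | (c : Set α) ⊆ Q ∧ IsChain (· ≤ ·) (c : Set α)}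

theorem finite_finsetChains {Q : Set α} (hQ : Q.Finite) : (finsetChains Q).Finite := by
  classical
  refine (hQ.toFinset.powerset.finite_toSet).subset fun c hc => ?_
  simp only [Finset.mem_coe, Finset.mem_powerset]
  intro x hx
  simpa using hc.1 hx

theorem finsetChains_mono_mem {Q : Set α} {c d : Finset α} (hd : d ∈ finsetChains Q) (h : c ⊆ d) :
    c ∈ finsetChains Q :=
  ⟨fun _ hx => hd.1 (h hx), hd.2.mono h⟩

theorem insert_mem_finsetChains [DecidableEq α] {Q : Set α} {q : α} (hq : q ∈ Q) {c : Finset α} :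
    insert q c ∈ finsetChains Q ∧ q ∉ c ↔ c ∈ finsetChains {p ∈ Q | p < q ∨ q < p} := by
  constructor
  · rintro ⟨⟨h1, h2⟩, h3⟩
    refine ⟨fun x hx => ⟨h1 (by simp [Finset.mem_coe.1 hx]), ?_⟩, h2.mono (by simp)⟩
    have hxq : x ≠ q := fun h => h3 (h ▸ hx)
    rcases h2 (x := x) (by simp [Finset.mem_coe.1 hx]) (y := q) (by simp) hxq with h | h
    · exact Or.inl (lt_of_le_of_ne h hxq)
    · exact Or.inr (lt_of_le_of_ne h hxq.symm)
  · rintro ⟨h1, h2⟩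
    refine ⟨⟨?_, ?_⟩, fun h => ?_⟩
    · intro x hx
      rcases Finset.mem_insert.1 (Finset.mem_coe.1 hx) with rfl | hx
      · exact hq
      · exact (h1 hx).1
    · rw [Finset.coe_insert]
      refine h2.insert fun b hb _ => ?_
      rcases (h1 hb).2 with h | h
      · exact Or.inr h.le
      · exact Or.inl h.le
    · simpa using (h1 h).2

/-- Barycentric subdivision preserves non-evasiveness of order complexes. -/
theorem PosetNonEvasive.finsetChains {Q : Set α} (hQ : PosetNonEvasive Q) :
    PosetNonEvasive {c ∈ PolytopalComplex.finsetChains Q | c.Nonempty} := by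
  classical
  induction hQ with
  | point a =>
    have : {c ∈ PolytopalComplex.finsetChains {a} | c.Nonempty} = {({a} : Finset α)} := by
      ext c
      constructor
      · rintro ⟨⟨h1, -⟩, h2⟩
        exact (Finset.subset_singleton_iff.1 (by exact_mod_cast h1)).resolve_left h2.ne_empty
      · rintro rfl
        exact ⟨⟨by simp, by simp⟩, by simp⟩
    rw [this]; exact .point _
  | step Q q hq hl hd ih1 ih2 =>
    have hQf : Q.Finite := (PosetNonEvasive.step Q q hq hl hd).finite
    have hfin : {c ∈ PolytopalComplex.finsetChains Q | c.Nonempty}.Finite :=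
      (finite_finsetChains hQf).subset fun c hc => hc.1
    have hq1 : {q} ∈ {c ∈ PolytopalComplex.finsetChains Q | c.Nonempty} :=
      ⟨⟨by simpa using hq, by simp⟩, by simp⟩
    refine .step _ {q} hq1 ?_ ?_
    -- The link of the vertex {q} consists of the chains properly containing q. Erasing q identifies
    -- it with the nonempty chains of the link of q.
    · have hlt : ∀ c ∈ {c ∈ PolytopalComplex.finsetChains Q | c.Nonempty},
          (c < {q} ∨ {q} < c ↔ q ∈ c ∧ c ≠ {q}) := by
        rintro c ⟨hc, hne⟩
        constructor
        · rintro (h | h)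
          · exact absurd (Finset.ssubset_singleton_iff.1 h) hne.ne_empty
          · exact ⟨Finset.singleton_subset_iff.1 h.le, h.ne'⟩
        · rintro ⟨h1, h2⟩
          exact Or.inr (lt_of_le_of_ne (Finset.singleton_subset_iff.2 h1) h2.symm)
      refine ih1.of_image (φ := fun c => c.erase q) ?_ ?_
      · ext c
        constructor
        · rintro ⟨d, ⟨hd, hd2⟩, rfl⟩
          obtain ⟨h1, h2⟩ := (hlt d hd).1 hd2
          refine ⟨(insert_mem_finsetChains hq).1 ⟨?_, by simp⟩, ?_⟩
          · rw [Finset.insert_erase h1]; exact hd.1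
          · rw [Finset.nonempty_iff_ne_empty]
            intro h
            rw [Finset.erase_eq_empty_iff] at h
            exact h.elim (fun h => hd.2.ne_empty h) h2
        · rintro ⟨hc, hne⟩
          obtain ⟨h1, h2⟩ := (insert_mem_finsetChains hq).2 hc
          have hm : insert q c ∈ {c ∈ PolytopalComplex.finsetChains Q | c.Nonempty} :=
            ⟨h1, by simp⟩
          refine ⟨insert q c, ⟨hm, (hlt _ hm).2 ⟨by simp, fun h => ?_⟩⟩, Finset.erase_insert h2⟩
          obtain ⟨x, hx⟩ := hne
          have : x ∈ ({q} : Finset α) := h ▸ Finset.mem_insert_of_mem hx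
          exact h2 (Finset.mem_singleton.1 this ▸ hx)
      · intro a ha b hb
        have ha' := ((hlt a ha.1).1 ha.2).1
        have hb' := ((hlt b hb.1).1 hb.2).1
        constructor
        · intro h
          have := Finset.insert_subset_insert q h
          rwa [Finset.insert_erase ha', Finset.insert_erase hb'] at this
        · exact fun h => Finset.erase_subset_erase q h
    -- After removing {q}, every other chain `c` through q can go too: the surviving chains below it
    -- all avoid q, hence lie below `c.erase q`.
    · refine .of_diff (S := {c ∈ PolytopalComplex.finsetChains Q | q ∈ c ∧ c ≠ {q}})
        (hfin.subset Set.sdiff_subset) ?_ ?_ ?_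
      · rintro c ⟨h1, h2, h3⟩
        exact ⟨⟨h1, ⟨q, h2⟩⟩, h3⟩
      · rintro c ⟨h1, h2, h3⟩
        have hne : (c.erase q).Nonempty := by
          rw [Finset.nonempty_iff_ne_empty]
          intro h
          rw [Finset.erase_eq_empty_iff] at h
          exact h.elim (fun h => by simp [h] at h2) h3
        refine ⟨c.erase q, ⟨⟨⟨finsetChains_mono_mem h1 (Finset.erase_subset _ _), hne⟩, ?_⟩, ?_⟩,
          Finset.erase_ssubset h2, ?_⟩
        · intro h
          have : q ∈ c.erase q := (Set.mem_singleton_iff.1 h) ▸ Finset.mem_singleton_self q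
          simp at this
        · rintro ⟨-, h, -⟩
          simp at h
        · rintro p ⟨⟨hp, hpq⟩, hpS⟩ hpc
          left
          refine Finset.subset_erase.2 ⟨hpc.le, fun hqp => hpS ⟨hp.1, hqp, hpq⟩⟩
      · convert ih2 using 1
        ext c
        constructor
        · rintro ⟨⟨⟨h1, h2⟩, h3⟩, h4⟩
          have hqc : q ∉ c := fun h => h4 ⟨h1, h, h3⟩
          exact ⟨⟨fun x hx => ⟨h1.1 hx, fun h => hqc (Set.mem_singleton_iff.1 h ▸ hx)⟩, h1.2⟩, h2⟩
        · rintro ⟨⟨h1, h2⟩, h3⟩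
          have hqc : q ∉ c := fun h => (h1 h).2 rfl
          refine ⟨⟨⟨⟨fun x hx => (h1 hx).1, h2⟩, h3⟩, fun h => hqc ?_⟩, fun h => hqc h.2.1⟩
          rw [Set.mem_singleton_iff.1 h]; simp

end Poset

/-! ### Abstract simplicial complexes: non-evasive implies collapsible. -/

section Abstract

variable {V : Type*} [DecidableEq V]

/-- The link of a vertex in an abstract simplicial complex. -/
def absLink (A : Set (Finset V)) (v : V) : Set (Finset V) := {s | v ∉ s ∧ insert v s ∈ A}

/-- The deletion of a vertex from an abstract simplicial complex. -/
def absDel (A : Set (Finset V)) (v : V) : Set (Finset V) := {s ∈ A | v ∉ s}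

/-- Non-evasiveness of an abstract simplicial complex. -/
inductive AbsNonEvasive : Set (Finset V) → Prop
  | point (v : V) : AbsNonEvasive {∅, {v}}
  | step (A : Set (Finset V)) (v : V) (hv : {v} ∈ A) (hlink : AbsNonEvasive (absLink A v))
      (hdel : AbsNonEvasive (absDel A v)) : AbsNonEvasive A

theorem isLowerSet_absLink {A : Set (Finset V)} (hA : IsLowerSet A) (v : V) :
    IsLowerSet (absLink A v) := fun _ _ hst hs =>
  ⟨fun h => hs.1 (hst h), hA (Finset.insert_subset_insert v hst) hs.2⟩

theorem isLowerSet_absDel {A : Set (Finset V)} (hA : IsLowerSet A) (v : V) :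
    IsLowerSet (absDel A v) := fun _ _ hst hs => ⟨hA hst hs.1, fun h => hs.2 (hst h)⟩

theorem absLink_subset {A : Set (Finset V)} (hA : IsLowerSet A) (v : V) : absLink A v ⊆ A :=
  fun _ hs => hA (Finset.subset_insert _ _) hs.2

theorem isLowerSet_finsetChains {α : Type*} [PartialOrder α] (Q : Set α) :
    IsLowerSet (finsetChains Q) := fun _ _ h hc => finsetChains_mono_mem hc h

/-- Chains that extend by q are exactly the chains of elements comparable to q, so the two recursive
definitions run in parallel. -/
theorem PosetNonEvasive.absNonEvasive {α : Type*} [PartialOrder α] [DecidableEq α] {Q : Set α}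
    (hQ : PosetNonEvasive Q) : AbsNonEvasive (PolytopalComplex.finsetChains Q) := by
  induction hQ with
  | point a =>
    have : PolytopalComplex.finsetChains {a} = {∅, ({a} : Finset α)} := by
      ext c
      constructor
      · rintro ⟨h1, -⟩
        exact Finset.subset_singleton_iff.1 (by exact_mod_cast h1)
      · rintro (rfl | rfl) <;> exact ⟨by simp, by simp⟩
    rw [this]; exact .point _
  | step Q q hq hl hd ih1 ih2 =>
    refine .step _ q ⟨by simpa using hq, by simp⟩ ?_ ?_
    · convert ih1 using 1
      ext c
      exact and_comm.trans (insert_mem_finsetChains hq)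
    · convert ih2 using 1
      ext c
      constructor
      · rintro ⟨h1, h2⟩
        exact ⟨fun x hx => ⟨h1.1 hx, fun h => h2 (Set.mem_singleton_iff.1 h ▸ hx)⟩, h1.2⟩
      · rintro ⟨h1, h2⟩
        exact ⟨⟨fun x hx => (h1 hx).1, h2⟩, fun h => (h1 h).2 rfl⟩

/-- An elementary collapse of abstract simplicial complexes. -/
def AbsCollapse (A B : Set (Finset V)) : Prop :=
  ∃ σ ∈ A, σ.Nonempty ∧ (∃! τ, τ ∈ A ∧ σ ⊂ τ) ∧ B = {s ∈ A | ¬ σ ⊆ s}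

/-- The cone with apex `v` over `L`, glued to `D`. -/
def absCone (D L : Set (Finset V)) (v : V) : Set (Finset V) := D ∪ {s | ∃ t ∈ L, s = insert v t}

theorem insert_ssubset_insert_iff {s t : Finset V} {v : V} (hs : v ∉ s) (ht : v ∉ t) :
    insert v s ⊂ insert v t ↔ s ⊂ t := by
  rw [ssubset_iff_subset_not_subset, ssubset_iff_subset_not_subset,
    Finset.insert_subset_insert_iff hs, Finset.insert_subset_insert_iff ht]

/-- All faces through `v` lie in the cone part, so a free face of the base gives, after adding `v`,
a free face of the glued complex. -/
theorem absCollapse_absCone {D L L' : Set (Finset V)} {v : V} (hD : ∀ s ∈ D, v ∉ s)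
    (hL : ∀ s ∈ L, v ∉ s) (h : AbsCollapse L L') :
    AbsCollapse (absCone D L v) (absCone D L' v) := by
  obtain ⟨σ, hσ, hne, ⟨τ, ⟨hτ, hστ⟩, huniq⟩, rfl⟩ := h
  refine ⟨insert v σ, Or.inr ⟨σ, hσ, rfl⟩, by simp, ⟨insert v τ, ⟨Or.inr ⟨τ, hτ, rfl⟩, ?_⟩, ?_⟩, ?_⟩
  · exact (insert_ssubset_insert_iff (hL σ hσ) (hL τ hτ)).2 hστ
  · rintro s ⟨hs | ⟨t, ht, rfl⟩, hs2⟩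
    · exact absurd (hs2.1 (Finset.mem_insert_self v σ)) (hD s hs)
    · rw [huniq t ⟨ht, (insert_ssubset_insert_iff (hL σ hσ) (hL t ht)).1 hs2⟩]
  · ext s
    constructor
    · rintro (hs | ⟨t, ⟨ht, ht2⟩, rfl⟩)
      · exact ⟨Or.inl hs, fun h => hD s hs (h (Finset.mem_insert_self v σ))⟩
      · exact ⟨Or.inr ⟨t, ht, rfl⟩, fun h => ht2 ((Finset.insert_subset_insert_iff (hL σ hσ)).1 h)⟩
    · rintro ⟨hs | ⟨t, ht, rfl⟩, hs2⟩
      · exact Or.inl hs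
      · exact Or.inr ⟨t, ⟨ht, fun h => hs2 (Finset.insert_subset_insert v h)⟩, rfl⟩

/-- The complex is its deletion at `v` with a cone over the link glued on. Collapsing the link to a
point `u` collapses the cone to the edge {v, u}; then {v} is free, and removing it leaves the
deletion, which collapses by induction. -/
theorem AbsNonEvasive.collapses {A : Set (Finset V)} (hA : AbsNonEvasive A) (hlow : IsLowerSet A) :
    ∃ u : V, Relation.ReflTransGen AbsCollapse A {∅, {u}} := by
  induction hA with
  | point v => exact ⟨v, .refl⟩
  | step A v hv _ _ ih1 ih2 =>
    obtain ⟨u, hu⟩ := ih1 (isLowerSet_absLink hlow v)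
    obtain ⟨w, hw⟩ := ih2 (isLowerSet_absDel hlow v)
    refine ⟨w, Relation.ReflTransGen.trans ?_ hw⟩
    have hD : ∀ s ∈ absDel A v, v ∉ s := fun s hs => hs.2
    have key : ∀ L, Relation.ReflTransGen AbsCollapse (absLink A v) L →
        (∀ s ∈ L, v ∉ s ∧ s ∈ A) ∧ Relation.ReflTransGen AbsCollapse A (absCone (absDel A v) L v) := by
      intro L hL
      induction hL with
      | refl =>
        refine ⟨fun s hs => ⟨hs.1, absLink_subset hlow v hs⟩, ?_⟩
        have : absCone (absDel A v) (absLink A v) v = A := by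
          ext s
          constructor
          · rintro (hs | ⟨t, ht, rfl⟩)
            · exact hs.1
            · exact ht.2
          · intro hs
            by_cases hvs : v ∈ s
            · refine Or.inr ⟨s.erase v, ⟨by simp, ?_⟩, (Finset.insert_erase hvs).symm⟩
              rwa [Finset.insert_erase hvs]
            · exact Or.inl ⟨hs, hvs⟩
        rw [this]
      | tail h1 h2 ih =>
        obtain ⟨ih1, ih2⟩ := ih
        refine ⟨fun s hs => ?_, ih2.tail (absCollapse_absCone hD (fun s hs => (ih1 s hs).1) h2)⟩
        obtain ⟨σ, -, -, -, rfl⟩ := h2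
        exact ih1 s hs.1
    obtain ⟨h1, h2⟩ := key _ hu
    refine h2.tail ⟨{v}, Or.inr ⟨∅, by simp, by simp⟩, by simp, ⟨{v, u}, ⟨Or.inr ⟨{u}, by simp, rfl⟩,
      ?_⟩, ?_⟩, ?_⟩
    · have : v ∉ ({u} : Finset V) := (h1 {u} (by simp)).1
      rw [Finset.ssubset_iff]
      exact ⟨u, by simpa [eq_comm] using this, by intro x; simp; tauto⟩
    · rintro s ⟨hs | ⟨t, rfl | rfl, rfl⟩, hs2⟩
      · exact absurd (hs2.1 (Finset.mem_singleton_self v)) (hD s hs)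
      · simp at hs2
      · rfl
    · ext s
      constructor
      · exact fun hs => ⟨Or.inl hs, fun h => hs.2 (h (Finset.mem_singleton_self v))⟩
      · rintro ⟨hs | ⟨t, ht, rfl⟩, hs2⟩
        · exact hs
        · simp at hs2

end Abstract

/-! ### Transfer from abstract to geometric complexes. -/

section Realization

variable {E : Type*} [NormedAddCommGroup E] [NormedSpace ℝ E] {V : Type*} [DecidableEq V]

/-- `f` realizes the abstract complex `A` by sets in `E`, with `P v` the point realizing `v`. -/
structure IsRealization (A : Set (Finset V)) (f : Finset V → Set E) (P : V → E) : Prop where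
  subset_iff : ∀ s ∈ A, ∀ t ∈ A, f s ⊆ f t ↔ s ⊆ t
  empty : f ∅ = ∅
  singleton : ∀ v, {v} ∈ A → f {v} = {P v}

theorem IsRealization.mono {A B : Set (Finset V)} {f : Finset V → Set E} {P : V → E}
    (h : IsRealization B f P) (hAB : A ⊆ B) : IsRealization A f P :=
  ⟨fun s hs t ht => h.subset_iff s (hAB hs) t (hAB ht), h.empty,
    fun v hv => h.singleton v (hAB hv)⟩

theorem IsRealization.deletion {A : Set (Finset V)} {f : Finset V → Set E} {P : V → E}
    (h : IsRealization A f P) {σ : Finset V} (hσ : σ ∈ A) :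
    PolytopalComplex.deletion (f '' A) (f σ) = f '' {s ∈ A | ¬ σ ⊆ s} := by
  ext x
  constructor
  · rintro ⟨⟨s, hs, rfl⟩, hx⟩
    exact ⟨s, ⟨hs, fun h' => hx ((h.subset_iff σ hσ s hs).2 h')⟩, rfl⟩
  · rintro ⟨s, ⟨hs, hx⟩, rfl⟩
    exact ⟨⟨s, hs, rfl⟩, fun h' => hx ((h.subset_iff σ hσ s hs).1 h')⟩

theorem IsRealization.deletion_vertex {A : Set (Finset V)} {f : Finset V → Set E} {P : V → E}
    (h : IsRealization A f P) {v : V} (hv : {v} ∈ A) :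
    PolytopalComplex.deletion (f '' A) {P v} = f '' absDel A v := by
  rw [← h.singleton v hv, h.deletion hv]
  simp [absDel]

theorem IsRealization.link {A : Set (Finset V)} {f : Finset V → Set E} {P : V → E}
    (h : IsRealization A f P) (hA : IsLowerSet A) {v : V} (hv : {v} ∈ A) :
    PolytopalComplex.link (f '' A) (P v) = f '' absLink A v := by
  have hs1 : ∀ s ∈ A, {P v} ⊆ f s ↔ v ∈ s := fun s hs => by
    rw [← h.singleton v hv, h.subset_iff _ hv s hs, Finset.singleton_subset_iff]
  ext x
  constructor
  · rintro ⟨⟨⟨s, hs, rfl⟩, _, ⟨t, ht, rfl⟩, hvt, hst⟩, hx⟩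
    rw [hs1 s hs] at hx
    rw [hs1 t ht] at hvt
    rw [h.subset_iff s hs t ht] at hst
    exact ⟨s, ⟨hx, hA (Finset.insert_subset hvt hst) ht⟩, rfl⟩
  · rintro ⟨s, ⟨hvs, hs⟩, rfl⟩
    have hsA : s ∈ A := hA (Finset.subset_insert _ _) hs
    refine ⟨⟨⟨s, hsA, rfl⟩, f (insert v s), ⟨_, hs, rfl⟩, (hs1 _ hs).2 (by simp),
      (h.subset_iff s hsA _ hs).2 (Finset.subset_insert _ _)⟩, ?_⟩
    rwa [hs1 s hsA]

theorem IsRealization.nonEvasive {A : Set (Finset V)} {f : Finset V → Set E} {P : V → E}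
    (h : IsRealization A f P) (hA : IsLowerSet A) (hne : AbsNonEvasive A) :
    NonEvasive (f '' A) := by
  induction hne with
  | point v =>
    rw [Set.image_pair, h.empty, h.singleton v (by simp)]
    exact .point _
  | step A v hv _ _ ih1 ih2 =>
    refine .step _ (P v) ⟨{v}, hv, h.singleton v hv⟩ ?_ ?_
    · rw [h.link hA hv]
      exact ih1 (h.mono (absLink_subset hA v)) (isLowerSet_absLink hA v)
    · rw [h.deletion_vertex hv]
      exact ih2 (h.mono fun _ hs => hs.1) (isLowerSet_absDel hA v)

theorem IsRealization.elementaryCollapse {A B : Set (Finset V)} {f : Finset V → Set E} {P : V → E}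
    (h : IsRealization A f P) (hempty : ∅ ∈ A) (hc : AbsCollapse A B) :
    ElementaryCollapse (f '' A) (f '' B) := by
  obtain ⟨σ, hσ, hne, ⟨τ, ⟨hτ, hστ⟩, huniq⟩, rfl⟩ := hc
  have hss : ∀ s ∈ A, ∀ t ∈ A, f s ⊂ f t ↔ s ⊂ t := fun s hs t ht => by
    rw [ssubset_iff_subset_not_subset, h.subset_iff s hs t ht, h.subset_iff t ht s hs]; rfl
  refine ⟨f σ, ⟨σ, hσ, rfl⟩, ?_, ⟨f τ, ⟨⟨τ, hτ, rfl⟩, (hss _ hσ _ hτ).2 hστ⟩, ?_⟩,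
    (h.deletion hσ).symm⟩
  · rw [Set.nonempty_iff_ne_empty]
    intro h0
    have := (h.subset_iff σ hσ ∅ hempty).1 (by rw [h0]; exact Set.empty_subset _)
    exact hne.ne_empty (Finset.subset_empty.1 this)
  · rintro _ ⟨⟨s, hs, rfl⟩, hs2⟩
    rw [huniq s ⟨hs, (hss _ hσ _ hs).1 hs2⟩]

theorem IsRealization.collapsible {A : Set (Finset V)} {f : Finset V → Set E} {P : V → E}
    (h : IsRealization A f P) (hA : IsLowerSet A) (hne : AbsNonEvasive A) :
    Collapsible (f '' A) := by
  obtain ⟨u, hu⟩ := hne.collapses hA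
  obtain ⟨v, hv⟩ : ∃ v, {v} ∈ A := by
    cases hne with
    | point v => exact ⟨v, by simp⟩
    | step _ v hv => exact ⟨v, hv⟩
  have hempty : ∅ ∈ A := hA (Finset.empty_subset _) hv
  have key : ∀ B, Relation.ReflTransGen AbsCollapse A B →
      B ⊆ A ∧ ∅ ∈ B ∧ Relation.ReflTransGen ElementaryCollapse (f '' A) (f '' B) := by
    intro B hB
    induction hB with
    | refl => exact ⟨subset_rfl, hempty, .refl⟩
    | tail h1 h2 ih =>
      obtain ⟨i1, i2, i3⟩ := ih
      have h3 := (h.mono i1).elementaryCollapse i2 h2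
      obtain ⟨σ, hσ, hne, -, rfl⟩ := h2
      exact ⟨fun s hs => i1 hs.1, ⟨i2, fun h => hne.ne_empty (Finset.subset_empty.1 h)⟩, i3.tail h3⟩
  obtain ⟨k1, -, k3⟩ := key _ hu
  rw [Set.image_pair, h.empty, h.singleton u (k1 (by simp))] at k3
  exact ⟨P u, k3⟩

end Realization

/-! ### Minimal faces, polyhedral cell complexes and the sweep. -/

section Polyhedra

open Filter Topology

variable {V : Type*} [AddCommGroup V] [Module ℝ V]

/-- The smallest face of the convex set `σ` containing `y`. -/
def minFace (σ : Set V) (y : V) : Set V := {z ∈ σ | ∃ w ∈ σ, y ∈ openSegment ℝ z w}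

/-- A polyhedron: the solution set of finitely many linear inequalities. -/
def IsPolyhedron (P : Set V) : Prop :=
  ∃ T : Finset (Module.Dual ℝ V × ℝ), P = {y | ∀ c ∈ T, c.1 y ≤ c.2}

theorem IsPolyhedron.convex {P : Set V} (hP : IsPolyhedron P) : Convex ℝ P := by
  obtain ⟨T, rfl⟩ := hP
  intro x hx y hy a b ha hb hab c hc
  have h1 := hx c hc
  have h2 := hy c hc
  simp only [map_add, map_smul, smul_eq_mul]
  calc a * c.1 x + b * c.1 y ≤ a * c.2 + b * c.2 := by gcongr
    _ = c.2 := by rw [← add_mul, hab, one_mul]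

theorem minFace_subset (σ : Set V) (y : V) : minFace σ y ⊆ σ := fun _ hz => hz.1

theorem self_mem_minFace {σ : Set V} {y : V} (hy : y ∈ σ) : y ∈ minFace σ y :=
  ⟨hy, y, hy, by simp⟩

/-- An extreme subset containing y contains both ends of every segment of the set with y in its
interior. This is what makes minimal faces agree between two cells meeting in a common face. -/
theorem minFace_eq_of_isExtreme {σ τ : Set V} (h : IsExtreme ℝ σ τ) {y : V} (hy : y ∈ τ) :
    minFace σ y = minFace τ y := by
  ext z
  constructor
  · rintro ⟨hz, w, hw, hyzw⟩
    exact ⟨h.2 hz hw hy hyzw, w, h.2 hw hz hy (openSegment_symm ℝ z w ▸ hyzw), hyzw⟩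
  · rintro ⟨hz, w, hw, hyzw⟩
    exact ⟨h.1 hz, w, h.1 hw, hyzw⟩

theorem minFace_subset_minFace {σ : Set V} (hσ : Convex ℝ σ) {w y : V} (hw : w ∈ minFace σ y) :
    minFace σ w ⊆ minFace σ y := by
  obtain ⟨-, y₁, hy₁, a, b, ha, hb, hab, rfl⟩ := hw
  rintro z ⟨hz, w₁, hw₁, a', b', ha', hb', hab', rfl⟩
  have h1 : a * a' < 1 := by nlinarith
  have h1' : 0 < 1 - a * a' := by linarith
  -- Substituting one combination into the other gives y = aa'z + ab'w₁ + by₁; the last two terms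
  -- are gathered into one point of `σ`.
  refine ⟨hz, (a * b' / (1 - a * a')) • w₁ + (b / (1 - a * a')) • y₁,
    hσ hw₁ hy₁ (by positivity) (by positivity) ?_, a * a', 1 - a * a', by positivity, h1',
    by ring, ?_⟩
  · rw [← add_div, div_eq_one_iff_eq h1'.ne']
    have : a * b' = a * (1 - a') := by rw [← hab']; ring
    rw [this]; linarith
  · rw [smul_add, smul_smul, smul_smul, smul_add, smul_smul, smul_smul, add_assoc]
    congr 3 <;> field_simp

theorem convex_minFace {σ : Set V} (hσ : Convex ℝ σ) (y : V) : Convex ℝ (minFace σ y) := by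
  rintro z₁ ⟨hz₁, w₁, hw₁, a₁, b₁, ha₁, hb₁, hab₁, rfl⟩ z₂ h₂ s t hs ht hst
  obtain ⟨hz₂, w₂, hw₂, a₂, b₂, ha₂, hb₂, hab₂, heq⟩ := h₂
  set y := a₁ • z₁ + b₁ • w₁ with hy
  -- `y` lies in the open segment from each `zᵢ` to `wᵢ`; mix with weights proportional to `s/a₁`, `t/a₂`
  set N := s / a₁ + t / a₂ with hN
  have hNpos : 0 < N := by
    rcases hs.eq_or_lt with rfl | hs'
    · have : t = 1 := by linarith
      rw [hN, this]; positivity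
    · positivity
  have h1N : 1 < N := by
    have e1 : s ≤ s / a₁ := by rw [le_div_iff₀ ha₁]; nlinarith
    have e2 : t ≤ t / a₂ := by rw [le_div_iff₀ ha₂]; nlinarith
    rcases hs.eq_or_lt with rfl | hs'
    · have ht1 : t = 1 := by linarith
      have : t < t / a₂ := by rw [lt_div_iff₀ ha₂]; nlinarith
      have : (0 : ℝ) / a₁ = 0 := zero_div _
      linarith
    · have : s < s / a₁ := by rw [lt_div_iff₀ ha₁]; nlinarith
      linarith
  have h1N' : 0 < N - 1 := by linarith
  refine ⟨hσ hz₁ hz₂ hs ht hst, (s * b₁ / a₁ / (N - 1)) • w₁ + (t * b₂ / a₂ / (N - 1)) • w₂,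
    hσ hw₁ hw₂ (by positivity) (by positivity) ?_, 1 / N, (N - 1) / N, by positivity,
    by positivity, by field_simp; ring, ?_⟩
  · rw [← add_div, div_eq_one_iff_eq h1N'.ne', hN]
    have e1 : b₁ = 1 - a₁ := by linarith
    have e2 : b₂ = 1 - a₂ := by linarith
    rw [e1, e2]
    field_simp
    linear_combination (-a₁ * a₂) * hst
  · have hyN : N • y = s • z₁ + t • z₂ + (s * b₁ / a₁) • w₁ + (t * b₂ / a₂) • w₂ := by
      have : N • y = (s / a₁) • y + (t / a₂) • y := by rw [hN, add_smul]
      rw [this]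
      nth_rewrite 2 [← heq]
      rw [hy, smul_add, smul_add, smul_smul, smul_smul, smul_smul, smul_smul,
        div_mul_cancel₀ _ ha₁.ne', div_mul_cancel₀ _ ha₂.ne', div_mul_eq_mul_div,
        div_mul_eq_mul_div]
      abel
    have : y = (1 / N) • (N • y) := by rw [smul_smul, one_div_mul_cancel hNpos.ne', one_smul]
    rw [this, hyN]
    match_scalars <;> field_simp

/-- The condition `minFace σ r = σ` serves as the definition of a relative interior point. The open
segment from such a point stays in the relative interior, because the minimal face of any of its
points contains `r`. -/
theorem minFace_eq_self_of_openSegment {σ : Set V} (hσ : Convex ℝ σ) {r z y : V} (hr : r ∈ σ)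
    (hrσ : minFace σ r = σ) (hz : z ∈ σ) (hy : y ∈ openSegment ℝ r z) : minFace σ y = σ := by
  refine (minFace_subset σ y).antisymm ?_
  conv_lhs => rw [← hrσ]
  exact minFace_subset_minFace hσ ⟨hr, z, hz, hy⟩

/-- Take a point whose minimal face is maximal. The minimal face of its midpoint with any z contains
both points, so by maximality z was already in the face. -/
theorem exists_minFace_eq_self {σ : Set V} (hσ : Convex ℝ σ) (hne : σ.Nonempty)
    (hfin : {F | ∃ y ∈ σ, F = minFace σ y}.Finite) : ∃ r ∈ σ, minFace σ r = σ := by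
  obtain ⟨F, hF⟩ := hfin.exists_maximal (by obtain ⟨y, hy⟩ := hne; exact ⟨_, y, hy, rfl⟩)
  obtain ⟨r, hr, rfl⟩ := hF.1
  refine ⟨r, hr, (minFace_subset σ r).antisymm fun z hz => ?_⟩
  set m := (1 / 2 : ℝ) • r + (1 / 2 : ℝ) • z with hm
  have hmσ : m ∈ σ := hσ hr hz (by norm_num) (by norm_num) (by norm_num)
  have hrm : r ∈ minFace σ m :=
    ⟨hr, z, hz, 1 / 2, 1 / 2, by norm_num, by norm_num, by norm_num, rfl⟩
  have hzm : z ∈ minFace σ m :=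
    ⟨hz, r, hr, 1 / 2, 1 / 2, by norm_num, by norm_num, by norm_num, by rw [hm, add_comm]⟩
  exact hF.2 ⟨m, hmσ, rfl⟩ (minFace_subset_minFace hσ hrm) hzm

/-- A direction that violates no active constraint can be followed for a while. -/
theorem eventually_add_smul_mem {T : Finset (Module.Dual ℝ V × ℝ)} {y d : V}
    (hy : ∀ c ∈ T, c.1 y ≤ c.2) (hd : ∀ c ∈ T, c.1 y = c.2 → c.1 d ≤ 0) :
    ∀ᶠ ε : ℝ in 𝓝[>] 0, ∀ c ∈ T, c.1 (y + ε • d) ≤ c.2 := by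
  rw [Filter.eventually_all_finset]
  intro c hc
  simp only [map_add, map_smul, smul_eq_mul]
  rcases (hy c hc).eq_or_lt with h | h
  · filter_upwards [self_mem_nhdsWithin] with ε hε
    have := mul_nonpos_of_nonneg_of_nonpos (le_of_lt hε) (hd c hc h)
    linarith
  · have hcont : Continuous fun ε : ℝ => c.1 y + ε * c.1 d := by fun_prop
    have : ∀ᶠ ε : ℝ in 𝓝 0, c.1 y + ε * c.1 d < c.2 :=
      hcont.continuousAt.eventually_lt continuousAt_const (by simpa using h)
    filter_upwards [nhdsWithin_le_nhds this] with ε hε using hε.le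

/-- The minimal face is cut out by the constraints active at y. If z satisfies them with equality,
the direction y − z violates no active constraint, so the segment from z can be prolonged a little
past y. -/
theorem mem_minFace_polyhedron {T : Finset (Module.Dual ℝ V × ℝ)} {y z : V}
    (hy : ∀ c ∈ T, c.1 y ≤ c.2) :
    z ∈ minFace {y | ∀ c ∈ T, c.1 y ≤ c.2} y ↔
      (∀ c ∈ T, c.1 z ≤ c.2) ∧ ∀ c ∈ T, c.1 y = c.2 → c.1 z = c.2 := by
  constructor
  · rintro ⟨hz, w, hw, a, b, ha, hb, hab, rfl⟩
    refine ⟨hz, fun c hc h => le_antisymm (hz c hc) ?_⟩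
    have h2 := hw c hc
    simp only [map_add, map_smul, smul_eq_mul] at h
    have hb' : b = 1 - a := by linarith
    subst hb'
    nlinarith
  · rintro ⟨hz, h⟩
    have hd : ∀ c ∈ T, c.1 y = c.2 → c.1 (y - z) ≤ 0 := fun c hc hcy => by
      rw [map_sub, hcy, h c hc hcy, sub_self]
    obtain ⟨ε, hε, hε0⟩ := ((eventually_add_smul_mem hy hd).and self_mem_nhdsWithin).exists
    have hε0 : 0 < ε := hε0
    refine ⟨hz, _, hε, ε / (1 + ε), 1 / (1 + ε), by positivity, by positivity, by field_simp; ring, ?_⟩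
    match_scalars <;> field_simp
    ring

/-- A finite complex of nonempty, possibly unbounded, convex polyhedra: it is closed under passing
to faces, and the smallest face containing a given point is the same in all cells. -/
structure IsCellComplex (X : Set (Set V)) : Prop where
  finite : X.Finite
  nonempty : ∀ σ ∈ X, σ.Nonempty
  isPolyhedron : ∀ σ ∈ X, IsPolyhedron σ
  minFace_mem : ∀ σ ∈ X, ∀ y ∈ σ, minFace σ y ∈ X
  minFace_eq : ∀ σ ∈ X, ∀ τ ∈ X, ∀ y, y ∈ σ → y ∈ τ → minFace σ y = minFace τ y

namespace IsCellComplex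

variable {X : Set (Set V)}

theorem convex (hX : IsCellComplex X) {σ : Set V} (hσ : σ ∈ X) : Convex ℝ σ :=
  (hX.isPolyhedron σ hσ).convex

theorem exists_relint (hX : IsCellComplex X) {σ : Set V} (hσ : σ ∈ X) :
    ∃ r ∈ σ, minFace σ r = σ :=
  exists_minFace_eq_self (hX.convex hσ) (hX.nonempty σ hσ)
    (hX.finite.subset (by rintro _ ⟨y, hy, rfl⟩; exact hX.minFace_mem σ hσ y hy))

/-- The minimal face of `r` is the same in both cells, and in `σ` it is all of `σ`. Inclusions of
cells can thus be tested at one relative interior point. -/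
theorem subset_of_mem (hX : IsCellComplex X) {σ τ : Set V} (hσ : σ ∈ X) (hτ : τ ∈ X) {r : V}
    (hr : r ∈ σ) (hrσ : minFace σ r = σ) (hrτ : r ∈ τ) : σ ⊆ τ := by
  rw [← hrσ, hX.minFace_eq σ hσ τ hτ r hr hrτ]
  exact minFace_subset τ r

/-- If `ν` is bounded below on a cell, then each point of the cell has a vertex of the cell
below it. -/
theorem exists_vertex_le (hX : IsCellComplex X) {ν : Module.Dual ℝ V}
    (hν : ∀ σ ∈ X, (∀ y ∈ σ, ∀ z ∈ σ, ν y = ν z) → σ.Subsingleton) {σ : Set V} (hσ : σ ∈ X)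
    {m : ℝ} (hm : ∀ z ∈ σ, m ≤ ν z) {y : V} (hy : y ∈ σ) :
    ∃ v, {v} ∈ X ∧ v ∈ σ ∧ ν v ≤ ν y := by
  induction hn : {τ ∈ X | τ ⊆ minFace σ y}.ncard using Nat.strong_induction_on generalizing y with
  | _ n ih =>
    have hfX := hX.minFace_mem σ hσ y hy
    by_cases hc : ∀ z ∈ minFace σ y, ν z = ν y
    · have hs := hν _ hfX fun a ha b hb => (hc a ha).trans (hc b hb).symm
      refine ⟨y, ?_, hy, le_rfl⟩
      rwa [hs.eq_singleton_of_mem (self_mem_minFace hy)] at hfX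
    push Not at hc
    obtain ⟨z, w, hz, hw, hyzw, hlt⟩ : ∃ z w, z ∈ σ ∧ w ∈ σ ∧ y ∈ openSegment ℝ z w ∧ ν z < ν y := by
      obtain ⟨z, ⟨hz, w, hw, hyzw⟩, hne⟩ := hc
      rcases hne.lt_or_gt with h | h
      · exact ⟨z, w, hz, hw, hyzw, h⟩
      · refine ⟨w, z, hw, hz, openSegment_symm ℝ z w ▸ hyzw, ?_⟩
        obtain ⟨a, b, ha, hb, hab, rfl⟩ := hyzw
        simp only [map_add, map_smul, smul_eq_mul] at h ⊢
        have ha' : a = 1 - b := by linarith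
        subst ha'
        have : ν w < ν z := by nlinarith
        nlinarith
    obtain ⟨a, b, ha, hb, hab, hyeq⟩ := hyzw
    set d := z - y with hd
    have hνd : ν d < 0 := by rw [hd, map_sub]; linarith
    -- Follow the descending direction `d` until it leaves `σ`; the lower bound on `ν` makes the
    -- exit time finite.
    set S : Set ℝ := {t | y + t • d ∈ σ} with hS
    have h1S : (1 : ℝ) ∈ S := by simp [hS, hd, hz]
    have hSb : BddAbove S := by
      refine ⟨(m - ν y) / ν d, fun t ht => ?_⟩
      have := hm _ ht
      rw [map_add, map_smul, smul_eq_mul] at this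
      rw [le_div_iff_of_neg hνd]
      linarith
    have hScl : IsClosed S := by
      obtain ⟨T, hT⟩ := hX.isPolyhedron σ hσ
      have : S = ⋂ c ∈ T, {t : ℝ | c.1 y + t * c.1 d ≤ c.2} := by
        ext t; simp [hS, hT]
      rw [this]
      exact isClosed_biInter fun c _ => isClosed_le (by fun_prop) continuous_const
    set t := sSup S with ht
    have htS : t ∈ S := hScl.csSup_mem ⟨1, h1S⟩ hSb
    have ht1 : 1 ≤ t := le_csSup hSb h1S
    have ht0 : 0 < t := by linarith
    set y' := y + t • d with hy'
    have hy'σ : y' ∈ σ := htS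
    have hwd : w = y - (a / b) • d := by
      have h2 : b • w = y - a • z := by rw [← hyeq]; abel
      have h3 : w = (1 / b) • (b • w) := by
        rw [smul_smul, one_div_mul_cancel hb.ne', one_smul]
      have h4 : y - a • z = b • y - a • d := by
        rw [hd, smul_sub]
        have : y = a • y + b • y := by rw [← add_smul, hab, one_smul]
        nth_rewrite 1 [this]
        abel
      rw [h3, h2, h4, smul_sub, smul_smul, smul_smul, one_div_mul_cancel hb.ne', one_smul,
        one_div_mul_eq_div]
    have hab0 : 0 < a / b := by positivity
    have hmem : y' ∈ minFace σ y := by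
      refine ⟨hy'σ, w, hw, (a / b) / (t + a / b), t / (t + a / b), by positivity, by positivity,
        by field_simp; ring, ?_⟩
      rw [hy', hwd]
      match_scalars
      · field_simp; ring
      · field_simp; ring
    -- Otherwise the segment from y could be prolonged past y' inside `σ`, against the choice of the
    -- exit time. Hence the minimal face shrinks strictly and the induction proceeds.
    have hnot : y ∉ minFace σ y' := by
      rintro ⟨-, w', hw', a', b', ha', hb', hab', heq⟩
      have h2 : w' = y + (t / b') • d := by
        have h3 : w' = (1 / b') • (b' • w') := by
          rw [smul_smul, one_div_mul_cancel hb'.ne', one_smul]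
        have h4 : b' • w' = b' • y + t • d := by
          have : b' • w' = y' - a' • y := by rw [← heq]; abel
          rw [this, hy']
          have : y = a' • y + b' • y := by rw [← add_smul, hab', one_smul]
          nth_rewrite 1 [this]
          abel
        rw [h3, h4, smul_add, smul_smul, smul_smul, one_div_mul_cancel hb'.ne', one_smul,
          one_div_mul_eq_div]
      have h5 : t / b' ∈ S := by rw [hS, Set.mem_ofPred_eq, ← h2]; exact hw'
      have h6 := le_csSup hSb h5
      rw [← ht, div_le_iff₀ hb'] at h6
      nlinarith
    have hsub := minFace_subset_minFace (hX.convex hσ) hmem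
    obtain ⟨v, hv, hvσ, hle⟩ := ih _ (by
      rw [← hn]
      refine Set.ncard_lt_ncard ⟨fun τ hτ => ⟨hτ.1, hτ.2.trans hsub⟩, fun h => ?_⟩
        (hX.finite.subset fun τ hτ => hτ.1)
      exact hnot ((h ⟨hfX, subset_rfl⟩).2 (self_mem_minFace hy))) hy'σ rfl
    refine ⟨v, hv, hvσ, hle.trans ?_⟩
    rw [hy', map_add, map_smul, smul_eq_mul]
    nlinarith

theorem finite_vertices (hX : IsCellComplex X) : {v | {v} ∈ X}.Finite :=
  hX.finite.preimage (f := fun v : V => ({v} : Set V)) Set.singleton_injective.injOn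

theorem exists_min_vertex (hX : IsCellComplex X) {ν : Module.Dual ℝ V}
    (hν : ∀ σ ∈ X, (∀ y ∈ σ, ∀ z ∈ σ, ν y = ν z) → σ.Subsingleton) {σ : Set V} (hσ : σ ∈ X)
    {m : ℝ} (hm : ∀ z ∈ σ, m ≤ ν z) :
    ∃ v, {v} ∈ X ∧ v ∈ σ ∧ ∀ z ∈ σ, ν v ≤ ν z := by
  have hfin : {v | {v} ∈ X ∧ v ∈ σ}.Finite := hX.finite_vertices.subset fun v hv => hv.1
  obtain ⟨y, hy⟩ := hX.nonempty σ hσ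
  obtain ⟨v₀, h1, h2, -⟩ := hX.exists_vertex_le hν hσ hm hy
  obtain ⟨v, ⟨hv1, hv2⟩, hv⟩ := hfin.exists_minimalFor ν _ ⟨v₀, h1, h2⟩
  refine ⟨v, hv1, hv2, fun z hz => ?_⟩
  obtain ⟨u, hu1, hu2, hu3⟩ := hX.exists_vertex_le hν hσ hm hz
  rcases le_total (ν v) (ν u) with h | h
  · exact h.trans hu3
  · exact (hv ⟨hu1, hu2⟩ h).trans hu3

/-- The cells contained in `{ν > 0}` can be removed, from the top to the bottom. -/
theorem posetNonEvasive_of_sweep (hX : IsCellComplex X) {ν : Module.Dual ℝ V}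
    (hν : ∀ σ ∈ X, (∀ y ∈ σ, ∀ z ∈ σ, ν y = ν z) → σ.Subsingleton)
    (hinj : ∀ v w, {v} ∈ X → {w} ∈ X → ν v = ν w → v = w)
    (hlink : ∀ v, {v} ∈ X → 0 < ν v → PosetNonEvasive {σ ∈ X | v ∈ σ ∧ ∃ y ∈ σ, ν y < ν v})
    {Y : Set (Set V)} (hYX : Y ⊆ X) (hY : ∀ σ ∈ X, (∃ y ∈ σ, 0 < ν y) → σ ∈ Y)
    (hlow : PosetNonEvasive {σ ∈ Y | ∃ y ∈ σ, ν y ≤ 0}) : PosetNonEvasive Y := by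
  classical
  have hUfin : {v | {v} ∈ X ∧ 0 < ν v}.Finite := hX.finite_vertices.subset fun v hv => hv.1
  set U := hUfin.toFinset with hU
  have hmemU : ∀ v, v ∈ U ↔ {v} ∈ X ∧ 0 < ν v := fun v => by simp [hU]
  -- `T` is an initial segment of the positive vertices by height. The family consists of the cells
  -- reaching ν ≤ 0 together with those whose lowest vertex is in `T`.
  have key : ∀ T : Finset V, T ⊆ U → (∀ u ∈ U, ∀ t ∈ T, ν u < ν t → u ∈ T) →
      PosetNonEvasive {σ ∈ Y | (∃ y ∈ σ, ν y ≤ 0) ∨ ∃ v ∈ T, v ∈ σ ∧ ∀ z ∈ σ, ν v ≤ ν z} := by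
    intro T
    induction T using Finset.induction_on_max_value ν with
    | empty =>
      intro _ _
      simpa using hlow
    | insert v T hvT hmax ih =>
      intro hTU hdown
      have hvU := (hmemU v).1 (hTU (Finset.mem_insert_self v T))
      have hTU' : T ⊆ U := (Finset.subset_insert v T).trans hTU
      have ih := ih hTU' (fun u hu t ht hlt => by
        rcases Finset.mem_insert.1 (hdown u hu t (Finset.mem_insert_of_mem ht) hlt) with rfl | h
        · exact absurd (hmax t ht) hlt.not_ge
        · exact h)
      have hneq : ∀ u ∈ T, ν u ≠ ν v := fun u hu h =>
        hvT (hinj u v ((hmemU u).1 (hTU' hu)).1 hvU.1 h ▸ hu)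
      set Z := {σ ∈ Y | (∃ y ∈ σ, ν y ≤ 0) ∨ ∃ u ∈ insert v T, u ∈ σ ∧ ∀ z ∈ σ, ν u ≤ ν z} with hZ
      set S := {σ ∈ Y | v ∈ σ ∧ (∀ z ∈ σ, ν v ≤ ν z) ∧ σ ≠ {v}} with hS
      have hvY : {v} ∈ Y := hY _ hvU.1 ⟨v, rfl, hvU.2⟩
      have hvZS : {v} ∈ Z \ S :=
        ⟨⟨hvY, Or.inr ⟨v, Finset.mem_insert_self v T, rfl, by rintro z rfl; exact le_rfl⟩⟩,
          fun h => h.2.2.2 rfl⟩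
      have hfin : Z.Finite := hX.finite.subset fun σ hσ => hYX hσ.1
      -- A cell of `Z` strictly inside a cell of `S` stays at height at least ν v > 0, so its own
      -- lowest vertex must be `v`. Hence {v} lies below all of them and serves as apex.
      refine .of_diff (S := S) hfin ?_ ?_ ?_
      · rintro σ ⟨h1, h2, h3, -⟩
        exact ⟨h1, Or.inr ⟨v, Finset.mem_insert_self v T, h2, h3⟩⟩
      · rintro σ ⟨h1, h2, h3, h4⟩
        refine ⟨{v}, hvZS, lt_of_le_of_ne (Set.singleton_subset_iff.2 h2) h4.symm, ?_⟩
        rintro p ⟨⟨hp, hp2⟩, -⟩ hpσ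
        right
        have hpσ' : p ⊆ σ := hpσ.le
        rcases hp2 with ⟨y, hy, hy0⟩ | ⟨u, hu, hup, -⟩
        · have := h3 y (hpσ' hy)
          linarith [hvU.2]
        · rcases Finset.mem_insert.1 hu with rfl | hu
          · exact Set.singleton_subset_iff.2 hup
          · exact absurd (le_antisymm (hmax u hu) (h3 u (hpσ' hup))) (hneq u hu)
      · refine .step _ {v} hvZS ?_ ?_
        -- With `S` removed, the cells still comparable to {v} are exactly those through `v` that go
        -- strictly below it. Each of them is in `Z`, since its lowest vertex, if positive, is lower
        -- than `v` and so belongs to `T`.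
        · convert hlink v hvU.1 hvU.2 using 1
          ext σ
          constructor
          · rintro ⟨⟨⟨h1, h2⟩, h3⟩, h4 | h4⟩
            · exfalso
              rcases Set.subset_singleton_iff_eq.1 h4.le with h | h
              · exact (hX.nonempty σ (hYX h1)).ne_empty h
              · exact h4.ne h
            · have hvσ : v ∈ σ := h4.le rfl
              refine ⟨hYX h1, hvσ, ?_⟩
              by_contra hcon
              push Not at hcon
              exact h3 ⟨h1, hvσ, hcon, h4.ne'⟩
          · rintro ⟨h1, h2, y, hy, hyv⟩
            refine ⟨⟨⟨hY σ h1 ⟨v, h2, hvU.2⟩, ?_⟩, fun h => (h.2.2.1 y hy).not_gt hyv⟩,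
              Or.inr (lt_of_le_of_ne (Set.singleton_subset_iff.2 h2) ?_)⟩
            · by_cases hc : ∃ y ∈ σ, ν y ≤ 0
              · exact Or.inl hc
              · push Not at hc
                obtain ⟨u, hu1, hu2, hu3⟩ := hX.exists_min_vertex hν h1 fun z hz => (hc z hz).le
                exact Or.inr ⟨u, hdown u ((hmemU u).2 ⟨hu1, hc u hu2⟩) v
                  (Finset.mem_insert_self v T) ((hu3 y hy).trans_lt hyv), hu2, hu3⟩
            · rintro rfl
              rw [Set.mem_singleton_iff.1 hy] at hyv
              exact lt_irrefl _ hyv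
        · convert ih using 1
          ext σ
          constructor
          · rintro ⟨⟨⟨h1, h2⟩, h3⟩, h4⟩
            refine ⟨h1, h2.imp_right ?_⟩
            rintro ⟨u, hu, hu2, hu3⟩
            rcases Finset.mem_insert.1 hu with rfl | hu
            · exact absurd ⟨h1, hu2, hu3, h4⟩ h3
            · exact ⟨u, hu, hu2, hu3⟩
          · rintro ⟨h1, h2⟩
            have hnot : ¬ (v ∈ σ ∧ ∀ z ∈ σ, ν v ≤ ν z) := by
              rintro ⟨h3, h4⟩
              rcases h2 with ⟨y, hy, hy0⟩ | ⟨u, hu, hu2, hu3⟩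
              · linarith [h4 y hy, hvU.2]
              · exact hneq u hu (le_antisymm (hu3 v h3) (h4 u hu2))
            refine ⟨⟨⟨h1, h2.imp_right ?_⟩, fun h => hnot ⟨h.2.1, h.2.2.1⟩⟩, fun h => hnot ?_⟩
            · rintro ⟨u, hu, h⟩
              exact ⟨u, Finset.mem_insert_of_mem hu, h⟩
            · rw [Set.mem_singleton_iff.1 h]
              exact ⟨rfl, by rintro z rfl; exact le_rfl⟩
  convert key U subset_rfl (fun u hu _ _ _ => hu) using 1
  ext σ
  refine ⟨fun h => ⟨h, ?_⟩, fun h => h.1⟩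
  by_cases hc : ∃ y ∈ σ, ν y ≤ 0
  · exact Or.inl hc
  · push Not at hc
    obtain ⟨u, hu1, hu2, hu3⟩ := hX.exists_min_vertex hν (hYX h) fun z hz => (hc z hz).le
    exact Or.inr ⟨u, (hmemU u).2 ⟨hu1, hc u hu2⟩, hu2, hu3⟩

end IsCellComplex

end Polyhedra

/-! ### Hyperplane slices, tangent cones and the induction on dimension. -/

section Slices

open Filter Topology

variable {V : Type*} [AddCommGroup V] [Module ℝ V]

theorem IsPolyhedron.inter_ker {P : Set V} (hP : IsPolyhedron P) (ν : Module.Dual ℝ V) :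
    IsPolyhedron {y ∈ P | ν y = 0} := by
  classical
  obtain ⟨T, rfl⟩ := hP
  refine ⟨T ∪ {(ν, 0), (-ν, 0)}, ?_⟩
  ext y
  constructor
  · rintro ⟨h1, h2⟩ c hc
    rcases Finset.mem_union.1 hc with hc | hc
    · exact h1 c hc
    · rcases Finset.mem_insert.1 hc with rfl | hc
      · exact h2.le
      · rw [Finset.mem_singleton.1 hc]
        simp [h2]
  · intro h
    refine ⟨fun c hc => h c (Finset.mem_union_left _ hc), le_antisymm (h (ν, 0) (by simp)) ?_⟩
    simpa using h (-ν, 0) (by simp)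

theorem minFace_inter_ker (σ : Set V) (ν : Module.Dual ℝ V) {y : V} (hy : ν y = 0) :
    minFace {y ∈ σ | ν y = 0} y = {z ∈ minFace σ y | ν z = 0} := by
  ext z
  constructor
  · rintro ⟨⟨hz, hνz⟩, w, ⟨hw, -⟩, h⟩
    exact ⟨⟨hz, w, hw, h⟩, hνz⟩
  · rintro ⟨⟨hz, w, hw, h⟩, hνz⟩
    refine ⟨⟨hz, hνz⟩, w, ⟨hw, ?_⟩, h⟩
    obtain ⟨a, b, ha, hb, hab, rfl⟩ := h
    simpa [hνz, hb.ne'] using hy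

/-- The slice of a complex by the hyperplane `ν = 0`. -/
theorem IsCellComplex.slice {X : Set (Set V)} (hX : IsCellComplex X) (ν : Module.Dual ℝ V) :
    IsCellComplex {s | ∃ σ ∈ X, s = {y ∈ σ | ν y = 0} ∧ s.Nonempty} where
  finite := (hX.finite.image fun σ => {y ∈ σ | ν y = 0}).subset (by
    rintro s ⟨σ, hσ, rfl, -⟩; exact ⟨σ, hσ, rfl⟩)
  nonempty := by rintro s ⟨σ, hσ, rfl, h⟩; exact h
  isPolyhedron := by
    rintro s ⟨σ, hσ, rfl, -⟩
    exact (hX.isPolyhedron σ hσ).inter_ker ν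
  minFace_mem := by
    rintro s ⟨σ, hσ, rfl, -⟩ y hy
    refine ⟨minFace σ y, hX.minFace_mem σ hσ y hy.1, minFace_inter_ker σ ν hy.2,
      y, self_mem_minFace hy⟩
  minFace_eq := by
    rintro s ⟨σ, hσ, rfl, -⟩ t ⟨τ, hτ, rfl, -⟩ y hyσ hyτ
    rw [minFace_inter_ker σ ν hyσ.2, minFace_inter_ker τ ν hyσ.2,
      hX.minFace_eq σ hσ τ hτ y hyσ.1 hyτ.1]

/-- The slice by the hyperplane `ν = 0` of the cone with apex `v` over `σ`. -/
def localSlice (ν : Module.Dual ℝ V) (v : V) (σ : Set V) : Set V :=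
  {u | ν u = 0 ∧ ∃ ε > (0 : ℝ), v + ε • (u - v) ∈ σ}

theorem add_smul_mem_of_le {σ : Set V} (hσ : Convex ℝ σ) {v d : V} (hv : v ∈ σ) {ε δ : ℝ}
    (h : v + ε • d ∈ σ) (hδ : 0 ≤ δ) (hδε : δ ≤ ε) : v + δ • d ∈ σ := by
  rcases hδ.eq_or_lt with rfl | hδ
  · simpa using hv
  have hε : 0 < ε := hδ.trans_le hδε
  have := hσ hv h (a := 1 - δ / ε) (b := δ / ε)
    (by rw [sub_nonneg]; exact div_le_one_of_le₀ hδε hε.le) (by positivity) (by ring)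
  convert this using 1
  match_scalars <;> field_simp
  ring

theorem IsPolyhedron.localSlice {P : Set V} (hP : IsPolyhedron P) (ν : Module.Dual ℝ V) {v : V}
    (hv : v ∈ P) : IsPolyhedron (localSlice ν v P) := by
  classical
  obtain ⟨T, rfl⟩ := hP
  -- The tangent cone at `v` is described by the constraints active at `v`; the inactive ones do not
  -- restrict directions.
  have h : IsPolyhedron {u : V | ∀ c ∈ T, c.1 v = c.2 → c.1 u ≤ c.2} :=
    ⟨T.filter fun c => c.1 v = c.2, by ext; simp⟩
  convert h.inter_ker ν using 1
  ext u
  constructor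
  · rintro ⟨h1, ε, hε, h2⟩
    refine ⟨fun c hc hcv => ?_, h1⟩
    have := h2 c hc
    rw [map_add, map_smul, map_sub, hcv, smul_eq_mul] at this
    nlinarith
  · rintro ⟨h1, h2⟩
    refine ⟨h2, ?_⟩
    have hd : ∀ c ∈ T, c.1 v = c.2 → c.1 (u - v) ≤ 0 := fun c hc hcv => by
      rw [map_sub, hcv]
      linarith [h1 c hc hcv]
    obtain ⟨ε, hε, hε0⟩ := ((eventually_add_smul_mem hv hd).and self_mem_nhdsWithin).exists
    exact ⟨ε, hε0, hε⟩

/-- Keeping the ray in `σ` up to time 2ε puts the point at time ε strictly inside a segment, so its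
minimal face contains the earlier points of the ray too. -/
theorem mem_minFace_add_smul {σ : Set V} {v d : V} {ε δ : ℝ} (hε : 0 < ε)
    (h2 : v + (2 * ε) • d ∈ σ) (hδ : v + δ • d ∈ σ) (hδε : δ < 2 * ε) :
    δ ≤ ε → v + δ • d ∈ minFace σ (v + ε • d) := by
  intro hle
  have hpos : 0 < 2 * ε - δ := by linarith
  have hne : ε * 2 - δ ≠ 0 := by linarith
  rcases hle.eq_or_lt with rfl | hlt
  · exact self_mem_minFace hδ
  refine ⟨hδ, _, h2, ε / (2 * ε - δ), (ε - δ) / (2 * ε - δ), by positivity,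
    div_pos (by linarith) hpos, by field_simp; ring, ?_⟩
  match_scalars <;> field_simp <;> ring

/-- Near `v`, the cell agrees with its tangent cone, so minimal faces of the slice are computed at a
point of the ray from `v` to `u` close to `v`. This reduces the complex axioms for local slices to
those of `X`. -/
theorem minFace_localSlice {σ : Set V} (hσ : Convex ℝ σ) {ν : Module.Dual ℝ V} {v u : V}
    (hv : v ∈ σ) (hu : ν u = 0) {ε : ℝ} (hε : 0 < ε) (h : v + (2 * ε) • (u - v) ∈ σ) :
    minFace (localSlice ν v σ) u = localSlice ν v (minFace σ (v + ε • (u - v))) := by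
  have hvF : v ∈ minFace σ (v + ε • (u - v)) := by
    simpa using mem_minFace_add_smul (δ := 0) hε h (by simpa using hv) (by linarith) hε.le
  ext z
  constructor
  · rintro ⟨⟨hz, η₁, hη₁, hzσ⟩, w, ⟨-, η₂, hη₂, hwσ⟩, a, b, ha, hb, hab, rfl⟩
    set η := min ε (min η₁ η₂) with hη
    have hη0 : 0 < η := by positivity
    have hz' := add_smul_mem_of_le hσ hv hzσ hη0.le ((min_le_right _ _).trans (min_le_left _ _))
    have hw' := add_smul_mem_of_le hσ hv hwσ hη0.le ((min_le_right _ _).trans (min_le_right _ _))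
    refine ⟨hz, η, hη0, ?_⟩
    have hηε : η ≤ ε := min_le_left _ _
    have h1 := mem_minFace_add_smul hε h
      (add_smul_mem_of_le hσ hv h hη0.le (by linarith)) (by linarith) hηε
    refine minFace_subset_minFace hσ h1 ⟨hz', _, hw', a, b, ha, hb, hab, ?_⟩
    have hb' : b = 1 - a := by linarith
    subst hb'
    module
  · rintro ⟨hz, η₁, hη₁, hzF⟩
    set η := min ε η₁ with hη
    have hη0 : 0 < η := by positivity
    have hηε : η ≤ ε := min_le_left _ _
    obtain ⟨hzσ, w, hw, a, b, ha, hb, hab, heq⟩ :=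
      add_smul_mem_of_le (convex_minFace hσ _) hvF hzF hη0.le (min_le_right _ _)
    have ha1 : a < 1 := by linarith
    have hpos : 0 < ε - a * η := by nlinarith
    refine ⟨⟨hz, η, hη0, hzσ⟩, v + (1 / (ε - a * η)) • (ε • (u - v) - (a * η) • (z - v)),
      ⟨?_, (ε - a * η) / b, by positivity, ?_⟩, a * η / ε, (ε - a * η) / ε, by positivity,
      by positivity, by field_simp; ring, ?_⟩
    · simp only [map_add, map_smul, map_sub, hu, hz, smul_eq_mul]
      field_simp
      ring
    · convert hw using 1
      have h3 : w = (1 / b) • (b • w) := by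
        rw [smul_smul, one_div_mul_cancel hb.ne', one_smul]
      have h4 : b • w = v + ε • (u - v) - a • (v + η • (z - v)) := by rw [← heq]; abel
      rw [h3, h4]
      have hb' : a = 1 - b := by linarith
      subst hb'
      match_scalars <;> field_simp
      ring
    · match_scalars <;> field_simp <;> ring

theorem exists_two_mul_add_smul_mem {σ : Set V} {v d : V}
    (h : ∃ ε > (0 : ℝ), v + ε • d ∈ σ) : ∃ ε > (0 : ℝ), v + (2 * ε) • d ∈ σ := by
  obtain ⟨ε, hε, h⟩ := h
  exact ⟨ε / 2, by positivity, by rwa [mul_div_cancel₀ _ (by norm_num)]⟩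

/-- The slice by `ν = 0` of the fan of tangent cones at `v`. -/
theorem IsCellComplex.localSlice {X : Set (Set V)} (hX : IsCellComplex X) (ν : Module.Dual ℝ V)
    (v : V) :
    IsCellComplex {s | ∃ σ ∈ X, v ∈ σ ∧ s = PolytopalComplex.localSlice ν v σ ∧ s.Nonempty} where
  finite := (hX.finite.image (PolytopalComplex.localSlice ν v)).subset (by
    rintro s ⟨σ, hσ, -, rfl, -⟩; exact ⟨σ, hσ, rfl⟩)
  nonempty := by rintro s ⟨σ, hσ, -, rfl, h⟩; exact h
  isPolyhedron := by
    rintro s ⟨σ, hσ, hv, rfl, -⟩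
    exact (hX.isPolyhedron σ hσ).localSlice ν hv
  minFace_mem := by
    rintro s ⟨σ, hσ, hv, rfl, -⟩ u hu
    obtain ⟨ε, hε, h⟩ := exists_two_mul_add_smul_mem hu.2
    have hy := add_smul_mem_of_le (hX.convex hσ) hv h hε.le (by linarith)
    refine ⟨_, hX.minFace_mem σ hσ _ hy, ?_, minFace_localSlice (hX.convex hσ) hv hu.1 hε h,
      u, self_mem_minFace hu⟩
    simpa using mem_minFace_add_smul (δ := 0) hε h (by simpa using hv) (by linarith) hε.le
  minFace_eq := by
    rintro s ⟨σ, hσ, hvσ, rfl, -⟩ t ⟨τ, hτ, hvτ, rfl, -⟩ u huσ huτ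
    obtain ⟨ε₁, hε₁, h₁⟩ := exists_two_mul_add_smul_mem huσ.2
    obtain ⟨ε₂, hε₂, h₂⟩ := exists_two_mul_add_smul_mem huτ.2
    set ε := min ε₁ ε₂ with hε
    have hε0 : 0 < ε := by positivity
    have hl : ε ≤ ε₁ := min_le_left _ _
    have hr : ε ≤ ε₂ := min_le_right _ _
    have h₁' := add_smul_mem_of_le (hX.convex hσ) hvσ h₁ (δ := 2 * ε) (by positivity) (by linarith)
    have h₂' := add_smul_mem_of_le (hX.convex hτ) hvτ h₂ (δ := 2 * ε) (by positivity) (by linarith)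
    rw [minFace_localSlice (hX.convex hσ) hvσ huσ.1 hε0 h₁',
      minFace_localSlice (hX.convex hτ) hvτ huσ.1 hε0 h₂',
      hX.minFace_eq σ hσ τ hτ _
        (add_smul_mem_of_le (hX.convex hσ) hvσ h₁' hε0.le (by linarith))
        (add_smul_mem_of_le (hX.convex hτ) hvτ h₂' hε0.le (by linarith))]

/-- There are finitely many cells, so one of them contains points of the ray arbitrarily close to
`v`; being closed along the ray, it contains `v` as well. -/
theorem IsCellComplex.exists_mem_of_frequently {X : Set (Set V)} (hX : IsCellComplex X) {v d : V}
    (h : ∃ᶠ ε : ℝ in 𝓝[>] 0, v + ε • d ∈ ⋃₀ X) :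
    ∃ σ ∈ X, v ∈ σ ∧ ∃ ε > (0 : ℝ), v + ε • d ∈ σ := by
  obtain ⟨σ, hσ, hf⟩ : ∃ σ ∈ X, ∃ᶠ ε : ℝ in 𝓝[>] 0, v + ε • d ∈ σ := by
    by_contra hcon
    simp only [not_exists, not_and, Filter.not_frequently] at hcon
    refine h ?_
    have := (Filter.eventually_all_finite hX.finite).2 hcon
    filter_upwards [this] with ε hε
    rintro ⟨σ, hσ, hmem⟩
    exact hε σ hσ hmem
  refine ⟨σ, hσ, ?_, ?_⟩
  · obtain ⟨T, rfl⟩ := hX.isPolyhedron σ hσ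
    intro c hc
    by_contra hlt
    push Not at hlt
    have hcont : Continuous fun ε : ℝ => c.1 v + ε * c.1 d := by fun_prop
    have : ∀ᶠ ε : ℝ in 𝓝 0, c.2 < c.1 v + ε * c.1 d :=
      continuousAt_const.eventually_lt hcont.continuousAt (by simpa using hlt)
    obtain ⟨ε, h1, h2⟩ := (hf.and_eventually (nhdsWithin_le_nhds this)).exists
    have := h1 c hc
    rw [map_add, map_smul, smul_eq_mul] at this
    linarith
  · obtain ⟨ε, h1, h2⟩ := (hf.and_eventually self_mem_nhdsWithin).exists
    exact ⟨ε, h2, h1⟩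

/-- This gives star-shapedness of the local slices. With s = 1 − κ(1 − t), one has v + κ(tu − v) =
s(v + (κ/s)t(u − v)): a point of `σ` pulled towards the star center. So the ray from `v` towards tu
starts inside the complex. -/
theorem IsCellComplex.smul_mem_localSlice {X : Set (Set V)} (hX : IsCellComplex X)
    (hstar : StarConvex ℝ 0 (⋃₀ X)) {ν : Module.Dual ℝ V} {v u : V} {σ : Set V} (hσ : σ ∈ X)
    (hv : v ∈ σ) (hu : ν u = 0) {t ε₀ : ℝ} (ht : 0 ≤ t) (ht1 : t ≤ 1) (hε₀ : 0 < ε₀)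
    (h : v + ε₀ • (t • (u - v)) ∈ σ) :
    ∃ τ ∈ X, v ∈ τ ∧ t • u ∈ PolytopalComplex.localSlice ν v τ := by
  obtain ⟨τ, hτ, hvτ, hmem⟩ := hX.exists_mem_of_frequently (v := v) (d := t • u - v) (by
    apply Filter.Eventually.frequently
    have hmin : (0 : ℝ) < min (1 / 2) (ε₀ / 2) := by positivity
    filter_upwards [Ioo_mem_nhdsGT hmin] with κ hκ
    have hκ0 : 0 < κ := hκ.1
    have hκ1 : κ < 1 / 2 := hκ.2.trans_le (min_le_left _ _)
    have hκ2 : κ < ε₀ / 2 := hκ.2.trans_le (min_le_right _ _)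
    have hs1 : 1 / 2 ≤ 1 - κ * (1 - t) := by nlinarith
    have hs2 : 1 - κ * (1 - t) ≤ 1 := by nlinarith
    have hs0 : 0 < 1 - κ * (1 - t) := by linarith
    have hy : v + (κ / (1 - κ * (1 - t))) • (t • (u - v)) ∈ σ := by
      refine add_smul_mem_of_le (hX.convex hσ) hv h (by positivity) ?_
      rw [div_le_iff₀ hs0]
      nlinarith
    have := starConvex_zero_iff.1 hstar (Set.mem_sUnion_of_mem hy hσ) hs0.le hs2
    convert this using 1
    match_scalars <;> field_simp
    ring)
  exact ⟨τ, hτ, hvτ, by simp [hu], hmem⟩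

theorem IsCellComplex.starConvex_localSlice {X : Set (Set V)} (hX : IsCellComplex X)
    (hstar : StarConvex ℝ 0 (⋃₀ X)) (ν : Module.Dual ℝ V) {v : V} (hv : {v} ∈ X) :
    StarConvex ℝ 0 (⋃₀ {s | ∃ σ ∈ X, v ∈ σ ∧ s = PolytopalComplex.localSlice ν v σ ∧ s.Nonempty}) ∧
      0 ∈ ⋃₀ {s | ∃ σ ∈ X, v ∈ σ ∧ s = PolytopalComplex.localSlice ν v σ ∧ s.Nonempty} := by
  constructor
  · rw [starConvex_zero_iff]
    rintro u ⟨_, ⟨σ, hσ, hvσ, rfl, -⟩, hu, ε, hε, huσ⟩ t ht ht1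
    obtain ⟨τ, hτ, hvτ, hmem⟩ := hX.smul_mem_localSlice hstar hσ hvσ hu ht ht1 hε (by
      rw [smul_smul]
      exact add_smul_mem_of_le (hX.convex hσ) hvσ huσ (by positivity) (by nlinarith))
    exact ⟨_, ⟨τ, hτ, hvτ, rfl, _, hmem⟩, hmem⟩
  -- The case t = 0 uses only the cell {v}: it says that the segment from `v` to the star center
  -- begins in some cell.
  · obtain ⟨τ, hτ, hvτ, hmem⟩ := hX.smul_mem_localSlice hstar (ν := ν) (u := 0) hv rfl (by simp)
      le_rfl zero_le_one zero_lt_one (by simp)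
    rw [smul_zero] at hmem
    exact ⟨_, ⟨τ, hτ, hvτ, rfl, _, hmem⟩, hmem⟩

/-- The cells going down from the vertex `v` correspond to the cells of the local slice at `v`. -/
theorem IsCellComplex.posetNonEvasive_lower {X : Set (Set V)} (hX : IsCellComplex X)
    {ν : Module.Dual ℝ V} {v : V} (hv : 0 < ν v)
    (h : PosetNonEvasive
      {s | ∃ σ ∈ X, v ∈ σ ∧ s = PolytopalComplex.localSlice ν v σ ∧ s.Nonempty}) :
    PosetNonEvasive {σ ∈ X | v ∈ σ ∧ ∃ y ∈ σ, ν y < ν v} := by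
  -- The ray from `v` through a lower point y hits the hyperplane ν = 0 here, because ν v > 0.
  have hdir : ∀ y, ν y < ν v → ν (v + (ν v / (ν v - ν y)) • (y - v)) = 0 := fun y hy => by
    have : ν v - ν y ≠ 0 := by linarith
    simp only [map_add, map_smul, map_sub, smul_eq_mul]
    field_simp
    ring
  refine h.of_image (φ := PolytopalComplex.localSlice ν v) ?_ ?_
  · ext s
    constructor
    · rintro ⟨σ, ⟨hσ, hvσ, y, hy, hyv⟩, rfl⟩
      refine ⟨σ, hσ, hvσ, rfl, v + (ν v / (ν v - ν y)) • (y - v), hdir y hyv,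
        (ν v - ν y) / ν v, div_pos (by linarith) hv, ?_⟩
      convert hy using 1
      have : ν v - ν y ≠ 0 := by linarith
      match_scalars <;> field_simp
      ring
    · rintro ⟨σ, hσ, hvσ, rfl, u, hu, ε, hε, hmem⟩
      refine ⟨σ, ⟨hσ, hvσ, _, hmem, ?_⟩, rfl⟩
      simp only [map_add, map_smul, map_sub, smul_eq_mul, hu]
      nlinarith
  · rintro σ ⟨hσ, hvσ, y, hy, hyv⟩ τ ⟨hτ, hvτ, -⟩
    constructor
    · intro hle
      obtain ⟨r₀, hr₀, hr₀σ⟩ := hX.exists_relint hσ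
      -- a relative interior point below `v`
      obtain ⟨r, hr, hrσ, hrv⟩ : ∃ r ∈ σ, minFace σ r = σ ∧ ν r < ν v := by
        by_cases hc : ν r₀ < ν v
        · exact ⟨r₀, hr₀, hr₀σ, hc⟩
        push Not at hc
        -- The weight s is chosen so that the combination of `r₀` and `y` has height halfway between
        -- ν y and ν v.
        set D := (ν r₀ - ν v) + (ν v - ν y) with hD
        set s := (ν v - ν y) / (2 * D) with hs
        have hDpos : 0 < D := by linarith
        have hs0 : 0 < s := div_pos (by linarith) (by linarith)
        have hs1 : s < 1 := by rw [hs, div_lt_one (by linarith)]; linarith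
        have hmem : s • r₀ + (1 - s) • y ∈ openSegment ℝ r₀ y :=
          ⟨s, 1 - s, hs0, by linarith, by ring, rfl⟩
        refine ⟨s • r₀ + (1 - s) • y, hX.convex hσ hr₀ hy hs0.le (by linarith) (by ring),
          minFace_eq_self_of_openSegment (hX.convex hσ) hr₀ hr₀σ hy hmem, ?_⟩
        simp only [map_add, map_smul, smul_eq_mul]
        have h2 : s * D = (ν v - ν y) / 2 := by rw [hs]; field_simp
        rw [hD] at h2
        nlinarith
      set u := v + (ν v / (ν v - ν r)) • (r - v) with hu
      have hne : 0 < ν v - ν r := by linarith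
      have huσ : u ∈ PolytopalComplex.localSlice ν v σ := by
        refine ⟨hdir r hrv, (ν v - ν r) / ν v, by positivity, ?_⟩
        convert hr using 1
        rw [hu]
        match_scalars <;> field_simp
        ring
      obtain ⟨-, ε, hε, hετ⟩ := hle huσ
      -- points of the segment from `v` to `r`, close to `v`
      set δ := min (ε * (ν v / (ν v - ν r))) (1 / 2) with hδ
      have hδ0 : 0 < δ := by positivity
      have hδ1 : δ < 1 := (min_le_right _ _).trans_lt (by norm_num)
      have hmemτ : v + δ • (r - v) ∈ τ := by
        refine add_smul_mem_of_le (hX.convex hτ) hvτ (ε := ε * (ν v / (ν v - ν r))) ?_ hδ0.le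
          (min_le_left _ _)
        rw [mul_smul]
        convert hετ using 3
        rw [hu]; abel
      have hseg : v + δ • (r - v) ∈ openSegment ℝ r v :=
        ⟨δ, 1 - δ, hδ0, by linarith, by ring, by module⟩
      exact hX.subset_of_mem hσ hτ
        (hX.convex hσ |>.openSegment_subset hr hvσ hseg)
        (minFace_eq_self_of_openSegment (hX.convex hσ) hr hrσ hvσ hseg) hmemτ
    · rintro hle u ⟨hu, ε, hε, hmem⟩
      exact ⟨hu, ε, hε, hle hmem⟩

/-- The cells meeting the hyperplane `ν = 0` through the star center. -/
theorem IsCellComplex.posetNonEvasive_of_slice {X : Set (Set V)} (hX : IsCellComplex X)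
    {ν : Module.Dual ℝ V}
    (hν : ∀ σ ∈ X, (∀ y ∈ σ, ∀ z ∈ σ, ν y = ν z) → σ.Subsingleton)
    (hν0 : ∀ v, {v} ∈ X → ν v = 0 → v = 0)
    (h : PosetNonEvasive {s | ∃ σ ∈ X, s = {y ∈ σ | ν y = 0} ∧ s.Nonempty}) :
    PosetNonEvasive {σ ∈ X | ∃ y ∈ σ, ν y = 0} := by
  -- On cells whose relative interior meets the hyperplane, slicing is an order isomorphism onto the
  -- slice complex. The other cells that meet it are removed below.
  set R := {σ ∈ X | ∃ y ∈ σ, ν y = 0 ∧ minFace σ y = σ} with hR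
  have hRne : PosetNonEvasive R := by
    refine h.of_image (φ := fun σ => {y ∈ σ | ν y = 0}) ?_ ?_
    · ext s
      constructor
      · rintro ⟨σ, ⟨hσ, y, hy, hy0, -⟩, rfl⟩
        exact ⟨σ, hσ, rfl, y, hy, hy0⟩
      · rintro ⟨σ, hσ, rfl, hne⟩
        obtain ⟨r, hr, hrs⟩ := (hX.slice ν).exists_relint ⟨σ, hσ, rfl, hne⟩
        rw [minFace_inter_ker σ ν hr.2] at hrs
        refine ⟨minFace σ r, ⟨hX.minFace_mem σ hσ r hr.1, r, self_mem_minFace hr.1, hr.2, ?_⟩, hrs⟩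
        exact (hX.minFace_eq _ (hX.minFace_mem σ hσ r hr.1) σ hσ r (self_mem_minFace hr.1) hr.1)
    · rintro σ ⟨hσ, y, hy, hy0, hyσ⟩ τ ⟨hτ, -⟩
      constructor
      · exact fun hle => hX.subset_of_mem hσ hτ hy hyσ (hle ⟨hy, hy0⟩).1
      · exact fun hle z hz => ⟨hle hz.1, hz.2⟩
  refine .of_diff (S := {σ ∈ X | (∃ y ∈ σ, ν y = 0) ∧ ¬ ∃ y ∈ σ, ν y = 0 ∧ minFace σ y = σ})
    (hX.finite.subset fun σ hσ => hσ.1) (fun σ hσ => ⟨hσ.1, hσ.2.1⟩) ?_ ?_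
  · -- such a cell lies on one side of the hyperplane and meets it only in the star center
    have key : ∀ σ ∈ X, (¬ ∃ y ∈ σ, ν y = 0 ∧ minFace σ y = σ) → ∀ y ∈ σ, ν y = 0 →
        minFace σ y = {y} ∧ y = 0 := by
      intro σ hσ hno y hy hy0
      obtain ⟨r, hr, hrσ⟩ := hX.exists_relint hσ
      -- If some z were strictly on the other side from `r`, the open segment from `r` to z would
      -- cross the hyperplane at a relative interior point.
      have hside : ∀ z ∈ σ, 0 ≤ ν r * ν z := by
        intro z hz
        by_contra hlt
        push Not at hlt
        have hne : ν r ≠ 0 := fun h => by simp [h] at hlt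
        have hpos : 0 < (ν r) ^ 2 - ν r * ν z := by nlinarith [sq_nonneg (ν r)]
        have hsq : 0 < (ν r) ^ 2 := by positivity
        have hne2 : ν r - ν z ≠ 0 := fun h => by
          rw [← sub_eq_zero.1 h] at hlt
          nlinarith
        have hseg : (-(ν r * ν z) / ((ν r) ^ 2 - ν r * ν z)) • r +
            ((ν r) ^ 2 / ((ν r) ^ 2 - ν r * ν z)) • z ∈ openSegment ℝ r z :=
          ⟨_, _, div_pos (by linarith) hpos, by positivity, by field_simp; ring, rfl⟩
        refine hno ⟨_, (hX.convex hσ).openSegment_subset hr hz hseg, ?_,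
          minFace_eq_self_of_openSegment (hX.convex hσ) hr hrσ hz hseg⟩
        simp only [map_add, map_smul, smul_eq_mul]
        field_simp
        ring
      have hr0 : ν r ≠ 0 := fun h => hno ⟨r, hr, h, hrσ⟩
      have hzero : ∀ z ∈ minFace σ y, ν z = 0 := by
        rintro z ⟨hz, w, hw, a, b, ha, hb, hab, rfl⟩
        simp only [map_add, map_smul, smul_eq_mul] at hy0
        have h1 := hside z hz
        have h2 := hside w hw
        have h3 : a * (ν r * ν z) + b * (ν r * ν w) = 0 := by linear_combination ν r * hy0
        have h4 : ν r * ν z = 0 := by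
          by_contra hne
          have : 0 < ν r * ν z := lt_of_le_of_ne h1 (Ne.symm hne)
          nlinarith [mul_pos ha this, mul_nonneg hb.le h2]
        exact (mul_eq_zero.1 h4).resolve_left hr0
      have hF := hX.minFace_mem σ hσ y hy
      have hs := (hν _ hF fun a ha b hb => (hzero a ha).trans (hzero b hb).symm)
      have hsing := hs.eq_singleton_of_mem (self_mem_minFace hy)
      exact ⟨hsing, hν0 y (hsing ▸ hF) hy0⟩
    -- The star center is then a vertex of the complex, and {0} lies below every remaining cell
    -- contained in such a `σ`.
    rintro σ ⟨hσ, ⟨y, hy, hy0⟩, hno⟩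
    obtain ⟨h1, rfl⟩ := key σ hσ hno y hy hy0
    have h0X : {(0 : V)} ∈ X := h1 ▸ hX.minFace_mem σ hσ 0 hy
    have h0R : minFace {(0 : V)} 0 = {(0 : V)} :=
      (Set.subset_singleton_iff_eq.1 (minFace_subset _ _)).resolve_left
        (Set.nonempty_iff_ne_empty.1 ⟨0, self_mem_minFace rfl⟩)
    refine ⟨{0}, ⟨⟨h0X, 0, rfl, by simp⟩, fun h => h.2.2 ⟨0, rfl, by simp, h0R⟩⟩,
      lt_of_le_of_ne (Set.singleton_subset_iff.2 hy) ?_, ?_⟩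
    · rintro rfl
      exact hno ⟨0, rfl, by simp, h0R⟩
    · rintro p ⟨⟨hp, z, hz, hz0⟩, -⟩ hpσ
      right
      obtain ⟨-, rfl⟩ := key σ hσ hno z (hpσ.le hz) hz0
      exact Set.singleton_subset_iff.2 hz
  · convert hRne using 1
    ext σ
    constructor
    · rintro ⟨⟨h1, h2⟩, h3⟩
      refine ⟨h1, ?_⟩
      by_contra hno
      exact h3 ⟨h1, h2, hno⟩
    · rintro ⟨h1, y, hy, hy0, hyσ⟩
      exact ⟨⟨h1, y, hy, hy0⟩, fun h => h.2.2 ⟨y, hy, hy0, hyσ⟩⟩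

/-- Each condition says that `ν` is nonzero on a certain nonzero vector: one difference per cell
with at least two points, the differences of vertices or 0, and `w₀`. Finitely many such vectors can
be avoided simultaneously. -/
theorem IsCellComplex.exists_generic {X : Set (Set V)} (hX : IsCellComplex X) {w₀ : V}
    (hw₀ : w₀ ≠ 0) : ∃ ν : Module.Dual ℝ V,
      (∀ σ ∈ X, (∀ y ∈ σ, ∀ z ∈ σ, ν y = ν z) → σ.Subsingleton) ∧
      (∀ v w, {v} ∈ X → {w} ∈ X → ν v = ν w → v = w) ∧
      (∀ v, {v} ∈ X → ν v = 0 → v = 0) ∧ ν w₀ ≠ 0 := by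
  have hch : ∀ σ : Set V, ∃ g : V, ¬ σ.Subsingleton → g ≠ 0 ∧ ∃ y ∈ σ, ∃ z ∈ σ, g = y - z := by
    intro σ
    by_cases hs : σ.Subsingleton
    · exact ⟨0, fun h => absurd hs h⟩
    · obtain ⟨y, hy, z, hz, hne⟩ := Set.not_subsingleton_iff.1 hs
      exact ⟨y - z, fun _ => ⟨sub_ne_zero.2 hne, y, hy, z, hz, rfl⟩⟩
  choose g hg using hch
  set N := insert 0 {v | {v} ∈ X} with hN
  have hNfin : N.Finite := hX.finite_vertices.insert 0
  set D := (insert w₀ (g '' X ∪ Set.image2 (fun a b => a - b) N N)) \ {0} with hD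
  have hDfin : D.Finite := ((((hX.finite.image g).union (hNfin.image2 _ hNfin)).insert w₀).subset
    Set.sdiff_subset)
  have := hDfin.to_subtype
  obtain ⟨ν, hν⟩ := Module.exists_dual_forall_apply_ne_zero (K := ℝ) (fun d : D => (d : V))
    (fun d => d.2.2)
  have hν' : ∀ d ∈ D, ν d ≠ 0 := fun d hd => hν ⟨d, hd⟩
  have hsub : ∀ v ∈ N, ∀ w ∈ N, ν v = ν w → v = w := by
    intro v hv w hw hvw
    by_contra hne
    refine hν' (v - w) ⟨Or.inr (Or.inr ⟨v, hv, w, hw, rfl⟩), sub_ne_zero.2 hne⟩ ?_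
    rw [map_sub, hvw, sub_self]
  refine ⟨ν, ?_, fun v w hv hw => hsub v (Or.inr hv) w (Or.inr hw), fun v hv h0 =>
    hsub v (Or.inr hv) 0 (Or.inl rfl) (by rw [h0, map_zero]), hν' w₀ ⟨Or.inl rfl, hw₀⟩⟩
  intro σ hσ hconst
  by_contra hs
  obtain ⟨h1, y, hy, z, hz, h2⟩ := hg σ hs
  refine hν' (g σ) ⟨Or.inr (Or.inl ⟨σ, hσ, rfl⟩), h1⟩ ?_
  rw [h2, map_sub, hconst y hy z hz, sub_self]

/-- The order complex of the cells of a star-shaped complex is non-evasive. -/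
theorem IsCellComplex.posetNonEvasive [FiniteDimensional ℝ V] (W : Submodule ℝ V) :
    ∀ {X : Set (Set V)}, IsCellComplex X → (∀ σ ∈ X, σ ⊆ W) →
      StarConvex ℝ 0 (⋃₀ X) → 0 ∈ ⋃₀ X → PosetNonEvasive X := by
  induction hn : Module.finrank ℝ W using Nat.strong_induction_on generalizing W with
  | _ n ih =>
    intro X hX hXW hstar h0
    by_cases hW : W = ⊥
    · subst hW
      have hall : ∀ σ ∈ X, σ = {0} := fun σ hσ =>
        (Set.subset_singleton_iff_eq.1 (by simpa using hXW σ hσ)).resolve_left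
          (hX.nonempty σ hσ).ne_empty
      obtain ⟨σ, hσ, -⟩ := h0
      have : X = {{0}} := Set.eq_singleton_iff_unique_mem.2 ⟨hall σ hσ ▸ hσ, hall⟩
      rw [this]; exact .point _
    obtain ⟨w₀, hw₀W, hw₀⟩ := Submodule.exists_mem_ne_zero_of_ne_bot hW
    obtain ⟨ν, hν1, hν2, hν3, hν4⟩ := hX.exists_generic hw₀
    have hlt : Module.finrank ℝ (W ⊓ LinearMap.ker ν : Submodule ℝ V) < n := by
      rw [← hn]
      refine Submodule.finrank_lt_finrank_of_lt (lt_of_le_of_ne inf_le_left fun h => ?_)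
      rw [inf_eq_left] at h
      exact hν4 (h hw₀W)
    have hker : LinearMap.ker (-ν) = LinearMap.ker ν := by ext; simp
    have hlink : ∀ μ : Module.Dual ℝ V, LinearMap.ker μ = LinearMap.ker ν → ∀ v, {v} ∈ X →
        0 < μ v → PosetNonEvasive {σ ∈ X | v ∈ σ ∧ ∃ y ∈ σ, μ y < μ v} := by
      intro μ hμ v hv hpos
      obtain ⟨h1, h2⟩ := hX.starConvex_localSlice hstar μ hv
      refine hX.posetNonEvasive_lower hpos (ih _ hlt _ rfl (hX.localSlice μ v) ?_ h1 h2)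
      rintro s ⟨σ, hσ, hvσ, rfl, -⟩ u ⟨hu, ε, hε, hmem⟩
      refine ⟨?_, hμ ▸ hu⟩
      have hvW : v ∈ W := hXW σ hσ hvσ
      have h3 : ε • (u - v) ∈ W := (Submodule.add_mem_iff_right W hvW).1 (hXW σ hσ hmem)
      have h4 := (Submodule.smul_mem_iff W hε.ne').1 h3
      simpa using W.add_mem h4 hvW
    have hslice : PosetNonEvasive {σ ∈ X | ∃ y ∈ σ, ν y = 0} := by
      refine hX.posetNonEvasive_of_slice hν1 hν3 (ih _ hlt _ rfl (hX.slice ν) ?_ ?_ ?_)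
      · rintro s ⟨σ, hσ, rfl, -⟩ y hy
        exact ⟨hXW σ hσ hy.1, hy.2⟩
      · rw [starConvex_zero_iff]
        rintro y ⟨_, ⟨σ, hσ, rfl, -⟩, hy, hy0⟩ t ht ht1
        obtain ⟨τ, hτ, hmem⟩ := starConvex_zero_iff.1 hstar (Set.mem_sUnion_of_mem hy hσ) ht ht1
        have : t • y ∈ {y ∈ τ | ν y = 0} := ⟨hmem, by simp [hy0]⟩
        exact ⟨_, ⟨τ, hτ, rfl, _, this⟩, this⟩
      · obtain ⟨σ, hσ, hmem⟩ := h0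
        have : (0 : V) ∈ {y ∈ σ | ν y = 0} := ⟨hmem, by simp⟩
        exact ⟨_, ⟨σ, hσ, rfl, _, this⟩, this⟩
    -- The first sweep clears ν > 0. The second, with −ν, clears ν < 0 within the cells that remain;
    -- both refer to links in the whole of `X`. What survives meets both closed half-spaces, hence
    -- the hyperplane.
    refine hX.posetNonEvasive_of_sweep hν1 hν2 (hlink ν rfl) subset_rfl (fun σ hσ _ => hσ) ?_
    refine hX.posetNonEvasive_of_sweep (ν := -ν) ?_ ?_ (hlink (-ν) hker) (fun σ hσ => hσ.1) ?_ ?_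
    · simpa using hν1
    · simpa using hν2
    · rintro σ hσ ⟨y, hy, hy0⟩
      exact ⟨hσ, y, hy, by simpa using hy0.le⟩
    · convert hslice using 1
      ext σ
      constructor
      · rintro ⟨⟨hσ, y, hy, hy0⟩, z, hz, hz0⟩
        refine ⟨hσ, ?_⟩
        have hz0 : 0 ≤ ν z := by simpa using hz0
        rcases hy0.eq_or_lt with h | h
        · exact ⟨y, hy, h⟩
        have hpos : 0 < ν z - ν y := by linarith
        refine ⟨(ν z / (ν z - ν y)) • y + (-ν y / (ν z - ν y)) • z,
          hX.convex hσ hy hz (by positivity) (div_nonneg (by linarith) hpos.le)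
            (by field_simp; ring), ?_⟩
        simp only [map_add, map_smul, smul_eq_mul]
        field_simp
        ring
      · rintro ⟨hσ, y, hy, hy0⟩
        exact ⟨⟨hσ, y, hy, hy0.le⟩, y, hy, by simp [hy0]⟩

end Slices

/-! ### Polytopes are polyhedra. -/

section Polytopes

variable {V : Type*} [AddCommGroup V] [Module ℝ V]

/-- Fourier–Motzkin elimination: adding a ray to a polyhedron gives a polyhedron. -/
theorem IsPolyhedron.add_ray {P : Set V} (hP : IsPolyhedron P) (e : V) :
    IsPolyhedron {y | ∃ t : ℝ, 0 ≤ t ∧ y - t • e ∈ P} := by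
  classical
  obtain ⟨T, rfl⟩ := hP
  set pos := T.filter fun c => 0 < c.1 e with hpos
  set neg := T.filter fun c => c.1 e < 0 with hneg
  -- Constraints with c(e) > 0 bound t from below and those with c(e) < 0 from above; each such pair
  -- is combined with multipliers that cancel t.
  refine ⟨(T.filter fun c => c.1 e ≤ 0) ∪ (pos ×ˢ neg).image fun q =>
    (q.1.1 e • q.2.1 - q.2.1 e • q.1.1, q.1.1 e * q.2.2 - q.2.1 e * q.1.2), ?_⟩
  ext y
  constructor
  · rintro ⟨t, ht, hy⟩ c hc
    rcases Finset.mem_union.1 hc with hc | hc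
    · obtain ⟨hc, hce⟩ := Finset.mem_filter.1 hc
      have := hy c hc
      simp only [map_sub, map_smul, smul_eq_mul] at this
      nlinarith
    · obtain ⟨⟨a, b⟩, hab, rfl⟩ := Finset.mem_image.1 hc
      obtain ⟨ha, hb⟩ := Finset.mem_product.1 hab
      obtain ⟨ha, hae⟩ := Finset.mem_filter.1 ha
      obtain ⟨hb, hbe⟩ := Finset.mem_filter.1 hb
      have h1 := hy a ha
      have h2 := hy b hb
      simp only [map_sub, map_smul, smul_eq_mul] at h1 h2
      simp only [LinearMap.sub_apply, LinearMap.smul_apply, smul_eq_mul]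
      have h3 := mul_le_mul_of_nonneg_left h2 hae.le
      have h4 := mul_le_mul_of_nonneg_left h1 (neg_nonneg.2 hbe.le)
      linarith
  · intro h
    have h1 : ∀ c ∈ T, c.1 e ≤ 0 → c.1 y ≤ c.2 := fun c hc hce =>
      h c (Finset.mem_union_left _ (Finset.mem_filter.2 ⟨hc, hce⟩))
    have h2 : ∀ a ∈ T, 0 < a.1 e → ∀ b ∈ T, b.1 e < 0 →
        a.1 e * b.1 y - b.1 e * a.1 y ≤ a.1 e * b.2 - b.1 e * a.2 := fun a ha hae b hb hbe => by
      have := h (a.1 e • b.1 - b.1 e • a.1, a.1 e * b.2 - b.1 e * a.2)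
        (Finset.mem_union_right _ (Finset.mem_image.2 ⟨(a, b), Finset.mem_product.2
          ⟨Finset.mem_filter.2 ⟨ha, hae⟩, Finset.mem_filter.2 ⟨hb, hbe⟩⟩, rfl⟩))
      simpa using this
    -- Take for t the largest of its lower bounds, including 0; the combined constraints say that it
    -- respects every upper bound.
    obtain ⟨t, ht, hmax⟩ := (insert 0 (pos.image fun c => (c.1 y - c.2) / c.1 e)).exists_max_image
      id ⟨0, Finset.mem_insert_self _ _⟩
    have ht0 : 0 ≤ t := hmax 0 (Finset.mem_insert_self _ _)
    refine ⟨t, ht0, fun c hc => ?_⟩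
    simp only [map_sub, map_smul, smul_eq_mul]
    rcases lt_trichotomy (c.1 e) 0 with hce | hce | hce
    · rcases Finset.mem_insert.1 ht with rfl | ht
      · have := h1 c hc hce.le
        linarith
      · obtain ⟨a, ha, rfl⟩ := Finset.mem_image.1 ht
        obtain ⟨ha, hae⟩ := Finset.mem_filter.1 ha
        have h3 := h2 a ha hae c hc hce
        rw [div_mul_eq_mul_div, sub_le_iff_le_add, ← sub_le_iff_le_add', le_div_iff₀ hae]
        linarith
    · have := h1 c hc hce.le
      rw [hce]; linarith
    · have := hmax ((c.1 y - c.2) / c.1 e) (Finset.mem_insert_of_mem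
        (Finset.mem_image.2 ⟨c, Finset.mem_filter.2 ⟨hc, hce⟩, rfl⟩))
      simp only [id, div_le_iff₀ hce] at this
      linarith

theorem isPolyhedron_singleton_zero [FiniteDimensional ℝ V] : IsPolyhedron ({0} : Set V) := by
  classical
  set b := Module.finBasis ℝ V
  refine ⟨Finset.univ.image (fun i => (b.coord i, (0 : ℝ))) ∪
    Finset.univ.image (fun i => (-b.coord i, (0 : ℝ))), ?_⟩
  ext y
  constructor
  · rintro rfl c hc
    simp only [Finset.mem_union, Finset.mem_image] at hc
    rcases hc with ⟨i, -, rfl⟩ | ⟨i, -, rfl⟩ <;> simp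
  · intro h
    refine b.ext_elem fun i => le_antisymm ?_ ?_
    · simpa using h (b.coord i, 0) (by simp)
    · simpa using h (-b.coord i, 0) (by simp)

theorem isPolyhedron_finite_cone [FiniteDimensional ℝ V] {ι : Type*} (s : Finset ι) (g : ι → V) :
    IsPolyhedron {y | ∃ w : ι → ℝ, (∀ a ∈ s, 0 ≤ w a) ∧ ∑ a ∈ s, w a • g a = y} := by
  classical
  induction s using Finset.induction_on with
  | empty =>
    convert isPolyhedron_singleton_zero (V := V) using 1
    ext y
    simp [eq_comm]
  | insert a s ha ih =>
    convert ih.add_ray (g a) using 1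
    ext y
    constructor
    · rintro ⟨w, hw, rfl⟩
      refine ⟨w a, hw a (Finset.mem_insert_self _ _), w,
        fun b hb => hw b (Finset.mem_insert_of_mem hb), ?_⟩
      rw [Finset.sum_insert ha]; abel
    · rintro ⟨t, ht, w, hw, hy⟩
      refine ⟨Function.update w a t, ?_, ?_⟩
      · intro b hb
        rcases Finset.mem_insert.1 hb with rfl | hb'
        · simpa using ht
        · rw [Function.update_of_ne (by rintro rfl; exact ha hb')]
          exact hw b hb'
      · rw [Finset.sum_insert ha, Function.update_self]
        have : ∑ b ∈ s, Function.update w a t b • g b = ∑ b ∈ s, w b • g b :=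
          Finset.sum_congr rfl fun b hb => by
            rw [Function.update_of_ne (by rintro rfl; exact ha hb)]
        rw [this, hy]; abel

theorem IsPolyhedron.preimage_prod_one {P : Set (V × ℝ)} (hP : IsPolyhedron P) :
    IsPolyhedron {x : V | (x, (1 : ℝ)) ∈ P} := by
  classical
  obtain ⟨T, rfl⟩ := hP
  refine ⟨T.image fun c => (c.1 ∘ₗ LinearMap.inl ℝ V ℝ, c.2 - c.1 (0, 1)), ?_⟩
  have hsplit : ∀ (c : Module.Dual ℝ (V × ℝ)) (x : V), c (x, 1) = c (x, 0) + c (0, 1) :=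
    fun c x => by rw [← map_add]; simp
  ext x
  constructor
  · intro h c hc
    obtain ⟨d, hd, rfl⟩ := Finset.mem_image.1 hc
    have := h d hd
    rw [hsplit] at this
    simp only [LinearMap.comp_apply, LinearMap.inl_apply]
    linarith
  · intro h d hd
    have := h _ (Finset.mem_image_of_mem _ hd)
    simp only [LinearMap.comp_apply, LinearMap.inl_apply] at this
    rw [hsplit]
    linarith

/-- The hull is the slice at height 1 of the cone generated by the points (a, 1), and that cone is
built one ray at a time. -/
theorem isPolyhedron_convexHull [FiniteDimensional ℝ V] (s : Finset V) :
    IsPolyhedron (convexHull ℝ (s : Set V)) := by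
  convert (isPolyhedron_finite_cone s (fun a => (a, (1 : ℝ)))).preimage_prod_one using 1
  ext x
  rw [Finset.mem_convexHull']
  refine exists_congr fun w => and_congr_right fun _ => ?_
  have h1 : (∑ a ∈ s, w a • (a, (1 : ℝ))).1 = ∑ a ∈ s, w a • a := by simp [Prod.fst_sum]
  have h2 : (∑ a ∈ s, w a • (a, (1 : ℝ))).2 = ∑ a ∈ s, w a := by simp [Prod.snd_sum]
  rw [Prod.ext_iff, h1, h2]
  exact and_comm

end Polytopes

/-! ### From polytopal complexes to cell complexes. -/

section Bridge

variable {E : Type*} [NormedAddCommGroup E] [NormedSpace ℝ E] [FiniteDimensional ℝ E]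

/-- The sum of the constraint functionals active at `y` exposes the minimal face: it is maximal
exactly where all of them are equalities. -/
theorem IsPolyhedron.isExposed_minFace {P : Set E} (hP : IsPolyhedron P) {y : E} (hy : y ∈ P) :
    IsExposed ℝ P (minFace P y) := by
  classical
  obtain ⟨T, rfl⟩ := hP
  intro _
  set A := T.filter fun c => c.1 y = c.2 with hA
  refine ⟨LinearMap.toContinuousLinearMap (∑ c ∈ A, c.1), ?_⟩
  have hsum : ∀ z, LinearMap.toContinuousLinearMap (∑ c ∈ A, c.1) z = ∑ c ∈ A, c.1 z :=
    fun z => by simp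
  have hle : ∀ z, (∀ c ∈ T, c.1 z ≤ c.2) → ∑ c ∈ A, c.1 z ≤ ∑ c ∈ A, c.2 := fun z hz =>
    Finset.sum_le_sum fun c hc => hz c (Finset.mem_filter.1 hc).1
  ext z
  rw [mem_minFace_polyhedron hy]
  constructor
  · rintro ⟨hz, hzA⟩
    refine ⟨hz, fun w hw => ?_⟩
    rw [hsum, hsum]
    refine (hle w hw).trans (le_of_eq (Finset.sum_congr rfl fun c hc => ?_))
    obtain ⟨h1, h2⟩ := Finset.mem_filter.1 hc
    exact (hzA c h1 h2).symm
  · rintro ⟨hz, hmax⟩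
    refine ⟨hz, fun c hc hcy => ?_⟩
    have h1 := hmax y hy
    rw [hsum, hsum] at h1
    have h2 : ∑ c ∈ A, c.1 y = ∑ c ∈ A, c.2 :=
      Finset.sum_congr rfl fun c hc => (Finset.mem_filter.1 hc).2
    have h3 : ∑ c ∈ A, c.1 z = ∑ c ∈ A, c.2 := le_antisymm (hle z hz) (h2 ▸ h1)
    exact (Finset.sum_eq_sum_iff_of_le fun c hc => hz c (Finset.mem_filter.1 hc).1).1 h3 c
      (Finset.mem_filter.2 ⟨hc, hcy⟩)

/-- The nonempty faces of a polytopal complex. -/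
def cells (C : Set (Set E)) : Set (Set E) := {σ ∈ C | σ.Nonempty}

theorem IsPolytopalComplex.isCellComplex {C : Set (Set E)} (hC : IsPolytopalComplex C) :
    IsCellComplex (cells C) where
  finite := hC.finite.subset fun _ hσ => hσ.1
  nonempty := fun _ hσ => hσ.2
  isPolyhedron := fun σ hσ => by
    obtain ⟨s, rfl⟩ := hC.isPolytope σ hσ.1
    exact isPolyhedron_convexHull s
  minFace_mem := fun σ hσ y hy => by
    refine ⟨hC.face_mem σ hσ.1 _ (IsPolyhedron.isExposed_minFace ?_ hy), y, self_mem_minFace hy⟩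
    obtain ⟨s, rfl⟩ := hC.isPolytope σ hσ.1
    exact isPolyhedron_convexHull s
  minFace_eq := fun σ hσ τ hτ y hyσ hyτ => by
    obtain ⟨h1, h2⟩ := hC.inter_face σ hσ.1 τ hτ.1
    rw [minFace_eq_of_isExtreme h1.isExtreme ⟨hyσ, hyτ⟩,
      minFace_eq_of_isExtreme h2.isExtreme ⟨hyσ, hyτ⟩]

/-- A segment from any z in `σ` to `y` lies in the affine span, so it can be continued slightly past
`y` without leaving `σ`. -/
theorem minFace_eq_self_of_mem_intrinsicInterior {σ : Set E} {y : E}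
    (hy : y ∈ intrinsicInterior ℝ σ) : minFace σ y = σ := by
  have hyσ : y ∈ σ := intrinsicInterior_subset hy
  refine (minFace_subset σ y).antisymm fun z hz => ?_
  obtain ⟨y', hy', rfl⟩ := mem_intrinsicInterior.1 hy
  have hmem : ∀ t : ℝ, t • ((y' : E) - z) + (y' : E) ∈ affineSpan ℝ σ := fun t =>
    AffineSubspace.smul_vsub_vadd_mem _ t y'.2 (subset_affineSpan ℝ σ hz) y'.2
  have hcont : Continuous fun t : ℝ => (⟨t • ((y' : E) - z) + y', hmem t⟩ : affineSpan ℝ σ) :=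
    Continuous.subtype_mk (by fun_prop) _
  have hnhds := hcont.continuousAt (x := 0) |>.preimage_mem_nhds
    (t := interior ((↑) ⁻¹' σ : Set (affineSpan ℝ σ)))
    (isOpen_interior.mem_nhds (by simpa using hy'))
  have hev : ∀ᶠ t : ℝ in nhdsWithin 0 (Set.Ioi 0),
      (⟨t • ((y' : E) - z) + y', hmem t⟩ : affineSpan ℝ σ) ∈
        interior ((↑) ⁻¹' σ : Set (affineSpan ℝ σ)) := nhdsWithin_le_nhds hnhds
  obtain ⟨t, ht, ht0⟩ := (hev.and self_mem_nhdsWithin).exists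
  have ht0 : 0 < t := ht0
  have htσ : t • ((y' : E) - z) + y' ∈ σ := by
    have := interior_subset ht
    exact this
  refine ⟨hz, _, htσ, t / (1 + t), 1 / (1 + t), by positivity, by positivity,
    by field_simp; ring, ?_⟩
  match_scalars <;> field_simp <;> ring

/-- A functional exposing `σ` in `τ` is constant on `σ`; equal direction spaces would make it
constant on `τ`, so `σ` would be all of `τ`. Thus non-increasing dimension orders proper supersets
first. -/
theorem IsPolytopalComplex.dim_lt {C : Set (Set E)} (hC : IsPolytopalComplex C) {σ τ : Set E}
    (hσ : σ ∈ cells C) (hτ : τ ∈ C) (h : σ ⊂ τ) : dim σ < dim τ := by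
  by_contra hle
  push Not at hle
  have hspan : vectorSpan ℝ σ = vectorSpan ℝ τ :=
    Submodule.eq_of_le_of_finrank_le (vectorSpan_mono ℝ h.1) hle
  obtain ⟨h1, -⟩ := hC.inter_face τ hτ σ hσ.1
  rw [Set.inter_eq_right.2 h.1] at h1
  obtain ⟨l, hl⟩ := h1 hσ.2
  obtain ⟨x, hx⟩ := hσ.2
  have hx' := hl ▸ hx
  have hker : vectorSpan ℝ σ ≤ LinearMap.ker (l : E →ₗ[ℝ] ℝ) := by
    rw [vectorSpan_def, Submodule.span_le]
    rintro _ ⟨a, ha, b, hb, rfl⟩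
    rw [hl] at ha hb
    have := le_antisymm (ha.2 b hb.1) (hb.2 a ha.1)
    simp [this]
  refine h.2 fun z hz => ?_
  have hzx : z - x ∈ LinearMap.ker (l : E →ₗ[ℝ] ℝ) :=
    hker (hspan ▸ vsub_mem_vectorSpan ℝ hz (h.1 hx))
  have hzx : l z = l x := by
    rw [LinearMap.mem_ker] at hzx
    simpa [sub_eq_zero] using hzx
  rw [hl]
  exact ⟨hz, fun y hy => hzx ▸ hx'.2 y hy⟩

end Bridge

/-! ### Derived subdivisions as complexes of chains of faces. -/

section Derived

variable {E : Type*} [NormedAddCommGroup E] [NormedSpace ℝ E] [FiniteDimensional ℝ E]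

theorem exists_greatest_of_isChain {α : Type*} [PartialOrder α] {c : Finset α}
    (hc : IsChain (· ≤ ·) (c : Set α)) (hne : c.Nonempty) : ∃ m ∈ c, ∀ a ∈ c, a ≤ m := by
  obtain ⟨m, hm⟩ := c.exists_maximal hne
  refine ⟨m, hm.1, fun a ha => ?_⟩
  rcases hc.total ha hm.1 with h | h
  · exact h
  · exact hm.2 ha h

theorem mem_convexHull_insert {s : Set E} {x y : E} (h : y ∈ convexHull ℝ (insert x s)) :
    y = x ∨ ∃ z ∈ convexHull ℝ s, ∃ a b : ℝ, 0 ≤ a ∧ 0 ≤ b ∧ a + b = 1 ∧ y = a • x + b • z := by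
  rcases s.eq_empty_or_nonempty with rfl | hs
  · left; simpa using h
  · right
    rw [convexHull_insert hs, mem_convexJoin] at h
    obtain ⟨x', rfl, z, hz, a, b, ha, hb, hab, rfl⟩ := h
    exact ⟨z, hz, a, b, ha, hb, hab, rfl⟩

/-- `p` chooses a point in the relative interior of each cell. -/
def IsCenterChoice (X : Set (Set E)) (p : Set E → E) : Prop :=
  ∀ τ ∈ X, p τ ∈ τ ∧ minFace τ (p τ) = τ

variable {X : Set (Set E)} {p : Set E → E}

/-- A point of the cone over `σ` by centers of a chain of cells lies in `σ` or in the relative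
interior of one of the cells. -/
theorem IsCellComplex.exists_carrier (hX : IsCellComplex X) (hp : IsCenterChoice X p) {σ : Set E}
    (hσ : Convex ℝ σ) {c : Finset (Set E)} (hc : c ∈ finsetChains X) (hσc : ∀ τ ∈ c, σ ⊆ τ) {y : E}
    (hy : y ∈ convexHull ℝ (σ ∪ p '' c)) : y ∈ σ ∨ ∃ τ ∈ c, y ∈ τ ∧ minFace τ y = τ := by
  classical
  induction hn : c.card using Nat.strong_induction_on generalizing c y with
  | _ n ih =>
    rcases c.eq_empty_or_nonempty with rfl | hne
    · left
      simpa [hσ.convexHull_eq] using hy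
    -- Split off the center of the largest cell: a point giving it positive weight is in the
    -- relative interior of that cell, and otherwise the chain is shorter.
    obtain ⟨τ, hτ, hmax⟩ := exists_greatest_of_isChain hc.2 hne
    have hτX := hc.1 hτ
    have hsplit : σ ∪ p '' c = insert (p τ) (σ ∪ p '' (c.erase τ)) := by
      nth_rewrite 1 [← Finset.insert_erase hτ]
      rw [Finset.coe_insert, Set.image_insert_eq, Set.union_insert]
    have hsub : convexHull ℝ (σ ∪ p '' (c.erase τ)) ⊆ τ := by
      refine convexHull_min (Set.union_subset (hσc τ hτ) ?_) (hX.convex hτX)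
      rintro _ ⟨ρ, hρ, rfl⟩
      exact hmax ρ (Finset.mem_of_mem_erase hρ) (hp ρ (hc.1 (Finset.mem_of_mem_erase hρ))).1
    have hin : ∀ y ∈ convexHull ℝ (σ ∪ p '' (c.erase τ)),
        y ∈ σ ∨ ∃ τ ∈ c, y ∈ τ ∧ minFace τ y = τ := fun y hy => by
      refine (ih _ ?_ (finsetChains_mono_mem hc (Finset.erase_subset τ c))
        (fun ρ hρ => hσc ρ (Finset.mem_of_mem_erase hρ)) hy rfl).imp_right ?_
      · rw [← hn]; exact Finset.card_erase_lt_of_mem hτ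
      · rintro ⟨ρ, hρ, h⟩
        exact ⟨ρ, Finset.mem_of_mem_erase hρ, h⟩
    rw [hsplit] at hy
    rcases mem_convexHull_insert hy with rfl | ⟨z, hz, a, b, ha, hb, hab, rfl⟩
    · exact Or.inr ⟨τ, hτ, hp τ hτX⟩
    · rcases ha.eq_or_lt with rfl | ha
      · have : b = 1 := by linarith
        subst this
        simpa using hin z hz
      right
      refine ⟨τ, hτ, hX.convex hτX (hp τ hτX).1 (hsub hz) ha.le hb hab, ?_⟩
      rcases hb.eq_or_lt with rfl | hb
      · have : a = 1 := by linarith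
        subst this
        simpa using (hp τ hτX).2
      · exact minFace_eq_self_of_openSegment (hX.convex hτX) (hp τ hτX).1 (hp τ hτX).2 (hsub hz)
          ⟨a, b, ha, hb, hab, rfl⟩

theorem IsCellComplex.eq_of_minFace_eq (hX : IsCellComplex X) {σ τ : Set E} (hσ : σ ∈ X)
    (hτ : τ ∈ X) {y : E} (h1 : y ∈ σ ∧ minFace σ y = σ) (h2 : y ∈ τ ∧ minFace τ y = τ) : σ = τ := by
  rw [← h1.2, hX.minFace_eq σ hσ τ hτ y h1.1 h2.1, h2.2]

theorem IsCellComplex.mem_of_center_mem (hX : IsCellComplex X) (hp : IsCenterChoice X p)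
    {c : Finset (Set E)} (hc : c ∈ finsetChains X) {τ : Set E} (hτ : τ ∈ X)
    (h : p τ ∈ convexHull ℝ (p '' c)) : τ ∈ c := by
  obtain h | ⟨ρ, hρ, h2⟩ := hX.exists_carrier hp convex_empty hc (fun _ _ => Set.empty_subset _)
    (by simpa using h)
  · exact h.elim
  · rwa [hX.eq_of_minFace_eq hτ (hc.1 hρ) (hp τ hτ) h2]

/-- The stage of the derived subdivision at which the faces in `U` have been subdivided. -/
def partialDerived (C : Set (Set E)) (p : Set E → E) (U : Set (Set E)) : Set (Set E) :=
  {ρ | ∃ σ ∈ C, σ ∉ U ∧ ∃ c ∈ finsetChains U, (∀ τ ∈ c, σ ⊆ τ) ∧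
    ρ = convexHull ℝ (σ ∪ p '' c)}

theorem IsPolytopalComplex.convex {C : Set (Set E)} (hC : IsPolytopalComplex C) {σ : Set E}
    (hσ : σ ∈ C) : Convex ℝ σ := by
  obtain ⟨s, rfl⟩ := hC.isPolytope σ hσ
  exact convex_convexHull ℝ _

theorem IsPolytopalComplex.subset_or_mem_of_center_mem {C : Set (Set E)}
    (hC : IsPolytopalComplex C) (hp : IsCenterChoice (cells C) p) {σ : Set E} (hσ : σ ∈ C)
    {c : Finset (Set E)} (hc : c ∈ finsetChains (cells C)) (hσc : ∀ τ ∈ c, σ ⊆ τ) {τ : Set E}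
    (hτ : τ ∈ cells C) (h : p τ ∈ convexHull ℝ (σ ∪ p '' c)) : τ ⊆ σ ∨ τ ∈ c := by
  have hX := hC.isCellComplex
  obtain h | ⟨ρ, hρ, h2⟩ := hX.exists_carrier hp (hC.convex hσ) hc hσc h
  · exact Or.inl (hX.subset_of_mem hτ ⟨hσ, _, h⟩ (hp τ hτ).1 (hp τ hτ).2 h)
  · right
    rwa [hX.eq_of_minFace_eq hτ (hc.1 hρ) (hp τ hτ) h2]

theorem finsetChains_mono {α : Type*} [PartialOrder α] {Q R : Set α} (h : Q ⊆ R) :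
    finsetChains Q ⊆ finsetChains R := fun _ hc => ⟨hc.1.trans h, hc.2⟩

/-- By `hup`, the faces of the current stage containing `τ` are exactly those with base `τ`. The
stellar move replaces them by cones from `p τ`, over proper faces σ of `τ` joined with centers; by
`hlow`, `τ` is the least element of the lengthened chain. -/
theorem IsPolytopalComplex.stellar_partialDerived {C : Set (Set E)} (hC : IsPolytopalComplex C)
    (hp : IsCenterChoice (cells C) p) {U : Set (Set E)} (hU : U ⊆ cells C) {τ : Set E}
    (hτ : τ ∈ cells C) (hτU : τ ∉ U) (hup : ∀ ρ ∈ C, τ ⊂ ρ → ρ ∈ U) (hlow : ∀ ρ ∈ U, ¬ ρ ⊆ τ) :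
    stellar (partialDerived C p U) τ (p τ) = partialDerived C p (insert τ U) := by
  classical
  have hXc := hC.isCellComplex
  have hcU : ∀ c ∈ finsetChains U, c ∈ finsetChains (cells C) := fun c hc => finsetChains_mono hU hc
  have hcontains : ∀ σ ∈ C, σ ∉ U → ∀ c ∈ finsetChains U, (∀ ρ ∈ c, σ ⊆ ρ) →
      (τ ⊆ convexHull ℝ (σ ∪ p '' c) ↔ σ = τ) := by
    intro σ hσ hσU c hc hσc
    constructor
    · intro h
      rcases hC.subset_or_mem_of_center_mem hp hσ (hcU c hc) hσc hτ (h (hp τ hτ).1) with h | h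
      · by_contra hne
        exact hσU (hup σ hσ (lt_of_le_of_ne h (Ne.symm hne)))
      · exact absurd (hc.1 h) hτU
    · rintro rfl
      exact Set.subset_union_left.trans (subset_convexHull ℝ _)
  have hins : ∀ (σ : Set E) (c : Finset (Set E)),
      convexHull ℝ (insert (p τ) (convexHull ℝ (σ ∪ p '' c))) =
        convexHull ℝ (σ ∪ p '' (insert τ c : Finset (Set E))) := by
    intro σ c
    have : convexHull ℝ (insert (p τ) (convexHull ℝ (σ ∪ p '' c))) =
        convexHull ℝ (insert (p τ) (σ ∪ p '' c)) :=
      (convexHull_min (Set.insert_subset (subset_convexHull ℝ _ (Set.mem_insert _ _))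
        (convexHull_mono (Set.subset_insert _ _))) (convex_convexHull ℝ _)).antisymm
        (convexHull_mono (Set.insert_subset_insert (subset_convexHull ℝ _)))
    rw [this, Finset.coe_insert, Set.image_insert_eq, Set.union_insert]
  ext ρ
  constructor
  · rintro (⟨⟨σ, hσ, hσU, c, hc, hσc, rfl⟩, hnot⟩ |
      ⟨s, ⟨⟨⟨σ, hσ, hσU, c, hc, hσc, rfl⟩, _, ⟨σ', hσ', hσU', c', hc', hσc', rfl⟩, hτs, hss⟩, hnot⟩,
        rfl⟩)
    · rw [hcontains σ hσ hσU c hc hσc] at hnot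
      exact ⟨σ, hσ, fun h => h.elim hnot hσU, c,
        finsetChains_mono (Set.subset_insert τ U) hc, hσc, rfl⟩
    · rw [hcontains σ hσ hσU c hc hσc] at hnot
      obtain rfl := (hcontains σ' hσ' hσU' c' hc' hσc').1 hτs
      -- The center of each ρ in `c` lies in the ambient star face, whose base is `τ` (now called
      -- σ'), so ρ belongs to the chain of that face or is contained in `τ`; the latter is excluded.
      have hcτ : ∀ ρ ∈ c, σ' ⊆ ρ := fun ρ hρ => by
        have hρX := hU (hc.1 hρ)
        rcases hC.subset_or_mem_of_center_mem hp hσ' (hcU c' hc') hσc' hρX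
          (hss (subset_convexHull ℝ _ (Or.inr ⟨ρ, hρ, rfl⟩))) with h | h
        · exact absurd h (hlow ρ (hc.1 hρ))
        · exact hσc' ρ h
      have hστ : σ ⊆ σ' := by
        rcases σ.eq_empty_or_nonempty with rfl | hne
        · exact Set.empty_subset _
        rcases hC.subset_or_mem_of_center_mem hp hσ' (hcU c' hc') hσc' ⟨hσ, hne⟩
          (hss (subset_convexHull ℝ _ (Or.inl (hp σ ⟨hσ, hne⟩).1))) with h | h
        · exact h
        · exact absurd (hc'.1 h) hσU
      refine ⟨σ, hσ, fun h => h.elim hnot hσU, insert σ' c, ⟨?_, ?_⟩, ?_, hins σ c⟩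
      · rw [Finset.coe_insert]
        exact Set.insert_subset_insert hc.1
      · rw [Finset.coe_insert]
        exact hc.2.insert fun b hb _ => Or.inl (hcτ b hb)
      · intro ρ hρ
        rcases Finset.mem_insert.1 hρ with rfl | hρ
        · exact hστ
        · exact hσc ρ hρ
  · rintro ⟨σ, hσ, hσU, c, hc, hσc, rfl⟩
    have hστ : σ ≠ τ := fun h => hσU (Or.inl h)
    have hσU' : σ ∉ U := fun h => hσU (Or.inr h)
    by_cases hτc : τ ∈ c
    · right
      have hc' : c.erase τ ∈ finsetChains U := by
        refine ⟨fun ρ hρ => ?_, hc.2.mono (Finset.erase_subset τ c)⟩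
        obtain ⟨h1, h2⟩ := Finset.mem_erase.1 hρ
        exact (hc.1 h2).resolve_left h1
      have hτc' : ∀ ρ ∈ c.erase τ, τ ⊆ ρ := fun ρ hρ => by
        rcases hc.2.total hτc (Finset.mem_of_mem_erase hρ) with h | h
        · exact h
        · exact absurd h (hlow ρ (hc'.1 hρ))
      have hσc' : ∀ ρ ∈ c.erase τ, σ ⊆ ρ := fun ρ hρ => hσc ρ (Finset.mem_of_mem_erase hρ)
      refine ⟨convexHull ℝ (σ ∪ p '' (c.erase τ)), ⟨⟨⟨σ, hσ, hσU', _, hc', hσc', rfl⟩, _,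
        ⟨τ, hτ.1, hτU, _, hc', hτc', rfl⟩, ?_, ?_⟩, ?_⟩, ?_⟩
      · exact Set.subset_union_left.trans (subset_convexHull ℝ _)
      · exact convexHull_mono (Set.union_subset_union_left _ (hσc τ hτc))
      · rw [hcontains σ hσ hσU' _ hc' hσc']
        exact hστ
      · rw [hins, Finset.insert_erase hτc]
    · left
      have hc' : c ∈ finsetChains U :=
        ⟨fun ρ hρ => (hc.1 hρ).resolve_left fun h => hτc (h ▸ hρ), hc.2⟩
      refine ⟨⟨σ, hσ, hσU', c, hc', hσc, rfl⟩, ?_⟩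
      rw [hcontains σ hσ hσU' c hc' hσc]
      exact hστ

/-- A derived subdivision consists of the simplices spanned by the centers of chains of faces. -/
theorem IsDerivedSubdivision.exists_eq_image {C D : Set (Set E)} (hC : IsPolytopalComplex C)
    (hne : ∅ ∈ C) (hD : IsDerivedSubdivision C D) : ∃ p, IsCenterChoice (cells C) p ∧
      D = (fun c : Finset (Set E) => convexHull ℝ (p '' c)) '' finsetChains (cells C) := by
  obtain ⟨l, p, hnodup, hmem, hpair, hrel, rfl⟩ := hD
  have hmem' : ∀ τ, τ ∈ l ↔ τ ∈ cells C := hmem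
  have hp : IsCenterChoice (cells C) p := fun τ hτ =>
    ⟨intrinsicInterior_subset (hrel τ ((hmem τ).2 hτ)),
      minFace_eq_self_of_mem_intrinsicInterior (hrel τ ((hmem τ).2 hτ))⟩
  refine ⟨p, hp, ?_⟩
  -- Here `l₁` lists the faces already subdivided, and `l₂` those still to come.
  have key : ∀ l₂ l₁ : List (Set E), l = l₁ ++ l₂ →
      l₂.foldl (fun L τ => stellar L τ (p τ)) (partialDerived C p {τ | τ ∈ l₁}) =
        partialDerived C p {τ | τ ∈ l} := by
    intro l₂
    induction l₂ with
    | nil => rintro l₁ rfl; simp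
    | cons τ l₂ ih =>
      intro l₁ hl
      rw [List.foldl_cons]
      have hτ : τ ∈ cells C := (hmem' τ).1 (by rw [hl]; simp)
      rw [hl] at hnodup hpair
      have hnd := List.nodup_append.1 hnodup
      have hpw := List.pairwise_append.1 hpair
      have hτ₁ : τ ∉ l₁ := fun h => hnd.2.2 τ h τ (by simp) rfl
      rw [hC.stellar_partialDerived hp (U := {τ | τ ∈ l₁}) ?_ hτ hτ₁ ?_ ?_]
      · rw [← ih (l₁ ++ [τ]) (by rw [hl]; simp)]
        congr 2
        ext x
        simp [or_comm]
      · intro ρ hρ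
        exact (hmem' ρ).1 (by rw [hl]; exact List.mem_append_left _ hρ)
      · intro ρ hρ hτρ
        have hρl : ρ ∈ l := (hmem' ρ).2 ⟨hρ, hτ.2.mono hτρ.1⟩
        have hdim := hC.dim_lt hτ hρ hτρ
        rw [hl] at hρl
        rcases List.mem_append.1 hρl with h | h
        · exact h
        · rcases List.mem_cons.1 h with rfl | h
          · exact absurd hdim (lt_irrefl _)
          · exact absurd ((List.pairwise_cons.1 hpw.2.1).1 ρ h) hdim.not_ge
      · intro ρ hρ hρτ
        have hle := hpw.2.2 ρ hρ τ (by simp)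
        have hρX : ρ ∈ cells C := (hmem' ρ).1 (by rw [hl]; exact List.mem_append_left _ hρ)
        by_cases heq : ρ = τ
        · exact hτ₁ (heq ▸ hρ)
        · exact absurd hle (hC.dim_lt hρX hτ.1 (lt_of_le_of_ne hρτ heq)).not_ge
  have h0 : partialDerived C p {τ | τ ∈ ([] : List (Set E))} = C := by
    ext ρ
    constructor
    · rintro ⟨σ, hσ, -, c, hc, -, rfl⟩
      have : c = ∅ := Finset.eq_empty_of_forall_notMem fun x hx => by simpa using hc.1 hx
      subst this
      simpa [(hC.convex hσ).convexHull_eq] using hσ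
    · intro hρ
      exact ⟨ρ, hρ, by simp, ∅, ⟨by simp, by simp⟩, by simp, by simp [(hC.convex hρ).convexHull_eq]⟩
  have h1 := key l [] rfl
  rw [h0] at h1
  rw [h1]
  have hset : {τ | τ ∈ l} = cells C := Set.ext hmem'
  rw [hset]
  ext ρ
  constructor
  · rintro ⟨σ, hσ, hσU, c, hc, -, rfl⟩
    -- Once all nonempty faces have been subdivided, the only admissible base is the empty face, and
    -- pure chains remain.
    have : σ = ∅ := by
      by_contra h
      exact hσU ⟨hσ, Set.nonempty_iff_ne_empty.2 h⟩
    subst this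
    exact ⟨c, hc, by simp⟩
  · rintro ⟨c, hc, rfl⟩
    exact ⟨∅, hne, fun h => by simpa using h.2, c, hc, by simp, by simp⟩

end Derived

/-! ### Faces of simplices and a criterion for simplicial complexes. -/

section Simplices

variable {E : Type*} [NormedAddCommGroup E] [NormedSpace ℝ E] [FiniteDimensional ℝ E]

/-- By Krein–Milman, an exposed face is recovered from its extreme points, which are extreme in the
polytope and hence belong to `s`. -/
theorem IsExposed.exists_eq_convexHull {s : Finset E} {F : Set E}
    (hF : IsExposed ℝ (convexHull ℝ (s : Set E)) F) : ∃ t ⊆ s, F = convexHull ℝ (t : Set E) := by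
  classical
  set t := s.filter (· ∈ F) with ht
  have hcompact : IsCompact F := hF.isCompact (s.finite_toSet.isCompact_convexHull ℝ)
  have hconv : Convex ℝ F := hF.convex (convex_convexHull ℝ _)
  refine ⟨t, Finset.filter_subset _ _, ?_⟩
  apply Set.Subset.antisymm
  · rw [← closure_convexHull_extremePoints hcompact hconv]
    refine closure_minimal (convexHull_mono fun x hx => ?_)
      (t.finite_toSet.isCompact_convexHull ℝ).isClosed
    have hxs : x ∈ (s : Set E) :=
      extremePoints_convexHull_subset (hF.isExtreme.extremePoints_subset_extremePoints hx)
    exact Finset.mem_coe.2 (Finset.mem_filter.2 ⟨hxs, hx.1⟩)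
  · exact convexHull_min (fun x hx => (Finset.mem_filter.1 hx).2) hconv

theorem exists_affine_coord {s : Set E} (hs : AffineIndependent ℝ ((↑) : s → E)) {b : E}
    (hb : b ∈ s) : ∃ h : E →ᵃ[ℝ] ℝ, h b = 1 ∧ ∀ a ∈ s, a ≠ b → h a = 0 := by
  obtain ⟨t, hst, hind, hspan⟩ := exists_subset_affineIndependent_affineSpan_eq_top hs
  let B : AffineBasis t ℝ E := ⟨(↑), hind, by rw [Subtype.range_coe]; exact hspan⟩
  refine ⟨B.coord ⟨b, hst hb⟩, B.coord_apply_eq ⟨b, hst hb⟩, fun a ha hne => ?_⟩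
  exact B.coord_apply_ne (i := ⟨b, hst hb⟩) (j := ⟨a, hst ha⟩)
    (fun h => hne (Subtype.ext_iff.1 h).symm)

theorem convex_setOf_affine_eq (h : E →ᵃ[ℝ] ℝ) (r : ℝ) : Convex ℝ {x | h x = r} :=
  (convex_singleton r).affine_preimage h

theorem convex_setOf_le_affine (h : E →ᵃ[ℝ] ℝ) (r : ℝ) : Convex ℝ {x | r ≤ h x} :=
  (convex_Ici r).affine_preimage h

/-- The hull of `u` is the minimal face of the barycenter of `u`. It contains no further vertex b:
the barycentric coordinate of b is nonnegative on the simplex and vanishes at the barycenter, hence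
on the whole minimal face. -/
theorem isExposed_convexHull_of_subset {s u : Finset E}
    (hs : AffineIndependent ℝ ((↑) : s → E)) (hus : u ⊆ s) :
    IsExposed ℝ (convexHull ℝ (s : Set E)) (convexHull ℝ (u : Set E)) := by
  classical
  rcases u.eq_empty_or_nonempty with rfl | hu
  · simpa using isExposed_empty
  have hcard : (0 : ℝ) < u.card := by exact_mod_cast hu.card_pos
  set r := ∑ a ∈ u, (1 / (u.card : ℝ)) • a with hr
  have hsum : ∑ _a ∈ u, (1 / (u.card : ℝ)) = 1 := by
    rw [Finset.sum_const, nsmul_eq_mul]; field_simp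
  have hru : r ∈ convexHull ℝ (u : Set E) :=
    (convex_convexHull ℝ _).sum_mem (fun _ _ => by positivity) hsum
      fun a ha => subset_convexHull ℝ _ ha
  have hrs : r ∈ convexHull ℝ (s : Set E) := convexHull_mono (by exact_mod_cast hus) hru
  have hexp := (isPolyhedron_convexHull s).isExposed_minFace hrs
  convert hexp using 1
  apply Set.Subset.antisymm
  · refine convexHull_min (fun a ha => ?_) (convex_minFace (convex_convexHull ℝ _) r)
    have has : a ∈ convexHull ℝ (s : Set E) := subset_convexHull ℝ _ (hus ha)
    rcases (Finset.one_le_card.2 hu).eq_or_lt with h1 | h1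
    · obtain ⟨b, rfl⟩ := Finset.card_eq_one.1 h1.symm
      have : r = a := by
        rw [Finset.mem_coe, Finset.mem_singleton] at ha
        simp [hr, ha]
      rw [this]
      exact self_mem_minFace has
    · have h1' : (1 : ℝ) < u.card := by exact_mod_cast h1
      have h2 : (0 : ℝ) < u.card - 1 := by linarith
      have hce : ((u.erase a).card : ℝ) = u.card - 1 := by
        rw [Finset.card_erase_of_mem ha, Nat.cast_sub h1.le, Nat.cast_one]
      refine ⟨has, ∑ b ∈ u.erase a, (1 / ((u.card : ℝ) - 1)) • b, ?_, 1 / u.card,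
        (u.card - 1) / u.card, by positivity, by positivity, by field_simp; ring, ?_⟩
      · refine (convex_convexHull ℝ _).sum_mem (fun _ _ => by positivity) ?_
          fun b hb => subset_convexHull ℝ _ (hus (Finset.mem_of_mem_erase hb))
        rw [Finset.sum_const, nsmul_eq_mul, hce]; field_simp
      · rw [hr, ← Finset.add_sum_erase u _ ha, Finset.smul_sum]
        congr 1
        refine Finset.sum_congr rfl fun b _ => ?_
        rw [smul_smul]
        congr 1
        field_simp
  · obtain ⟨t, hts, ht⟩ := IsExposed.exists_eq_convexHull hexp
    rw [ht]
    refine convexHull_mono fun b hb => ?_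
    by_contra hbu
    obtain ⟨h, hb1, h0⟩ := exists_affine_coord (s := (s : Set E)) hs (hts hb)
    have hmem : b ∈ minFace (convexHull ℝ (s : Set E)) r := ht ▸ subset_convexHull ℝ _ hb
    obtain ⟨-, w, hw, α, β, hα, hβ, hαβ, heq⟩ := hmem
    have hr0 : h r = 0 := convexHull_min (t := {x | h x = 0})
      (fun a ha => h0 a (hus ha) fun hab => hbu (hab ▸ ha)) (convex_setOf_affine_eq h 0) hru
    have hw0 : 0 ≤ h w := convexHull_min (t := {x | 0 ≤ h x}) (fun a ha => by
      by_cases hab : a = b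
      · rw [hab, Set.mem_ofPred_eq, hb1]; exact zero_le_one
      · exact (h0 a ha hab).ge) (convex_setOf_le_affine h 0) hw
    have := Convex.combo_affine_apply (f := h) (x := b) (y := w) hαβ
    rw [heq, hr0, hb1] at this
    simp only [smul_eq_mul, mul_one] at this
    nlinarith

/-- An abstract simplicial complex on points of `E` whose simplices are affinely independent and
intersect properly spans a geometric simplicial complex. -/
theorem isSimplicialComplex_image_convexHull {A : Set (Finset E)} (hfin : A.Finite)
    (hlow : IsLowerSet A) (hind : ∀ s ∈ A, AffineIndependent ℝ ((↑) : s → E))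
    (hinter : ∀ s ∈ A, ∀ t ∈ A,
      convexHull ℝ (s : Set E) ∩ convexHull ℝ (t : Set E) ⊆ convexHull ℝ ((s : Set E) ∩ t)) :
    IsSimplicialComplex ((fun s : Finset E => convexHull ℝ (s : Set E)) '' A) := by
  classical
  have hface : ∀ s ∈ A, ∀ t ∈ A, IsExposed ℝ (convexHull ℝ (s : Set E))
      (convexHull ℝ (s : Set E) ∩ convexHull ℝ (t : Set E)) := by
    intro s hs t ht
    have : convexHull ℝ (s : Set E) ∩ convexHull ℝ (t : Set E) =
        convexHull ℝ ((s ∩ t : Finset E) : Set E) := by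
      rw [Finset.coe_inter]
      exact (hinter s hs t ht).antisymm (Set.subset_inter (convexHull_mono Set.inter_subset_left)
        (convexHull_mono Set.inter_subset_right))
    rw [this]
    exact isExposed_convexHull_of_subset (hind s hs) Finset.inter_subset_left
  refine ⟨⟨hfin.image _, ?_, ?_, ?_⟩, ?_⟩
  · rintro _ ⟨s, hs, rfl⟩
    exact ⟨s, rfl⟩
  · rintro _ ⟨s, hs, rfl⟩ F hF
    obtain ⟨t, hts, rfl⟩ := IsExposed.exists_eq_convexHull hF
    exact ⟨t, hlow hts hs, rfl⟩
  · rintro _ ⟨s, hs, rfl⟩ _ ⟨t, ht, rfl⟩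
    exact ⟨hface s hs t ht, Set.inter_comm _ _ ▸ hface t ht s hs⟩
  · rintro _ ⟨s, hs, rfl⟩
    exact ⟨s, hind s hs, rfl⟩

theorem affineIndependent_insert {s : Set E} {x : E}
    (hs : AffineIndependent ℝ ((↑) : s → E)) (hx : x ∉ affineSpan ℝ s) :
    AffineIndependent ℝ ((↑) : ↥(insert x s) → E) := by
  set i : ↥(insert x s) := ⟨x, Set.mem_insert x s⟩ with hi
  have hmem : ∀ z : {y : ↥(insert x s) // y ≠ i}, (z : E) ∈ s :=
    fun z => z.1.2.resolve_left fun h => z.2 (Subtype.ext h)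
  refine AffineIndependent.affineIndependent_of_notMem_span (i := i) ?_ ?_
  · exact hs.comp_embedding (f := ⟨fun z : {y : ↥(insert x s) // y ≠ i} => (⟨z, hmem z⟩ : s),
      fun a b h => Subtype.ext (Subtype.ext (congrArg (fun q : s => (q : E)) h))⟩)
  · refine fun h => hx (affineSpan_mono ℝ ?_ h)
    rintro _ ⟨z, hz, rfl⟩
    exact hmem ⟨z, hz⟩

end Simplices

/-! ### The simplices spanned by centers form a simplicial complex. -/

section Chains

variable {E : Type*} [NormedAddCommGroup E] [NormedSpace ℝ E] [FiniteDimensional ℝ E]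
variable {X : Set (Set E)} {p : Set E → E}

theorem IsCellComplex.center_injOn (hX : IsCellComplex X) (hp : IsCenterChoice X p) :
    Set.InjOn p X := fun σ hσ τ hτ h =>
  hX.eq_of_minFace_eq hσ hτ (hp σ hσ) (h ▸ hp τ hτ)

/-- The functional exposing `σ` in `τ` is constant on the affine span of `σ`, so a point of `τ` in
that span lies in `σ`; a relative interior point of `τ` cannot. -/
theorem IsCellComplex.notMem_affineSpan_of_ssubset (hX : IsCellComplex X) {σ τ : Set E}
    (hσ : σ ∈ X) (hτ : τ ∈ X) (h : σ ⊂ τ) {y : E} (hy : y ∈ τ ∧ minFace τ y = τ) :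
    y ∉ affineSpan ℝ σ := by
  intro hspan
  obtain ⟨r, hr, hrσ⟩ := hX.exists_relint hσ
  have hrτ := hX.minFace_eq σ hσ τ hτ r hr (h.1 hr)
  have hexp := (hX.isPolyhedron τ hτ).isExposed_minFace (h.1 hr)
  rw [← hrτ, hrσ] at hexp
  obtain ⟨l, hl⟩ := hexp ⟨r, hr⟩
  have hr' := hl ▸ hr
  have hconst : ∀ z ∈ affineSpan ℝ σ, l z = l r := by
    intro z hz
    refine affineSpan_induction (p := fun z => l z = l r) hz (fun x hx => ?_) ?_
    · rw [hl] at hx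
      exact le_antisymm (hr'.2 x hx.1) (hx.2 r hr'.1)
    · intro c u v w hu hv hw
      simp [hu, hv, hw]
  have hyσ : y ∈ σ := by
    rw [hl]
    exact ⟨hy.1, fun z hz => hconst y hspan ▸ hr'.2 z hz⟩
  exact h.2 (hX.subset_of_mem hτ hσ hy.1 hy.2 hyσ)

theorem IsCellComplex.affineIndependent_centers (hX : IsCellComplex X) (hp : IsCenterChoice X p)
    {c : Finset (Set E)} (hc : c ∈ finsetChains X) :
    AffineIndependent ℝ ((↑) : (p '' (c : Set (Set E)) : Set E) → E) := by
  classical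
  induction hn : c.card using Nat.strong_induction_on generalizing c with
  | _ n ih =>
    rcases c.eq_empty_or_nonempty with rfl | hne
    · have : IsEmpty (p '' ((∅ : Finset (Set E)) : Set (Set E)) : Set E) := by simp
      exact affineIndependent_of_subsingleton ℝ _
    obtain ⟨τ, hτ, hmax⟩ := exists_greatest_of_isChain hc.2 hne
    have hsplit : p '' (c : Set (Set E)) = insert (p τ) (p '' (c.erase τ : Finset (Set E))) := by
      nth_rewrite 1 [← Finset.insert_erase hτ]
      rw [Finset.coe_insert, Set.image_insert_eq]
    have hc' : c.erase τ ∈ finsetChains X := finsetChains_mono_mem hc (Finset.erase_subset τ c)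
    have hτX := hc.1 hτ
    rw [hsplit]
    refine affineIndependent_insert
      (ih _ (by rw [← hn]; exact Finset.card_erase_lt_of_mem hτ) hc' rfl) ?_
    rcases (c.erase τ).eq_empty_or_nonempty with h0 | hne'
    · rw [h0]
      simpa using AffineSubspace.notMem_bot ℝ E (p τ)
    obtain ⟨σ, hσ, hmax'⟩ := exists_greatest_of_isChain hc'.2 hne'
    obtain ⟨hστ, hσc⟩ := Finset.mem_erase.1 hσ
    intro hmem
    refine hX.notMem_affineSpan_of_ssubset (hc.1 hσc) hτX (lt_of_le_of_ne (hmax σ hσc) hστ)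
      (hp τ hτX) (affineSpan_mono ℝ ?_ hmem)
    rintro _ ⟨ρ, hρ, rfl⟩
    exact hmax' ρ hρ (hp ρ (hc'.1 hρ)).1

/-- The point at which the ray from a center through a point leaves the cell is unique. -/
theorem IsCellComplex.weight_le_of_combo_eq (hX : IsCellComplex X) (hp : IsCenterChoice X p)
    {τ : Set E} (hτ : τ ∈ X) {c c' : Finset (Set E)} (hc : c ∈ finsetChains X) (hτc : τ ∉ c)
    (hc' : c' ∈ finsetChains X) (hc'τ : ∀ ρ ∈ c', ρ ⊆ τ) {z z' : E}
    (hz : z ∈ convexHull ℝ (p '' c)) (hz' : z' ∈ convexHull ℝ (p '' c')) {a a' : ℝ}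
    (ha'1 : a' < 1) (h : a • p τ + (1 - a) • z = a' • p τ + (1 - a') • z') :
    a' ≤ a := by
  by_contra hlt
  push Not at hlt
  have hz'τ : z' ∈ τ := by
    refine convexHull_min ?_ (hX.convex hτ) hz'
    rintro _ ⟨ρ, hρ, rfl⟩
    exact hc'τ ρ hρ (hp ρ (hc'.1 hρ)).1
  have hne : (1 - a) ≠ 0 := by linarith
  have hz_eq : ((a' - a) / (1 - a)) • p τ + ((1 - a') / (1 - a)) • z' = z := by
    have h1 : (1 - a) • z = (a' - a) • p τ + (1 - a') • z' := by
      have : (1 - a) • z = (a • p τ + (1 - a) • z) - a • p τ := by abel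
      rw [this, h]; module
    have h2 : z = (1 / (1 - a)) • ((1 - a) • z) := by
      rw [smul_smul, one_div_mul_cancel hne, one_smul]
    rw [h2, h1, smul_add, smul_smul, smul_smul, one_div_mul_eq_div, one_div_mul_eq_div]
  -- If a < a', then z sits strictly between the center and z', so it is a relative interior point
  -- of `τ`. But z lies in the relative interior of a member of `c`, and `τ` is not one.
  have hseg : z ∈ openSegment ℝ (p τ) z' :=
    ⟨(a' - a) / (1 - a), (1 - a') / (1 - a), div_pos (by linarith) (by linarith),
      div_pos (by linarith) (by linarith), by field_simp; ring, hz_eq⟩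
  have hzτ : z ∈ τ := (hX.convex hτ).openSegment_subset (hp τ hτ).1 hz'τ hseg
  have hface := minFace_eq_self_of_openSegment (hX.convex hτ) (hp τ hτ).1 (hp τ hτ).2 hz'τ hseg
  obtain h0 | ⟨ρ, hρ, h2⟩ := hX.exists_carrier hp convex_empty hc (fun _ _ => Set.empty_subset _)
    (y := z) (by simpa using hz)
  · exact h0
  · exact hτc (hX.eq_of_minFace_eq hτ (hc.1 hρ) ⟨hzτ, hface⟩ h2 ▸ hρ)

/-- Induction on the total number of cells. Either the point lies in a simplex with the top center
dropped, or it is in the relative interior of both top cells, which then coincide. In that case the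
weights of the common center agree, and so do the residual points. -/
theorem IsCellComplex.convexHull_centers_inter (hX : IsCellComplex X) (hp : IsCenterChoice X p)
    {c c' : Finset (Set E)} (hc : c ∈ finsetChains X) (hc' : c' ∈ finsetChains X) :
    convexHull ℝ (p '' c) ∩ convexHull ℝ (p '' c') ⊆
      convexHull ℝ (p '' ((c : Set (Set E)) ∩ c')) := by
  classical
  induction hn : c.card + c'.card using Nat.strong_induction_on generalizing c c' with
  | _ n ih =>
    rintro y ⟨hy, hy'⟩
    rcases c.eq_empty_or_nonempty with rfl | hne
    · simp at hy
    rcases c'.eq_empty_or_nonempty with rfl | hne'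
    · simp at hy'
    obtain ⟨τ, hτ, hmax⟩ := exists_greatest_of_isChain hc.2 hne
    obtain ⟨τ', hτ', hmax'⟩ := exists_greatest_of_isChain hc'.2 hne'
    have hτX := hc.1 hτ
    have hτX' := hc'.1 hτ'
    have hsplit : ∀ {c : Finset (Set E)} {τ}, τ ∈ c →
        p '' (c : Set (Set E)) = insert (p τ) (p '' (c.erase τ : Finset (Set E))) := by
      intro c τ hτ
      nth_rewrite 1 [← Finset.insert_erase hτ]
      rw [Finset.coe_insert, Set.image_insert_eq]
    have hce := finsetChains_mono_mem hc (Finset.erase_subset τ c)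
    have hce' := finsetChains_mono_mem hc' (Finset.erase_subset τ' c')
    have hlt := Finset.card_erase_lt_of_mem hτ
    have hlt' := Finset.card_erase_lt_of_mem hτ'
    have hsub : ∀ {c : Finset (Set E)} {τ}, τ ∈ c → c ∈ finsetChains X → (∀ a ∈ c, a ≤ τ) →
        convexHull ℝ (p '' (c.erase τ : Finset (Set E))) ⊆ τ := by
      intro c τ hτ hc hmax
      refine convexHull_min ?_ (hX.convex (hc.1 hτ))
      rintro _ ⟨ρ, hρ, rfl⟩
      exact hmax ρ (Finset.mem_of_mem_erase hρ) (hp ρ (hc.1 (Finset.mem_of_mem_erase hρ))).1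
    -- either the point already lies in the smaller simplex, or it is in the relative interior of `τ`
    have hcase : ∀ {c : Finset (Set E)} {τ}, τ ∈ c → c ∈ finsetChains X → (∀ a ∈ c, a ≤ τ) →
        y ∈ convexHull ℝ (p '' c) → y ∈ convexHull ℝ (p '' (c.erase τ : Finset (Set E))) ∨
          ((y ∈ τ ∧ minFace τ y = τ) ∧ (y = p τ ∨ ∃ z ∈ convexHull ℝ (p '' (c.erase τ : Finset (Set E))),
            ∃ a : ℝ, 0 < a ∧ a < 1 ∧ y = a • p τ + (1 - a) • z)) := by
      intro c τ hτ hc hmax hy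
      have hτX := hc.1 hτ
      rw [hsplit hτ] at hy
      rcases mem_convexHull_insert hy with rfl | ⟨z, hz, a, b, ha, hb, hab, rfl⟩
      · exact Or.inr ⟨hp τ hτX, Or.inl rfl⟩
      rcases ha.eq_or_lt with rfl | ha
      · left
        have : b = 1 := by linarith
        subst this
        simpa using hz
      rcases hb.eq_or_lt with rfl | hb
      · right
        have : a = 1 := by linarith
        subst this
        simpa using hp τ hτX
      · right
        have hb' : b = 1 - a := by linarith
        have hseg : a • p τ + b • z ∈ openSegment ℝ (p τ) z := ⟨a, b, ha, hb, hab, rfl⟩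
        refine ⟨⟨(hX.convex hτX).openSegment_subset (hp τ hτX).1 (hsub hτ hc hmax hz) hseg,
          minFace_eq_self_of_openSegment (hX.convex hτX) (hp τ hτX).1 (hp τ hτX).2
            (hsub hτ hc hmax hz) hseg⟩, Or.inr ⟨z, hz, a, ha, by linarith, by rw [hb']⟩⟩
    have hmono : ∀ {d d' : Set (Set E)}, d ⊆ c → d' ⊆ c' →
        convexHull ℝ (p '' (d ∩ d')) ⊆ convexHull ℝ (p '' ((c : Set (Set E)) ∩ c')) :=
      fun h1 h2 => convexHull_mono (Set.image_mono (Set.inter_subset_inter h1 h2))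
    rcases hcase hτ hc hmax hy with h1 | ⟨h1, h2⟩
    · exact hmono (Finset.coe_subset.2 (Finset.erase_subset τ c)) subset_rfl
        (ih _ (by omega) hce hc' rfl ⟨h1, hy'⟩)
    rcases hcase hτ' hc' hmax' hy' with h1' | ⟨h1', h2'⟩
    · exact hmono subset_rfl (Finset.coe_subset.2 (Finset.erase_subset τ' c'))
        (ih _ (by omega) hc hce' rfl ⟨hy, h1'⟩)
    obtain rfl := hX.eq_of_minFace_eq hτX hτX' h1 h1'
    have hpτ : p τ ∈ convexHull ℝ (p '' ((c : Set (Set E)) ∩ c')) :=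
      subset_convexHull ℝ _ ⟨τ, ⟨hτ, hτ'⟩, rfl⟩
    rcases h2 with rfl | ⟨z, hz, a, ha, ha1, hya⟩
    · exact hpτ
    rcases h2' with rfl | ⟨z', hz', a', ha', ha1', hya'⟩
    · exact hpτ
    have heq := hya.symm.trans hya'
    have hle := hX.weight_le_of_combo_eq hp hτX hce (Finset.notMem_erase τ c) hce'
      (fun ρ hρ => hmax' ρ (Finset.mem_of_mem_erase hρ)) hz hz' ha1' heq
    have hle' := hX.weight_le_of_combo_eq hp hτX hce' (Finset.notMem_erase τ c') hce
      (fun ρ hρ => hmax ρ (Finset.mem_of_mem_erase hρ)) hz' hz ha1 heq.symm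
    obtain rfl := le_antisymm hle' hle
    have hzz : z = z' := by
      have h3 : (1 - a) • z = (1 - a) • z' := add_left_cancel heq
      exact smul_right_injective E (by linarith : (1 - a) ≠ 0) h3
    subst hzz
    have hz2 := hmono (Finset.coe_subset.2 (Finset.erase_subset τ c))
      (Finset.coe_subset.2 (Finset.erase_subset τ c')) (ih _ (by omega) hce hce' rfl ⟨hz, hz'⟩)
    rw [hya]
    exact convex_convexHull ℝ _ hpτ hz2 ha.le (by linarith) (by ring)

theorem IsCellComplex.isRealization_centers (hX : IsCellComplex X) (hp : IsCenterChoice X p)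
    [DecidableEq (Set E)] :
    IsRealization (finsetChains X) (fun c : Finset (Set E) => convexHull ℝ (p '' c)) p where
  subset_iff := fun c hc c' hc' => by
    refine ⟨fun h τ hτ => ?_, fun h => convexHull_mono (Set.image_mono (Finset.coe_subset.2 h))⟩
    exact hX.mem_of_center_mem hp hc' (hc.1 hτ) (h (subset_convexHull ℝ _ ⟨τ, hτ, rfl⟩))
  empty := by simp
  singleton := fun v _ => by simp

theorem IsCellComplex.isSimplicialComplex_centers (hX : IsCellComplex X)
    (hp : IsCenterChoice X p) : IsSimplicialComplex
      ((fun c : Finset (Set E) => convexHull ℝ (p '' c)) '' finsetChains X) := by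
  classical
  have himage : (fun c : Finset (Set E) => convexHull ℝ (p '' c)) '' finsetChains X =
      (fun s : Finset E => convexHull ℝ (s : Set E)) '' (Finset.image p '' finsetChains X) := by
    rw [Set.image_image]
    simp only [Finset.coe_image]
  rw [himage]
  refine isSimplicialComplex_image_convexHull ((finite_finsetChains hX.finite).image _) ?_ ?_ ?_
  · rintro _ t ht ⟨c, hc, rfl⟩
    obtain ⟨d, hd, rfl⟩ := Finset.subset_image_iff.1 ht
    exact ⟨d, finsetChains_mono_mem hc (by exact_mod_cast hd), rfl⟩
  · rintro _ ⟨c, hc, rfl⟩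
    have := hX.affineIndependent_centers hp hc
    rw [← Finset.coe_image] at this
    exact this
  · rintro _ ⟨c, hc, rfl⟩ _ ⟨c', hc', rfl⟩
    rw [Finset.coe_image, Finset.coe_image, ← (hX.center_injOn hp).image_inter hc.1 hc'.1]
    exact hX.convexHull_centers_inter hp hc hc'

/-- The conclusion contains the poset property for `D` as well, so that the statement can be
iterated. -/
theorem IsDerivedSubdivision.nonEvasive {C D : Set (Set E)} (hC : IsPolytopalComplex C)
    (hD : IsDerivedSubdivision C D) (hne : PosetNonEvasive (cells C)) :
    IsSimplicialComplex D ∧ PosetNonEvasive (cells D) ∧ NonEvasive D ∧ Collapsible D := by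
  classical
  obtain ⟨σ, hσ⟩ := hne.nonempty
  have hempty : ∅ ∈ C := hC.face_mem σ hσ.1 ∅ isExposed_empty
  obtain ⟨p, hp, rfl⟩ := hD.exists_eq_image hC hempty
  have hX := hC.isCellComplex
  have hreal := hX.isRealization_centers hp
  refine ⟨hX.isSimplicialComplex_centers hp, ?_,
    hreal.nonEvasive (isLowerSet_finsetChains _) hne.absNonEvasive,
    hreal.collapsible (isLowerSet_finsetChains _) hne.absNonEvasive⟩
  have := hne.finsetChains.image (φ := fun c : Finset (Set E) => convexHull ℝ (p '' c))
    fun c hc d hd => hreal.subset_iff c hc.1 d hd.1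
  convert this using 1
  ext ρ
  constructor
  · rintro ⟨⟨c, hc, rfl⟩, hρ⟩
    refine ⟨c, ⟨hc, ?_⟩, rfl⟩
    simpa using hρ
  · rintro ⟨c, ⟨hc, hcne⟩, rfl⟩
    refine ⟨⟨c, hc, rfl⟩, ?_⟩
    simpa using hcne

theorem IsIteratedDerived.nonEvasive {C : Set (Set E)} (hC : IsPolytopalComplex C)
    (hne : PosetNonEvasive (cells C)) (r : ℕ) {D : Set (Set E)}
    (hD : IsIteratedDerived (r + 1) C D) :
    IsSimplicialComplex D ∧ PosetNonEvasive (cells D) ∧ NonEvasive D ∧ Collapsible D := by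
  induction r generalizing D with
  | zero =>
    obtain ⟨D', rfl, hD⟩ := hD
    exact hD.nonEvasive hC hne
  | succ r ih =>
    obtain ⟨D', hD', hD⟩ := hD
    obtain ⟨h1, h2, -⟩ := ih hD'
    exact hD.nonEvasive h1.1 h2

end Chains

/-! ### Moving the star center to the origin. -/

section Translation

variable {E : Type*} [NormedAddCommGroup E] [NormedSpace ℝ E] [FiniteDimensional ℝ E]

theorem minFace_preimage_add (σ : Set E) (x y : E) :
    minFace ((fun z => z + x) ⁻¹' σ) y = (fun z => z + x) ⁻¹' minFace σ (y + x) := by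
  ext z
  constructor
  · rintro ⟨hz, w, hw, a, b, ha, hb, hab, rfl⟩
    refine ⟨hz, w + x, hw, a, b, ha, hb, hab, ?_⟩
    have : x = a • x + b • x := by rw [← add_smul, hab, one_smul]
    nth_rewrite 3 [this]
    module
  · rintro ⟨hz, w, hw, a, b, ha, hb, hab, heq⟩
    refine ⟨hz, w - x, by simpa using hw, a, b, ha, hb, hab, ?_⟩
    have : x = a • x + b • x := by rw [← add_smul, hab, one_smul]
    have h2 : y = a • (z + x) + b • w - x := by rw [heq]; abel
    rw [h2]
    nth_rewrite 3 [this]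
    module

theorem IsCellComplex.preimage_add {X : Set (Set E)} (hX : IsCellComplex X) (x : E) :
    IsCellComplex ((fun σ => (fun z => z + x) ⁻¹' σ) '' X) where
  finite := hX.finite.image _
  nonempty := by
    rintro _ ⟨σ, hσ, rfl⟩
    obtain ⟨y, hy⟩ := hX.nonempty σ hσ
    exact ⟨y - x, by simpa using hy⟩
  isPolyhedron := by
    classical
    rintro _ ⟨σ, hσ, rfl⟩
    obtain ⟨T, rfl⟩ := hX.isPolyhedron σ hσ
    refine ⟨T.image fun c => (c.1, c.2 - c.1 x), ?_⟩
    ext y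
    simp only [Finset.forall_mem_image, le_sub_iff_add_le, ← map_add]
    rfl
  minFace_mem := by
    rintro _ ⟨σ, hσ, rfl⟩ y hy
    exact ⟨_, hX.minFace_mem σ hσ _ hy, (minFace_preimage_add σ x y).symm⟩
  minFace_eq := by
    rintro _ ⟨σ, hσ, rfl⟩ _ ⟨τ, hτ, rfl⟩ y hyσ hyτ
    rw [minFace_preimage_add, minFace_preimage_add, hX.minFace_eq σ hσ τ hτ _ hyσ hyτ]

/-- The order complex of the faces of a star-shaped polytopal complex is non-evasive. -/
theorem IsPolytopalComplex.posetNonEvasive_cells {C : Set (Set E)} (hC : IsPolytopalComplex C)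
    (hstar : IsStarShaped (space C)) : PosetNonEvasive (cells C) := by
  obtain ⟨x, ⟨σ, hσ, hxσ⟩, hstar⟩ := hstar
  have hX := hC.isCellComplex
  have hsp : ∀ y, y ∈ ⋃₀ ((fun σ => (fun z => z + x) ⁻¹' σ) '' cells C) ↔ y + x ∈ space C := by
    intro y
    constructor
    · rintro ⟨_, ⟨τ, hτ, rfl⟩, hy⟩
      exact ⟨τ, hτ.1, hy⟩
    · rintro ⟨τ, hτ, hy⟩
      exact ⟨_, ⟨τ, ⟨hτ, _, hy⟩, rfl⟩, hy⟩
  have h := (hX.preimage_add x).posetNonEvasive ⊤ (fun _ _ _ _ => trivial)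
    (starConvex_zero_iff.2 fun y hy t ht ht1 => by
      rw [hsp] at hy ⊢
      have := hstar hy (sub_nonneg.2 ht1) ht (by ring)
      convert this using 1
      module)
    ((hsp 0).2 ⟨σ, hσ, by simpa using hxσ⟩)
  refine h.of_image rfl fun σ _ τ _ => ?_
  exact Set.preimage_subset_preimage_iff (by
    rw [(add_right_surjective x).range_eq]; exact Set.subset_univ _)

end Translation

/-! ### Connectedness and first cohomology mod 2 under vertex removal and splitting. -/

section Cohomology

variable {V : Type*} [DecidableEq V]

/-- Connectedness of an abstract simplicial complex, in terms of `0`-cocycles mod `2`. -/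
def AbsConnected (A : Set (Finset V)) : Prop :=
  ∀ g : V → ZMod 2, (∀ a b, {a, b} ∈ A → g a = g b) → ∀ a b, {a} ∈ A → {b} ∈ A → g a = g b

/-- Vanishing of the first cohomology mod `2` of an abstract simplicial complex. -/
def AbsAcyclicOne (A : Set (Finset V)) : Prop :=
  ∀ f : V → V → ZMod 2, (∀ a b c, {a, b, c} ∈ A → f a b + f b c = f a c) →
    ∃ g : V → ZMod 2, ∀ a b, {a, b} ∈ A → f a b = g a + g b

theorem AbsNonEvasive.exists_vertex {A : Set (Finset V)} (h : AbsNonEvasive A) :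
    ∃ v, {v} ∈ A := by
  cases h with
  | point v => exact ⟨v, by simp⟩
  | step _ v hv => exact ⟨v, hv⟩

theorem mem_absLink_singleton {A : Set (Finset V)} {v a : V} :
    {a} ∈ absLink A v ↔ a ≠ v ∧ {v, a} ∈ A := by
  simp [absLink, eq_comm]

theorem mem_absLink_pair {A : Set (Finset V)} {v a b : V} :
    {a, b} ∈ absLink A v ↔ a ≠ v ∧ b ≠ v ∧ {v, a, b} ∈ A := by
  simp [absLink, eq_comm, and_assoc]

theorem mem_absDel_singleton {A : Set (Finset V)} {v a : V} :
    {a} ∈ absDel A v ↔ {a} ∈ A ∧ a ≠ v := by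
  simp [absDel, eq_comm]

theorem mem_absDel_pair {A : Set (Finset V)} {v a b : V} :
    {a, b} ∈ absDel A v ↔ {a, b} ∈ A ∧ a ≠ v ∧ b ≠ v := by
  simp [absDel, eq_comm]

theorem AbsNonEvasive.absConnected {A : Set (Finset V)} (h : AbsNonEvasive A)
    (hlow : IsLowerSet A) : AbsConnected A := by
  induction h with
  | point v =>
    intro g _ a b ha hb
    have ha : a = v := by simpa using ha
    have hb : b = v := by simpa using hb
    rw [ha, hb]
  | step A v hv hl _ _ ih2 =>
    intro g hg
    obtain ⟨u, hu⟩ := hl.exists_vertex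
    rw [mem_absLink_singleton] at hu
    have huA : {u} ∈ A := hlow (by simp) hu.2
    have hdel := ih2 (isLowerSet_absDel hlow v) g fun a b hab => hg a b hab.1
    have key : ∀ a, {a} ∈ A → g a = g u := fun a ha => by
      by_cases hav : a = v
      · rw [hav]; exact hg v u hu.2
      · exact hdel a u (mem_absDel_singleton.2 ⟨ha, hav⟩) (mem_absDel_singleton.2 ⟨huA, hu.1⟩)
    exact fun a b ha hb => (key a ha).trans (key b hb).symm

theorem cocycle_self {A : Set (Finset V)} {f : V → V → ZMod 2}
    (hf : ∀ a b c, {a, b, c} ∈ A → f a b + f b c = f a c) {a : V} (ha : {a} ∈ A) : f a a = 0 := by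
  have := hf a a a (by simpa using ha)
  simpa using this

theorem cocycle_symm {A : Set (Finset V)} (hlow : IsLowerSet A) {f : V → V → ZMod 2}
    (hf : ∀ a b c, {a, b, c} ∈ A → f a b + f b c = f a c) {a b : V} (h : {a, b} ∈ A) :
    f a b = f b a := by
  have h1 := hf a b a (by rwa [show ({a, b, a} : Finset V) = {a, b} by ext; simp; tauto])
  rw [cocycle_self hf (hlow (by simp) h)] at h1
  exact CharTwo.add_eq_zero.1 h1

/-- A primitive `g` on the deletion exists by induction. On the link, which is connected, f(v, ·) +
g is constant, and this constant is the right value of the primitive at `v`. -/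
theorem AbsNonEvasive.absAcyclicOne {A : Set (Finset V)} (h : AbsNonEvasive A)
    (hlow : IsLowerSet A) : AbsAcyclicOne A := by
  induction h with
  | point v =>
    intro f hf
    refine ⟨fun _ => 0, fun a b hab => ?_⟩
    have ha : {a} ∈ ({∅, {v}} : Set (Finset V)) := hlow (by simp) hab
    have hb : {b} ∈ ({∅, {v}} : Set (Finset V)) := hlow (by simp) hab
    have ha' : a = v := by simpa using ha
    have hb' : b = v := by simpa using hb
    subst ha' hb'
    simpa using cocycle_self hf ha
  | step A v hv hl _ _ ih2 =>
    intro f hf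
    obtain ⟨g, hg⟩ := ih2 (isLowerSet_absDel hlow v) f fun a b c h => hf a b c h.1
    obtain ⟨u, hu⟩ := hl.exists_vertex
    have hconn := hl.absConnected (isLowerSet_absLink hlow v) (fun a => f v a + g a) (by
      intro a b hab
      obtain ⟨ha, hb, habA⟩ := mem_absLink_pair.1 hab
      have h1 := hf v a b habA
      have h2 := hg a b (mem_absDel_pair.2 ⟨hlow (by intro x; simp; tauto) habA, ha, hb⟩)
      rw [← h1, h2]
      have := CharTwo.add_self_eq_zero (g b)
      linear_combination -this)
    refine ⟨Function.update g v (f v u + g u), fun a b hab => ?_⟩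
    have key : ∀ b, {v, b} ∈ A → b ≠ v → f v b = f v u + g u + g b := fun b hb hbv => by
      have := hconn b u (mem_absLink_singleton.2 ⟨hbv, hb⟩) hu
      rw [← this, add_assoc, CharTwo.add_self_eq_zero, add_zero]
    by_cases ha : a = v
    · subst ha
      by_cases hb : b = a
      · subst hb
        rw [cocycle_self hf hv, CharTwo.add_self_eq_zero]
      · rw [Function.update_self, Function.update_of_ne hb]
        exact key b hab hb
    · by_cases hb : b = v
      · subst hb
        rw [Function.update_self, Function.update_of_ne ha, cocycle_symm hlow hf hab, add_comm]
        exact key a (by rwa [Finset.pair_comm]) ha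
      · rw [Function.update_of_ne ha, Function.update_of_ne hb]
        exact hg a b (mem_absDel_pair.2 ⟨hab, ha, hb⟩)

/-- A locally constant function on the deletion is constant on the connected link, so it extends
over `u` by that value. -/
theorem AbsConnected.absDel {A : Set (Finset V)} (hA : AbsConnected A) (hlow : IsLowerSet A) {u : V}
    (hl : AbsNonEvasive (absLink A u)) : AbsConnected (absDel A u) := by
  intro g hg a b ha hb
  obtain ⟨w, hw⟩ := hl.exists_vertex
  have hlink : ∀ y, {u, y} ∈ A → y ≠ u → g y = g w := fun y hy hyu =>
    hl.absConnected (isLowerSet_absLink hlow u) g (fun a b hab => by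
      obtain ⟨h1, h2, h3⟩ := mem_absLink_pair.1 hab
      exact hg a b (mem_absDel_pair.2 ⟨hlow (by intro x; simp; tauto) h3, h1, h2⟩))
      y w (mem_absLink_singleton.2 ⟨hyu, hy⟩) hw
  obtain ⟨ha, hau⟩ := mem_absDel_singleton.1 ha
  obtain ⟨hb, hbu⟩ := mem_absDel_singleton.1 hb
  have := hA (Function.update g u (g w)) (fun x y hxy => by
    by_cases hx : x = u
    · subst hx
      by_cases hy : y = x
      · rw [hy]
      · rw [Function.update_self, Function.update_of_ne hy, hlink y hxy hy]
    · by_cases hy : y = u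
      · subst hy
        rw [Function.update_self, Function.update_of_ne hx,
          hlink x (by rwa [Finset.pair_comm]) hx]
      · rw [Function.update_of_ne hx, Function.update_of_ne hy]
        exact hg x y (mem_absDel_pair.2 ⟨hxy, hx, hy⟩)) a b ha hb
  rwa [Function.update_of_ne hau, Function.update_of_ne hbu] at this

/-- A cocycle on the deletion is a coboundary of some h on the acyclic link; setting f(u, x) = h(x)
extends it to a cocycle on all of `A`. -/
theorem AbsAcyclicOne.absDel {A : Set (Finset V)} (hA : AbsAcyclicOne A) (hlow : IsLowerSet A)
    {u : V} (hl : AbsNonEvasive (absLink A u)) : AbsAcyclicOne (absDel A u) := by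
  intro f hf
  obtain ⟨h, hh⟩ := hl.absAcyclicOne (isLowerSet_absLink hlow u) f (fun a b c habc =>
    hf a b c ⟨absLink_subset hlow u habc, habc.1⟩)
  have hpair : ∀ x y, x ≠ u → y ≠ u → {u, x, y} ∈ A → f x y = h x + h y := fun x y hx hy hxy =>
    hh x y (mem_absLink_pair.2 ⟨hx, hy, hxy⟩)
  obtain ⟨g, hg⟩ := hA (fun x y => if x = u then (if y = u then 0 else h y) else
    if y = u then h x else f x y) (by
      intro x y z hxyz
      have e2 := fun r : ZMod 2 => CharTwo.add_self_eq_zero r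
      by_cases hx : x = u <;> by_cases hy : y = u <;> by_cases hz : z = u <;>
        simp only [hx, hy, hz, if_true, if_false, add_zero, zero_add, e2]
      · rw [hpair y z hy hz (by rwa [hx] at hxyz), ← add_assoc, e2, zero_add]
      · rw [hpair x z hx hz (by
          rw [hy] at hxyz; rwa [show ({u, x, z} : Finset V) = {x, u, z} by ext; simp; tauto])]
      · rw [hpair x y hx hy (by
          rw [hz] at hxyz; rwa [show ({u, x, y} : Finset V) = {x, y, u} by ext; simp; tauto]),
          add_assoc, e2, add_zero]
      · exact hf x y z ⟨hxyz, by simp [Ne.symm hx, Ne.symm hy, Ne.symm hz]⟩)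
  refine ⟨g, fun a b hab => ?_⟩
  obtain ⟨hab, ha, hb⟩ := mem_absDel_pair.1 hab
  simpa [ha, hb] using hg a b hab

/-- A connected graph on a linearly ordered vertex set in which each vertex has at most one smaller
neighbor is non-evasive. -/
theorem absNonEvasive_of_unique_lower_neighbor {L : Set (Finset V)} (hlow : IsLowerSet L)
    (hfin : {a | {a} ∈ L}.Finite) (hcard : ∀ s ∈ L, s.card ≤ 2) (m : V → ℝ)
    (hm : ∀ a b, {a} ∈ L → {b} ∈ L → m a = m b → a = b)
    (huniq : ∀ a b b', {a, b} ∈ L → {a, b'} ∈ L → m b < m a → m b' < m a → b = b')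
    (hconn : AbsConnected L) (hne : ∃ a, {a} ∈ L) : AbsNonEvasive L := by
  induction hn : {a | {a} ∈ L}.ncard using Nat.strong_induction_on generalizing L with
  | _ n ih =>
    obtain ⟨a, ha, hmax⟩ := hfin.exists_maximalFor m _ hne
    have ha : {a} ∈ L := ha
    have hlt : ∀ b, {b} ∈ L → b ≠ a → m b < m a := fun b hb hba => by
      rcases lt_trichotomy (m b) (m a) with h | h | h
      · exact h
      · exact absurd (hm b a hb ha h) hba
      · exact absurd (hmax hb h.le) h.not_ge
    by_cases honly : ∀ b, {b} ∈ L → b = a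
    · have : L = {∅, {a}} := by
        ext s
        constructor
        · intro hs
          exact Finset.subset_singleton_iff.1 fun x hx =>
            Finset.mem_singleton.2 (honly x (hlow (Finset.singleton_subset_iff.2 hx) hs))
        · rintro (rfl | rfl)
          · exact hlow (Finset.empty_subset _) ha
          · exact ha
      rw [this]; exact .point a
    push Not at honly
    obtain ⟨c, hc, hca⟩ := honly
    -- The top vertex `a` is not isolated, by connectedness. All its neighbors are lower, so there
    -- is exactly one and `a` is a leaf.
    obtain ⟨b, hba, hab⟩ : ∃ b, b ≠ a ∧ {a, b} ∈ L := by
      by_contra hcon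
      push Not at hcon
      have := hconn (fun x => if x = a then 1 else 0) (fun x y hxy => by
        by_cases hx : x = a
        · by_cases hy : y = a
          · simp [hx, hy]
          · exact absurd (hx ▸ hxy) (hcon y hy)
        · by_cases hy : y = a
          · exact absurd (by rw [← hy, Finset.pair_comm]; exact hxy) (hcon x hx)
          · simp [hx, hy]) a c ha hc
      simp [hca] at this
    have hbL : {b} ∈ L := hlow (by simp) hab
    have hunb : ∀ b', b' ≠ a → {a, b'} ∈ L → b' = b := fun b' hb' h =>
      huniq a b' b h hab (hlt b' (hlow (by simp) h) hb') (hlt b hbL hba)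
    have hlink : absLink L a = {∅, {b}} := by
      ext s
      constructor
      · rintro ⟨has, hs⟩
        have hc2 := hcard _ hs
        rw [Finset.card_insert_of_notMem has] at hc2
        refine Finset.subset_singleton_iff.1 fun x hx => Finset.mem_singleton.2 ?_
        refine hunb x (fun h => has (h ▸ hx)) (hlow ?_ hs)
        exact Finset.insert_subset_insert a (Finset.singleton_subset_iff.2 hx)
      · rintro (rfl | rfl)
        · exact ⟨by simp, by simpa using ha⟩
        · exact ⟨by simpa using hba.symm, hab⟩
    refine .step L a ha (by rw [hlink]; exact .point b) ?_
    have hsub : {x | {x} ∈ absDel L a} ⊆ {x | {x} ∈ L} := fun x hx => hx.1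
    have hbdel : {b} ∈ absDel L a := mem_absDel_singleton.2 ⟨hbL, hba⟩
    refine ih _ ?_ (isLowerSet_absDel hlow a) (hfin.subset hsub) (fun s hs => hcard s hs.1)
      (fun x y hx hy => hm x y hx.1 hy.1) (fun x y z hy hz => huniq x y z hy.1 hz.1) ?_
      ⟨b, hbdel⟩ rfl
    · rw [← hn]
      exact Set.ncard_lt_ncard ⟨hsub, fun h => (mem_absDel_singleton.1 (h ha)).2 rfl⟩ hfin
    · refine hconn.absDel hlow ?_
      rw [hlink]; exact .point b

/-- The part of `A` spanned by `v` and the vertices on which `k` takes the value `i`. -/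
def absPart (A : Set (Finset V)) (v : V) (k : V → ZMod 2) (i : ZMod 2) : Set (Finset V) :=
  {s ∈ A | ∀ x ∈ s, x = v ∨ k x = i}

section Split

variable {A : Set (Finset V)} {v : V} {k : V → ZMod 2}

theorem isLowerSet_absPart (hlow : IsLowerSet A) (i : ZMod 2) : IsLowerSet (absPart A v k i) :=
  fun _ _ hst hs => ⟨hlow hst hs.1, fun x hx => hs.2 x (hst hx)⟩

/-- A function on one part extends to `A` by its value at `v` on the other part, since the two parts
touch only at `v`. -/
theorem AbsConnected.absPart (hA : AbsConnected A)
    (hk : ∀ x y, x ≠ v → y ≠ v → {x, y} ∈ A → k x = k y) (i : ZMod 2) :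
    AbsConnected (absPart A v k i) := by
  classical
  intro g hg a b ha hb
  have := hA (fun x => if x = v ∨ k x = i then g x else g v) (fun x y hxy => by
    by_cases hx : x = v ∨ k x = i
    · by_cases hy : y = v ∨ k y = i
      · simp only [hx, hy, if_true]
        refine hg x y ⟨hxy, fun z hz => ?_⟩
        rcases Finset.mem_insert.1 hz with rfl | hz
        · exact hx
        · rw [Finset.mem_singleton.1 hz]; exact hy
      · have hxv : x = v := by
          by_contra hxv
          push Not at hy
          exact hy.2 ((hk x y hxv hy.1 hxy).symm.trans (hx.resolve_left hxv))
        rw [if_pos hx, if_neg hy, hxv]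
    · by_cases hy : y = v ∨ k y = i
      · have hyv : y = v := by
          by_contra hyv
          push Not at hx
          exact hx.2 ((hk x y hx.1 hyv hxy).trans (hy.resolve_left hyv))
        rw [if_neg hx, if_pos hy, hyv]
      · simp only [hx, hy, if_false]) a b ha.1 hb.1
  have ha' := ha.2 a (by simp)
  have hb' := hb.2 b (by simp)
  simpa only [ha', hb', if_true] using this

/-- A cocycle on the part is extended by zero. A simplex with a vertex outside the part meets the
part at most in `v`, where the cocycle vanishes. -/
theorem AbsAcyclicOne.absPart (hA : AbsAcyclicOne A) (hlow : IsLowerSet A) (hv : {v} ∈ A)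
    (hk : ∀ x y, x ≠ v → y ≠ v → {x, y} ∈ A → k x = k y) (i : ZMod 2) :
    AbsAcyclicOne (absPart A v k i) := by
  classical
  intro f hf
  have hvv : f v v = 0 := cocycle_self hf ⟨hv, fun x hx => Or.inl (Finset.mem_singleton.1 hx)⟩
  set f' : V → V → ZMod 2 := fun x y => if (x = v ∨ k x = i) ∧ (y = v ∨ k y = i) then f x y else 0
    with hf'
  obtain ⟨g, hg⟩ := hA f' (by
    intro x y z hxyz
    by_cases hall : ∀ w ∈ ({x, y, z} : Finset V), w = v ∨ k w = i
    · have hx := hall x (by simp)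
      have hy := hall y (by simp)
      have hz := hall z (by simp)
      simp only [hf', hx, hy, hz, and_self, if_true]
      exact hf x y z ⟨hxyz, hall⟩
    · push Not at hall
      obtain ⟨w, hw, hwv, hwi⟩ := hall
      have hzero : ∀ a ∈ ({x, y, z} : Finset V), ∀ b ∈ ({x, y, z} : Finset V), f' a b = 0 := by
        have hcase : ∀ a ∈ ({x, y, z} : Finset V), (a = v ∨ k a = i) → a = v := by
          intro a ha hai
          by_contra hav
          refine hwi ((hk w a hwv hav (hlow ?_ hxyz)).trans (hai.resolve_left hav))
          exact Finset.insert_subset hw (Finset.singleton_subset_iff.2 ha)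
        intro a ha b hb
        simp only [hf']
        split_ifs with h
        · rw [hcase a ha h.1, hcase b hb h.2, hvv]
        · rfl
      rw [hzero x (by simp) y (by simp), hzero y (by simp) z (by simp),
        hzero x (by simp) z (by simp), add_zero])
  refine ⟨g, fun a b hab => ?_⟩
  have ha := hab.2 a (by simp)
  have hb := hab.2 b (by simp)
  rw [← hg a b hab.1]
  simp only [hf', ha, hb, and_self, if_true]

theorem absLink_absPart (hlow : IsLowerSet A)
    (hk : ∀ x y, x ≠ v → y ≠ v → {x, y} ∈ A → k x = k y) {u : V} (hu : u ≠ v) :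
    absLink (absPart A v k (k u)) u = absLink A u := by
  ext s
  refine ⟨fun h => ⟨h.1, h.2.1⟩, fun h => ⟨h.1, h.2, fun x hx => ?_⟩⟩
  by_cases hxv : x = v
  · exact Or.inl hxv
  · exact Or.inr (hk x u hxv hu (hlow
      (Finset.insert_subset hx (Finset.singleton_subset_iff.2 (Finset.mem_insert_self u s))) h.2))

/-- If the link of `v` is disconnected, then `v` is a cut vertex. -/
theorem AbsAcyclicOne.exists_split (hA : AbsAcyclicOne A)
    (hl : ¬ AbsConnected (absLink A v)) : ∃ k : V → ZMod 2,
      (∀ x y, x ≠ v → y ≠ v → {x, y} ∈ A → k x = k y) ∧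
      ∃ a b, a ≠ v ∧ b ≠ v ∧ {v, a} ∈ A ∧ {v, b} ∈ A ∧ k a ≠ k b := by
  unfold AbsConnected at hl
  push Not at hl
  obtain ⟨g₀, hg₀, a, b, ha, hb, hab⟩ := hl
  rw [mem_absLink_singleton] at ha hb
  have e2 := fun r : ZMod 2 => CharTwo.add_self_eq_zero r
  -- The cochain equal to g₀ on edges at `v` and zero elsewhere is a cocycle, because g₀ is locally
  -- constant on the link. Its primitive is locally constant away from `v` and still separates `a`
  -- from `b`.
  obtain ⟨g, hg⟩ := hA (fun x y => if x = v then (if y = v then 0 else g₀ y) else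
    if y = v then g₀ x else 0) (by
      have hpair : ∀ x y, x ≠ v → y ≠ v → {v, x, y} ∈ A → g₀ x = g₀ y := fun x y hx hy h =>
        hg₀ x y (mem_absLink_pair.2 ⟨hx, hy, h⟩)
      intro x y z hxyz
      by_cases hx : x = v <;> by_cases hy : y = v <;> by_cases hz : z = v <;>
        simp only [hx, hy, hz, if_true, if_false, add_zero, zero_add, e2]
      · exact hpair y z hy hz (by rwa [hx] at hxyz)
      · rw [hpair x z hx hz (by
          rw [hy] at hxyz; rwa [show ({v, x, z} : Finset V) = {x, v, z} by ext; simp; tauto]), e2]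
      · exact (hpair x y hx hy (by
          rw [hz] at hxyz; rwa [show ({v, x, y} : Finset V) = {x, y, v} by ext; simp; tauto])).symm)
  refine ⟨g, fun x y hx hy hxy => ?_, a, b, ha.1, hb.1, ha.2, hb.2, fun h => hab ?_⟩
  · have := hg x y hxy
    simp only [hx, hy, if_false] at this
    exact CharTwo.add_eq_zero.1 this.symm
  · have h1 := hg v a ha.2
    have h2 := hg v b hb.2
    simp only [if_true, ha.1, hb.1, if_false] at h1 h2
    rw [h1, h2, h]

end Split

end Cohomology

/-! ### Acyclic simplicial complexes in the plane. -/

section Plane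

variable {E : Type*} [NormedAddCommGroup E] [NormedSpace ℝ E] [FiniteDimensional ℝ E]
  [DecidableEq E]

/-- A finite simplicial complex with affinely independent, properly intersecting simplices. -/
structure IsEmbedded (A : Set (Finset E)) : Prop where
  finite : A.Finite
  isLowerSet : IsLowerSet A
  affineIndependent : ∀ s ∈ A, AffineIndependent ℝ ((↑) : s → E)
  inter_subset : ∀ s ∈ A, ∀ t ∈ A,
    convexHull ℝ (s : Set E) ∩ convexHull ℝ (t : Set E) ⊆ convexHull ℝ ((s : Set E) ∩ t)

theorem IsEmbedded.mono {A B : Set (Finset E)} (hB : IsEmbedded B) (hAB : A ⊆ B)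
    (hA : IsLowerSet A) : IsEmbedded A :=
  ⟨hB.finite.subset hAB, hA, fun s hs => hB.affineIndependent s (hAB hs),
    fun s hs t ht => hB.inter_subset s (hAB hs) t (hAB ht)⟩

theorem IsEmbedded.finite_vertices {A : Set (Finset E)} (hA : IsEmbedded A) :
    {a | {a} ∈ A}.Finite :=
  hA.finite.preimage (f := fun a : E => ({a} : Finset E)) Finset.singleton_injective.injOn

/-- The edges at a vertex `v` that is maximal for `ν` are ordered by their slopes. -/
theorem IsEmbedded.absNonEvasive_link {A : Set (Finset E)} (hA : IsEmbedded A)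
    (hdim : Module.finrank ℝ E = 2) {ν μ : Module.Dual ℝ E}
    (hνμ : ∀ x, ν x = 0 → μ x = 0 → x = 0) {v : E}
    (hmax : ∀ a, {a} ∈ A → a ≠ v → ν a < ν v) (hconn : AbsConnected (absLink A v))
    (hne : ∃ a, {a} ∈ absLink A v) : AbsNonEvasive (absLink A v) := by
  have hlow := hA.isLowerSet
  have hpos : ∀ a, {a} ∈ absLink A v → 0 < ν v - ν a := fun a ha => by
    obtain ⟨h1, h2⟩ := mem_absLink_singleton.1 ha
    linarith [hmax a (hlow (by simp) h2) h1]
  -- Slope of the edge from `v` to a in the coordinates (ν, μ); the denominator is positive on the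
  -- link by maximality of `v`.
  set m : E → ℝ := fun a => (μ a - μ v) / (ν v - ν a) with hm
  -- Equal slopes put a on the segment from `v` to b, and proper intersection forces a = b.
  have hinj : ∀ a b, {a} ∈ absLink A v → {b} ∈ absLink A v → ν v - ν a ≤ ν v - ν b →
      m a = m b → a = b := by
    intro a b ha hb hle hab
    have hα := hpos a ha
    have hβ := hpos b hb
    simp only [hm] at hab
    rw [div_eq_div_iff hα.ne' hβ.ne'] at hab
    have heq : (ν v - ν b) • (a - v) - (ν v - ν a) • (b - v) = 0 := by
      refine hνμ _ ?_ ?_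
      · simp only [map_sub, map_smul, smul_eq_mul]; ring
      · simp only [map_sub, map_smul, smul_eq_mul]; linarith
    have hmem : a ∈ convexHull ℝ (({v, b} : Finset E) : Set E) := by
      rw [Finset.coe_pair, convexHull_pair]
      refine ⟨1 - (ν v - ν a) / (ν v - ν b), (ν v - ν a) / (ν v - ν b), ?_, by positivity,
        by ring, ?_⟩
      · rw [sub_nonneg]; exact div_le_one_of_le₀ hle hβ.le
      · have h1 : a - v = ((ν v - ν a) / (ν v - ν b)) • (b - v) := by
          have h2 : (ν v - ν b) • (a - v) = (ν v - ν a) • (b - v) := sub_eq_zero.1 heq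
          have h3 : a - v = (1 / (ν v - ν b)) • ((ν v - ν b) • (a - v)) := by
            rw [smul_smul, one_div_mul_cancel hβ.ne', one_smul]
          rw [h3, h2, smul_smul, one_div_mul_eq_div]
        have h4 : a = ((ν v - ν a) / (ν v - ν b)) • (b - v) + v := sub_eq_iff_eq_add.1 h1
        generalize (ν v - ν a) / (ν v - ν b) = c at h4 ⊢
        refine Eq.trans ?_ h4.symm
        module
    obtain ⟨hav, haA⟩ := mem_absLink_singleton.1 ha
    obtain ⟨hbv, hbA⟩ := mem_absLink_singleton.1 hb
    have := hA.inter_subset {a} (hlow (by simp) haA) {v, b} hbA ⟨by simp, hmem⟩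
    obtain ⟨x, hx1, hx2⟩ := convexHull_nonempty_iff.1 ⟨a, this⟩
    have hxa : x = a := by simpa using hx1
    rw [hxa] at hx2
    have : a = v ∨ a = b := by simpa using hx2
    exact this.resolve_left hav
  have hinj' : ∀ a b, {a} ∈ absLink A v → {b} ∈ absLink A v → m a = m b → a = b := by
    intro a b ha hb hab
    rcases le_total (ν v - ν a) (ν v - ν b) with h | h
    · exact hinj a b ha hb h hab
    · exact (hinj b a hb ha h hab.symm).symm
  -- An edge at `v` with slope strictly between those of a and b' would enter the triangle v, a, b'
  -- near `v`, contrary to proper intersection. So a has at most one neighbor of smaller slope.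
  have hbetween : ∀ a b b', {a, b} ∈ absLink A v → {a, b'} ∈ absLink A v → m b' < m b →
      m b < m a → False := by
    intro a b b' hab hab' h1 h2
    have hll := isLowerSet_absLink hlow v
    have ha : {a} ∈ absLink A v := hll (by simp) hab
    have hb : {b} ∈ absLink A v := hll (by simp) hab
    have hb' : {b'} ∈ absLink A v := hll (by simp) hab'
    have hα := hpos a ha
    have hβ := hpos b hb
    have hγ := hpos b' hb'
    have hD : 0 < m a - m b' := by linarith
    set s := (m b - m b') / (m a - m b') with hs
    set t := (m a - m b) / (m a - m b') with ht
    have hs0 : 0 < s := div_pos (by linarith) hD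
    have ht0 : 0 < t := div_pos (by linarith) hD
    have hst : s + t = 1 := by rw [hs, ht]; field_simp; ring
    have hstm : s * m a + t * m b' = m b := by rw [hs, ht]; field_simp; ring
    set P := (ν v - ν b) * s / (ν v - ν a) with hP
    set Q := (ν v - ν b) * t / (ν v - ν b') with hQ
    have hP0 : 0 < P := by positivity
    have hQ0 : 0 < Q := by positivity
    have hPa : P * (ν v - ν a) = (ν v - ν b) * s := by rw [hP]; field_simp
    have hQb : Q * (ν v - ν b') = (ν v - ν b) * t := by rw [hQ]; field_simp
    have hma : μ a - μ v = m a * (ν v - ν a) := by simp only [hm]; field_simp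
    have hmb : μ b - μ v = m b * (ν v - ν b) := by simp only [hm]; field_simp
    have hmb' : μ b' - μ v = m b' * (ν v - ν b') := by simp only [hm]; field_simp
    have heq : b - v = P • (a - v) + Q • (b' - v) := by
      rw [← sub_eq_zero]
      refine hνμ _ ?_ ?_
      · simp only [map_sub, map_add, map_smul, smul_eq_mul]
        linear_combination hPa + hQb + (ν v - ν b) * hst
      · simp only [map_sub, map_add, map_smul, smul_eq_mul]
        rw [hma, hmb, hmb']
        linear_combination (-m a) * hPa + (-m b') * hQb - (ν v - ν b) * hstm
    obtain ⟨-, -, habA⟩ := mem_absLink_pair.1 hab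
    obtain ⟨hav, hb'v, habA'⟩ := mem_absLink_pair.1 hab'
    obtain ⟨hbv, hbA⟩ := mem_absLink_singleton.1 hb
    -- Small enough that v + ε(b − v) is a convex combination of v, a, b' with weights ε, εP, εQ.
    set ε := 1 / (1 + P + Q) with hε
    have hε0 : 0 < ε := by positivity
    have hε1 : ε ≤ 1 := by rw [hε, div_le_one (by positivity)]; linarith
    have hεPQ : 1 - ε * P - ε * Q = ε := by rw [hε]; field_simp; ring
    have hx1 : v + ε • (b - v) ∈ convexHull ℝ (({v, b} : Finset E) : Set E) := by
      rw [Finset.coe_pair, convexHull_pair]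
      exact ⟨1 - ε, ε, by linarith, hε0.le, by ring, by module⟩
    have hx2 : v + ε • (b - v) ∈ convexHull ℝ (({v, a, b'} : Finset E) : Set E) := by
      have hmem : ∀ z ∈ ({v, a, b'} : Finset E),
          z ∈ convexHull ℝ (({v, a, b'} : Finset E) : Set E) :=
        fun z hz => subset_convexHull ℝ _ hz
      have hconv := convex_convexHull ℝ (({v, a, b'} : Finset E) : Set E)
      have h5 := hconv.sum_mem (t := Finset.univ) (w := ![ε, ε * P, ε * Q]) (z := ![v, a, b'])
        (by intro i _; fin_cases i <;> simp <;> positivity)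
        (by simp [Fin.sum_univ_three]; linarith)
        (by intro i _; fin_cases i <;> exact hmem _ (by simp))
      have hid : ∀ r p q : ℝ, 1 - r * p - r * q = r →
          v + r • (p • (a - v) + q • (b' - v)) = r • v + (r * p) • a + (r * q) • b' := by
        intro r p q h
        have : v + r • (p • (a - v) + q • (b' - v)) =
            (1 - r * p - r * q) • v + (r * p) • a + (r * q) • b' := by module
        rwa [h] at this
      rw [heq, hid ε P Q hεPQ]
      simpa [Fin.sum_univ_three] using h5
    have hx := hA.inter_subset {v, b} hbA {v, a, b'} habA' ⟨hx1, hx2⟩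
    have hsub : (({v, b} : Finset E) : Set E) ∩ (({v, a, b'} : Finset E) : Set E) ⊆ {v} := by
      rintro z ⟨hz1, hz2⟩
      simp only [Finset.coe_insert, Finset.coe_singleton, Set.mem_insert_iff,
        Set.mem_singleton_iff] at hz1 hz2 ⊢
      rcases hz1 with rfl | rfl
      · rfl
      · rcases hz2 with h | h | h
        · exact h
        · rw [h] at h2; exact absurd h2 (lt_irrefl _)
        · rw [h] at h1; exact absurd h1 (lt_irrefl _)
    have hxv : v + ε • (b - v) = v := by simpa using convexHull_mono hsub hx
    have : ε • (b - v) = 0 := by simpa using hxv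
    exact hbv (sub_eq_zero.1 ((smul_eq_zero.1 this).resolve_left hε0.ne'))
  refine absNonEvasive_of_unique_lower_neighbor (isLowerSet_absLink hlow v)
    (hA.finite_vertices.subset fun a ha => hlow (by simp) (mem_absLink_singleton.1 ha).2) ?_ m
    hinj' ?_ hconn hne
  · intro s hs
    have h1 := (hA.affineIndependent _ hs.2).card_le_finrank_succ
    have h2 : Module.finrank ℝ (vectorSpan ℝ (Set.range ((↑) : ↥(insert v s) → E))) ≤ 2 :=
      hdim ▸ Submodule.finrank_le _
    rw [Fintype.card_coe, Finset.card_insert_of_notMem hs.1] at h1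
    omega
  · intro a b b' hab hab' h1 h2
    have hll := isLowerSet_absLink hlow v
    rcases lt_trichotomy (m b) (m b') with h | h | h
    · exact (hbetween a b' b hab' hab h h2).elim
    · exact hinj' b b' (hll (by simp) hab) (hll (by simp) hab') h
    · exact (hbetween a b b' hab hab' h h1).elim

theorem exists_dual_complement (hdim : Module.finrank ℝ E = 2) {ν : Module.Dual ℝ E} (hν : ν ≠ 0) :
    ∃ μ : Module.Dual ℝ E, ∀ x, ν x = 0 → μ x = 0 → x = 0 := by
  have h1 : Module.finrank ℝ (LinearMap.ker ν) = 1 := by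
    have := Module.Dual.finrank_ker_add_one_of_ne_zero hν
    omega
  obtain ⟨⟨k, hk⟩, hk0, hspan⟩ := finrank_eq_one_iff'.1 h1
  have hk0' : k ≠ 0 := fun h => hk0 (Subtype.ext h)
  obtain ⟨μ, hμ⟩ := Module.exists_dual_forall_apply_ne_zero (K := ℝ) (fun _ : Unit => k)
    (fun _ => hk0')
  refine ⟨μ, fun x hx hμx => ?_⟩
  obtain ⟨c, hc⟩ := hspan ⟨x, hx⟩
  have hc' : c • k = x := congrArg Subtype.val hc
  rw [← hc', map_smul, smul_eq_mul] at hμx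
  rw [← hc', (mul_eq_zero.1 hμx).resolve_right (hμ ()), zero_smul]

theorem AbsConnected.exists_vertex_absLink {A : Set (Finset E)} (hA : AbsConnected A) {v w : E}
    (hv : {v} ∈ A) (hw : {w} ∈ A) (hvw : w ≠ v) : ∃ a, {a} ∈ absLink A v := by
  by_contra hcon
  push Not at hcon
  have := hA (fun x => if x = v then 1 else 0) (fun x y hxy => by
    by_cases hx : x = v
    · by_cases hy : y = v
      · simp [hx, hy]
      · exact absurd (mem_absLink_singleton.2 ⟨hy, hx ▸ hxy⟩) (hcon y)
    · by_cases hy : y = v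
      · exact absurd (mem_absLink_singleton.2 ⟨hx, by rw [← hy, Finset.pair_comm]; exact hxy⟩)
          (hcon x)
      · simp [hx, hy]) v w hv hw
  simp [hvw] at this

/-- The highest and lowest vertices for a generic functional are good if their links are connected.
Otherwise one of them is a cut vertex, and each of two smaller parts has two good vertices by
induction. At least one of these is not the cut vertex, and its link is unchanged in `A`; this is
why two are asked for. -/
theorem IsEmbedded.exists_two_good_vertices {A : Set (Finset E)} (hA : IsEmbedded A)
    (hdim : Module.finrank ℝ E = 2) (hconn : AbsConnected A) (hacyc : AbsAcyclicOne A)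
    {v₁ v₂ : E} (hv₁ : {v₁} ∈ A) (hv₂ : {v₂} ∈ A) (hne : v₁ ≠ v₂) :
    ∃ u u', u ≠ u' ∧ {u} ∈ A ∧ {u'} ∈ A ∧ AbsNonEvasive (absLink A u) ∧
      AbsNonEvasive (absLink A u') := by
  induction hn : {a | {a} ∈ A}.ncard using Nat.strong_induction_on generalizing A v₁ v₂ with
  | _ n ih =>
    have hlow := hA.isLowerSet
    have hfin := hA.finite_vertices
    have hsplit : ∀ v, {v} ∈ A → ¬ AbsConnected (absLink A v) →
        ∃ u u', u ≠ u' ∧ {u} ∈ A ∧ {u'} ∈ A ∧ AbsNonEvasive (absLink A u) ∧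
          AbsNonEvasive (absLink A u') := by
      intro v hv hdis
      obtain ⟨k, hk, a, b, hav, hbv, ha, hb, hab⟩ := hacyc.exists_split hdis
      have hpart : ∀ a b, a ≠ v → b ≠ v → {v, a} ∈ A → {v, b} ∈ A → k a ≠ k b →
          ∃ u, k u = k a ∧ {u} ∈ A ∧ AbsNonEvasive (absLink A u) := by
        intro a b hav hbv ha hb hab
        have haA : {a} ∈ A := hlow (by simp) ha
        have hbA : {b} ∈ A := hlow (by simp) hb
        obtain ⟨u, u', huu', hu, hu', hul, hul'⟩ := ih _ (by
            rw [← hn]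
            refine Set.ncard_lt_ncard ⟨fun x hx => hx.1, fun h => ?_⟩ hfin
            exact ((h hbA).2 b (by simp)).elim hbv fun h' => hab h'.symm)
          (hA.mono (fun s hs => hs.1) (isLowerSet_absPart hlow (k a)))
          (hconn.absPart hk (k a)) (hacyc.absPart hlow hv hk (k a))
          (v₁ := v) (v₂ := a) ⟨hv, fun x hx => Or.inl (by simpa using hx)⟩
          ⟨haA, fun x hx => Or.inr (by rw [Finset.mem_singleton.1 hx])⟩ hav.symm rfl
        have hgood : ∀ u, u ≠ v → {u} ∈ absPart A v k (k a) →
            AbsNonEvasive (absLink (absPart A v k (k a)) u) →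
            ∃ u, k u = k a ∧ {u} ∈ A ∧ AbsNonEvasive (absLink A u) := by
          intro u huv hu hul
          have hku : k u = k a := (hu.2 u (by simp)).resolve_left huv
          rw [← hku, absLink_absPart hlow hk huv] at hul
          exact ⟨u, hku, hu.1, hul⟩
        by_cases huv : u = v
        · exact hgood u' (fun h => huu' (huv.trans h.symm)) hu' hul'
        · exact hgood u huv hu hul
      obtain ⟨u, hku, hu, hul⟩ := hpart a b hav hbv ha hb hab
      obtain ⟨u', hku', hu', hul'⟩ := hpart b a hbv hav hb ha hab.symm
      exact ⟨u, u', fun h => hab (by rw [← hku, ← hku', h]), hu, hu', hul, hul'⟩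
    -- a functional that is injective on the vertices
    obtain ⟨ν, hν⟩ : ∃ ν : Module.Dual ℝ E, ∀ a b, {a} ∈ A → {b} ∈ A → ν a = ν b → a = b := by
      set D := (Set.image2 (fun a b => a - b) {a | {a} ∈ A} {a | {a} ∈ A}) \ {0} with hD
      have := ((hfin.image2 (fun a b : E => a - b) hfin).subset
        (Set.sdiff_subset : D ⊆ _)).to_subtype
      obtain ⟨ν, hν⟩ := Module.exists_dual_forall_apply_ne_zero (K := ℝ) (fun d : D => (d : E))
        (fun d => d.2.2)
      refine ⟨ν, fun a b ha hb hab => ?_⟩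
      by_contra hne
      refine hν ⟨a - b, ⟨a, ha, b, hb, rfl⟩, sub_ne_zero.2 hne⟩ ?_
      rw [map_sub, hab, sub_self]
    have hν0 : ν ≠ 0 := fun h => hne (hν v₁ v₂ hv₁ hv₂ (by simp [h]))
    have hother : ∀ v, ∃ w, {w} ∈ A ∧ w ≠ v := fun v => by
      by_cases h : v₁ = v
      · exact ⟨v₂, hv₂, fun h' => hne (h.trans h'.symm)⟩
      · exact ⟨v₁, hv₁, h⟩
    have htop : ∀ ν : Module.Dual ℝ E, ν ≠ 0 → (∀ a b, {a} ∈ A → {b} ∈ A → ν a = ν b → a = b) →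
        ∃ t, {t} ∈ A ∧ (∀ a, {a} ∈ A → a ≠ t → ν a < ν t) ∧
          (AbsConnected (absLink A t) → AbsNonEvasive (absLink A t)) := by
      intro ν hν0 hν
      obtain ⟨t, ht, hmax⟩ := hfin.exists_maximalFor ν _ ⟨v₁, hv₁⟩
      have hlt : ∀ a, {a} ∈ A → a ≠ t → ν a < ν t := fun a ha hat => by
        rcases lt_trichotomy (ν a) (ν t) with h | h | h
        · exact h
        · exact absurd (hν a t ha ht h) hat
        · exact absurd (hmax ha h.le) h.not_ge
      obtain ⟨μ, hμ⟩ := exists_dual_complement hdim hν0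
      obtain ⟨w, hw, hwt⟩ := hother t
      exact ⟨t, ht, hlt, fun hc => hA.absNonEvasive_link hdim hμ hlt hc
        (hconn.exists_vertex_absLink ht hw hwt)⟩
    obtain ⟨t, ht, htlt, htl⟩ := htop ν hν0 hν
    obtain ⟨b, hb, hblt, hbl⟩ := htop (-ν) (neg_ne_zero.2 hν0) (fun a b ha hb hab =>
      hν a b ha hb (by simpa using hab))
    by_cases hct : AbsConnected (absLink A t)
    · by_cases hcb : AbsConnected (absLink A b)
      · refine ⟨t, b, ?_, ht, hb, htl hct, hbl hcb⟩
        rintro rfl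
        obtain ⟨w, hw, hwt⟩ := hother t
        have h1 := htlt w hw hwt
        have h2 := hblt w hw hwt
        simp only [LinearMap.neg_apply] at h2
        linarith
      · exact hsplit b hb hcb
    · exact hsplit t ht hct

theorem IsEmbedded.absNonEvasive {A : Set (Finset E)} (hA : IsEmbedded A)
    (hdim : Module.finrank ℝ E = 2) (hconn : AbsConnected A) (hacyc : AbsAcyclicOne A)
    (hne : ∃ v, {v} ∈ A) : AbsNonEvasive A := by
  induction hn : {a | {a} ∈ A}.ncard using Nat.strong_induction_on generalizing A with
  | _ n ih =>
    have hlow := hA.isLowerSet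
    obtain ⟨v, hv⟩ := hne
    by_cases honly : ∀ b, {b} ∈ A → b = v
    · have : A = {∅, {v}} := by
        ext s
        constructor
        · intro hs
          exact Finset.subset_singleton_iff.1 fun x hx =>
            Finset.mem_singleton.2 (honly x (hlow (Finset.singleton_subset_iff.2 hx) hs))
        · rintro (rfl | rfl)
          · exact hlow (Finset.empty_subset _) hv
          · exact hv
      rw [this]; exact .point v
    push Not at honly
    obtain ⟨w, hw, hwv⟩ := honly
    obtain ⟨u, u', huu', hu, hu', hul, -⟩ :=
      hA.exists_two_good_vertices hdim hconn hacyc hv hw hwv.symm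
    refine .step A u hu hul (ih _ ?_ (hA.mono (fun s hs => hs.1) (isLowerSet_absDel hlow u))
      (hconn.absDel hlow hul) (hacyc.absDel hlow hul)
      ⟨u', mem_absDel_singleton.2 ⟨hu', huu'.symm⟩⟩ rfl)
    rw [← hn]
    exact Set.ncard_lt_ncard ⟨fun x hx => hx.1, fun h => (mem_absDel_singleton.1 (h hu)).2 rfl⟩
      hA.finite_vertices

end Plane

/-! ### Vertex schemes of geometric complexes and the case of the plane. -/

section VertexScheme

variable {E : Type*} [NormedAddCommGroup E] [NormedSpace ℝ E] [FiniteDimensional ℝ E]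

/-- The vertex scheme of a geometric simplicial complex. -/
def vertexSets (C : Set (Set E)) : Set (Finset E) :=
  {s | AffineIndependent ℝ ((↑) : s → E) ∧ convexHull ℝ (s : Set E) ∈ C}

variable {C : Set (Set E)}

theorem singleton_mem_vertexSets {a : E} : {a} ∈ vertexSets C ↔ {a} ∈ C := by
  constructor
  · intro h
    simpa using h.2
  · intro h
    have : Subsingleton ({a} : Finset E) := ⟨fun x y => Subtype.ext
      ((Finset.mem_singleton.1 x.2).trans (Finset.mem_singleton.1 y.2).symm)⟩
    exact ⟨affineIndependent_of_subsingleton ℝ _, by simpa using h⟩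

theorem IsSimplicialComplex.image_vertexSets (hC : IsSimplicialComplex C) :
    (fun s : Finset E => convexHull ℝ (s : Set E)) '' vertexSets C = C := by
  ext P
  constructor
  · rintro ⟨s, hs, rfl⟩
    exact hs.2
  · intro hP
    obtain ⟨s, hs, rfl⟩ := hC.2 P hP
    exact ⟨s, ⟨hs, hP⟩, rfl⟩

theorem IsPolytopalComplex.isLowerSet_vertexSets (hC : IsPolytopalComplex C) :
    IsLowerSet (vertexSets C) := fun s t hts hs =>
  ⟨hs.1.mono (s := (t : Set E)) (t := (s : Set E)) (by exact_mod_cast hts),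
    hC.face_mem _ hs.2 _ (isExposed_convexHull_of_subset hs.1 hts)⟩

theorem IsPolytopalComplex.mem_of_mem_convexHull (hC : IsPolytopalComplex C) {a : E}
    (ha : {a} ∈ C) {s : Finset E} (hs : s ∈ vertexSets C)
    (has : a ∈ convexHull ℝ (s : Set E)) : a ∈ s := by
  have h := (hC.inter_face _ hs.2 _ ha).1
  rw [Set.inter_eq_right.2 (Set.singleton_subset_iff.2 has)] at h
  exact_mod_cast extremePoints_convexHull_subset (isExtreme_singleton.1 h.isExtreme)

theorem IsPolytopalComplex.convexHull_subset_iff (hC : IsPolytopalComplex C) {s t : Finset E}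
    (hs : s ∈ vertexSets C) (ht : t ∈ vertexSets C) :
    convexHull ℝ (s : Set E) ⊆ convexHull ℝ (t : Set E) ↔ s ⊆ t := by
  refine ⟨fun h a ha => ?_, fun h => convexHull_mono (by exact_mod_cast h)⟩
  exact hC.mem_of_mem_convexHull (singleton_mem_vertexSets.1 (hC.isLowerSet_vertexSets
    (Finset.singleton_subset_iff.2 ha) hs)) ht (h (subset_convexHull ℝ _ ha))

theorem IsPolytopalComplex.isEmbedded_vertexSets (hC : IsPolytopalComplex C) :
    IsEmbedded (vertexSets C) where
  finite := by
    refine Set.Finite.of_finite_image (f := fun s : Finset E => convexHull ℝ (s : Set E))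
      (hC.finite.subset (by rintro _ ⟨s, hs, rfl⟩; exact hs.2)) fun s hs t ht h => ?_
    exact ((hC.convexHull_subset_iff hs ht).1 h.subset).antisymm
      ((hC.convexHull_subset_iff ht hs).1 h.symm.subset)
  isLowerSet := hC.isLowerSet_vertexSets
  affineIndependent _ hs := hs.1
  inter_subset s hs t ht := by
    obtain ⟨h1, -⟩ := hC.inter_face _ hs.2 _ ht.2
    obtain ⟨u, hus, hu⟩ := IsExposed.exists_eq_convexHull h1
    rw [hu]
    have huA := hC.isLowerSet_vertexSets hus hs
    refine convexHull_mono fun a ha => ⟨hus ha, ?_⟩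
    exact (hC.convexHull_subset_iff huA ht).1 (hu ▸ Set.inter_subset_right) ha

theorem IsPolytopalComplex.isRealization_vertexSets (hC : IsPolytopalComplex C) :
    IsRealization (vertexSets C) (fun s : Finset E => convexHull ℝ (s : Set E)) id where
  subset_iff _ hs _ ht := hC.convexHull_subset_iff hs ht
  empty := by simp
  singleton _ _ := by simp

/-- The barycentric subdivision maps simplicially to the complex, sending each simplex to one of its
vertices. -/
theorem IsSimplicialComplex.exists_vertex_map (hC : IsSimplicialComplex C) [DecidableEq E] :
    ∃ m : Set E → E, (∀ a, m {a} = a) ∧ (∀ σ ∈ cells C, m σ ∈ σ) ∧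
      ∀ c ∈ finsetChains (cells C), c.Nonempty → c.image m ∈ vertexSets C := by
  have hex : ∀ σ : Set E, ∃ x, σ ∈ cells C → x ∈ σ ∧ {x} ∈ C := by
    intro σ
    by_cases hσ : σ ∈ cells C
    · obtain ⟨s, hs, rfl⟩ := hC.2 σ hσ.1
      obtain ⟨x, hx⟩ := convexHull_nonempty_iff.1 hσ.2
      exact ⟨x, fun _ => ⟨subset_convexHull ℝ _ hx, singleton_mem_vertexSets.1
        (hC.1.isLowerSet_vertexSets (Finset.singleton_subset_iff.2 hx) ⟨hs, hσ.1⟩)⟩⟩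
    · exact ⟨0, fun h => absurd h hσ⟩
  choose m hm using hex
  classical
  -- The choice is normalized on singletons so that m' {a} = a holds by definition of the map, not
  -- only on cells.
  set m' : Set E → E := fun σ => if h : ∃ a, σ = {a} then h.choose else m σ with hm'
  have hsing : ∀ a, m' {a} = a := by
    intro a
    have h : ∃ b, ({a} : Set E) = {b} := ⟨a, rfl⟩
    simp only [hm', dif_pos h]
    exact (Set.singleton_injective h.choose_spec).symm
  have hmem : ∀ σ ∈ cells C, m' σ ∈ σ ∧ {m' σ} ∈ C := by
    intro σ hσ
    by_cases h : ∃ a, σ = {a}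
    · obtain ⟨a, rfl⟩ := h
      rw [hsing]
      exact ⟨rfl, hσ.1⟩
    · simp only [hm', dif_neg h]
      exact hm σ hσ
  refine ⟨m', hsing, fun σ hσ => (hmem σ hσ).1, fun c hc hne => ?_⟩
  obtain ⟨κ, hκ, hmax⟩ := c.exists_maximal hne
  have hle : ∀ σ ∈ c, σ ⊆ κ := fun σ hσ => by
    rcases hc.2.total hσ hκ with h | h
    · exact h
    · exact hmax hσ h
  obtain ⟨s, hs, hκs⟩ := hC.2 κ (hc.1 hκ).1
  have hsA : s ∈ vertexSets C := ⟨hs, hκs ▸ (hc.1 hκ).1⟩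
  refine hC.1.isLowerSet_vertexSets (fun x hx => ?_) hsA
  obtain ⟨σ, hσ, rfl⟩ := Finset.mem_image.1 hx
  have := hmem σ (hc.1 hσ)
  exact hC.1.mem_of_mem_convexHull this.2 hsA (hκs ▸ hle σ hσ this.1)

theorem singleton_mem_cells {a : E} (h : {a} ∈ vertexSets C) : {a} ∈ cells C :=
  ⟨singleton_mem_vertexSets.1 h, Set.singleton_nonempty a⟩

theorem IsSimplicialComplex.absConnected_vertexSets [DecidableEq E] [DecidableEq (Set E)]
    (hC : IsSimplicialComplex C) (h : AbsConnected (finsetChains (cells C))) :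
    AbsConnected (vertexSets C) := by
  obtain ⟨m, hm1, -, hm⟩ := hC.exists_vertex_map
  intro g hg a b ha hb
  have := h (fun σ => g (m σ)) (fun σ τ hστ => hg _ _ (by
    simpa using hm _ hστ (by simp))) {a} {b} ⟨by simpa using singleton_mem_cells ha, by simp⟩
    ⟨by simpa using singleton_mem_cells hb, by simp⟩
  simpa only [hm1] using this

/-- Pull the cocycle back along the vertex map, take a primitive on the order complex and restrict
it to the vertices. An edge ab is compared with the path through the cell `e` spanned by it, whose
image vertex is a or b. -/
theorem IsSimplicialComplex.absAcyclicOne_vertexSets [DecidableEq E] [DecidableEq (Set E)]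
    (hC : IsSimplicialComplex C) (h : AbsAcyclicOne (finsetChains (cells C))) :
    AbsAcyclicOne (vertexSets C) := by
  obtain ⟨m, hm1, hm2, hm⟩ := hC.exists_vertex_map
  intro f hf
  obtain ⟨G, hG⟩ := h (fun σ τ => f (m σ) (m τ)) (fun σ τ ρ h => hf _ _ _ (by
    simpa [Finset.image_insert] using hm _ h (by simp)))
  refine ⟨fun a => G {a}, fun a b hab => ?_⟩
  have hlow := hC.1.isLowerSet_vertexSets
  have ha : {a} ∈ vertexSets C := hlow (by simp) hab
  have hb : {b} ∈ vertexSets C := hlow (by simp) hab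
  set e := convexHull ℝ (({a, b} : Finset E) : Set E) with he
  have hae : {a} ⊆ e := Set.singleton_subset_iff.2 (subset_convexHull ℝ _ (by simp))
  have hbe : {b} ⊆ e := Set.singleton_subset_iff.2 (subset_convexHull ℝ _ (by simp))
  have heC : e ∈ cells C := ⟨hab.2, a, hae rfl⟩
  have hpair : ∀ x, {x} ∈ vertexSets C → {x} ⊆ e → f x (m e) = G {x} + G e := by
    intro x hx hxe
    have := hG {x} e ⟨by
      intro z hz
      rcases Finset.mem_insert.1 (Finset.mem_coe.1 hz) with rfl | hz
      · exact singleton_mem_cells hx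
      · rw [Finset.mem_singleton.1 hz]; exact heC, by
      rw [Finset.coe_pair]
      exact IsChain.pair hxe⟩
    simpa only [hm1] using this
  have hmA : m e ∈ ({a, b} : Finset E) := by
    have : {m e} ∈ vertexSets C := by
      simpa using hm {e} ⟨by simpa using heC, by simp⟩ (by simp)
    exact hC.1.mem_of_mem_convexHull (singleton_mem_vertexSets.1 this) hab (hm2 e heC)
  have hsum := hf a b (m e) (hlow (by
    intro x hx
    simp only [Finset.mem_insert, Finset.mem_singleton] at hx hmA ⊢
    rcases hx with h | h | h
    · exact Or.inl h
    · exact Or.inr h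
    · exact h ▸ hmA) hab)
  rw [hpair a ha hae, hpair b hb hbe] at hsum
  have h2 := CharTwo.add_self_eq_zero (G {b})
  linear_combination hsum - h2

/-- A star-shaped simplicial complex in the plane is non-evasive and collapsible. -/
theorem IsSimplicialComplex.nonEvasive_of_finrank_eq_two (hC : IsSimplicialComplex C)
    (hdim : Module.finrank ℝ E = 2) (hstar : IsStarShaped (space C)) :
    NonEvasive C ∧ Collapsible C := by
  classical
  have hNE := (hC.1.posetNonEvasive_cells hstar).absNonEvasive
  have hchains := isLowerSet_finsetChains (cells C)
  have hlow := hC.1.isLowerSet_vertexSets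
  have hvert : ∃ a, {a} ∈ vertexSets C := by
    obtain ⟨x, ⟨P, hP, hxP⟩, -⟩ := hstar
    obtain ⟨s, hs, rfl⟩ := hC.2 P hP
    obtain ⟨a, ha⟩ := convexHull_nonempty_iff.1 ⟨x, hxP⟩
    exact ⟨a, hlow (Finset.singleton_subset_iff.2 ha) ⟨hs, hP⟩⟩
  have hA := hC.1.isEmbedded_vertexSets.absNonEvasive hdim
    (hC.absConnected_vertexSets (hNE.absConnected hchains))
    (hC.absAcyclicOne_vertexSets (hNE.absAcyclicOne hchains)) hvert
  have hR := hC.1.isRealization_vertexSets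
  rw [← hC.image_vertexSets]
  exact ⟨hR.nonEvasive hlow hA, hR.collapsible hlow hA⟩

end VertexScheme

end PolytopalComplex

theorem theorem2p2 (d : ℕ) (C : Set (Set (EuclideanSpace ℝ (Fin d))))
    (hC : (3 ≤ d ∧ PolytopalComplex.IsPolytopalComplex C) ∨
      (d = 2 ∧ PolytopalComplex.IsSimplicialComplex C))
    (hstar : PolytopalComplex.IsStarShaped (PolytopalComplex.space C))
    (D : Set (Set (EuclideanSpace ℝ (Fin d))))
    (hD : PolytopalComplex.IsIteratedDerived (d - 2) C D) :
    PolytopalComplex.IsSimplicialComplex D ∧ PolytopalComplex.NonEvasive D ∧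
      PolytopalComplex.Collapsible D := by
  rcases hC with ⟨hd, hC⟩ | ⟨rfl, hC⟩
  -- For d ≥ 3 at least one derived subdivision is taken, and the first one already suffices.
  · rw [show d - 2 = d - 3 + 1 by omega] at hD
    obtain ⟨h1, -, h2, h3⟩ :=
      PolytopalComplex.IsIteratedDerived.nonEvasive hC (hC.posetNonEvasive_cells hstar) _ hD
    exact ⟨h1, h2, h3⟩
  -- For d = 2 the iteration is empty, so the complex itself must be shown non-evasive.
  · obtain rfl : D = C := hD
    exact ⟨hC, hC.nonEvasive_of_finrank_eq_two (by simp) hstar⟩
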